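/- Let $\mathcal V$ be a category with finite limits and small colimits such that, for every object $X$, the functor $X\times -$ preserves connected small colimits (for example, $\mathcal V$ cartesian closed, or the category of based objects of such a category). Let $\mathbf{Cat}(\mathcal V)$ be the 2-category of categories, functors and natural transformations internal to $\mathcal V$ ($\mathcal V$-categories, $\mathcal V$-functors, $\mathcal V$-transformations), and let $\mathcal O$ be a reduced (symmetric) operad in $\mathbf{Cat}(\mathcal V)$, that is, an operad with structure functors $\gamma$, unit $1\colon *\to\mathcal O(1)$, right actions of the symmetric groups, and $\mathcal O(0)$ the trivial $\mathcal V$-category $*$; write $0\in\mathcal O(0)$ for its object. Elements below are generalized elements. An *$\mathcal O$-pseudoalgebra* is a $\mathcal V$-category $\mathcal A$ with $\mathcal V$-functors $\theta_n\colon\mathcal O(n)\times\mathcal A^n\to\mathcal A$ $(n\ge 0)$ and invertible $\mathcal V$-transformations $\varphi(n;m_1,\dots,m_n)$ with components $$\varphi(o;p;a)\colon\ \theta_n\bigl(o;\theta_{m_1}(p_1;a_1),\dots,\theta_{m_n}(p_n;a_n)\bigr)\longrightarrow\theta_m\bigl(\gamma(o;p_1,\dots,p_n);a_1,\dots,a_n\bigr),\qquad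 m=m_1+\dots+m_n,\ a_r\in\mathcal A^{m_r},$$ such that 1. $\theta_n(o\rho;a_{\rho(1)},\dots,a_{\rho(n)})=\theta_n(o;a_1,\dots,a_n)$ for $\rho\in\Sigma_n$; 2. for $1\le r\le n$, the component of $\varphi$ at $(o;1,\dots,1,0,1,\dots,1)$, with $0$ in position $r$, is the identity for all $o\in \mathcal O(n)$ and all arguments in $\mathcal A^{n-1}$; 3. $\theta_1(1;a)=a$; 4. $\varphi(o\rho;p_{\rho(1)},\dots,p_{\rho(n)};a_{\rho(1)},\dots,a_{\rho(n)})=\varphi(o;p;a)$ for $\rho\in\Sigma_n$, and $\varphi(o;p_1\tau_1,\dots,p_n\tau_n;a_1\circ\tau_1,\dots,a_n\circ\tau_n)=\varphi(o;p;a)$ for $\tau_r\in\Sigma_{m_r}$; 5. $\varphi(1;p;a)$ and $\varphi(o;1,\dots,1;a)$ are identities; 6. the two composites $\theta(o;\theta(p_r;\theta(q_{rs};a_{rs})))\to\theta(\gamma(\gamma(o;p);q);a)$ built from $\varphi$ agree: $\varphi(\gamma(o;p);q;a)\circ\varphi(o;p;\theta(q;a))=\varphi(o;\gamma(p;q);a)\circ\theta(\mathrm{id}_o;\varphi(p_r;q_r;a_r))$.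 An *$\mathcal O$-pseudomorphism* $(f,\zeta)\colon(\mathcal A,\theta,\varphi)\to(\mathcal B,\xi,\psi)$ is a $\mathcal V$-functor $f\colon\mathcal A\to\mathcal B$ with invertible $\mathcal V$-transformations $\zeta_n$ with components $\zeta_n(o;a)\colon\xi_n(o;f a_1,\dots,f a_n)\to f\theta_n(o;a_1,\dots,a_n)$, such that $\zeta_0$ and $\zeta_1(1;-)$ are identities, $\zeta_n(o\rho;a_{\rho(1)},\dots,a_{\rho(n)})=\zeta_n(o;a)$ for $\rho\in\Sigma_n$, and $$f(\varphi(o;p;a))\circ\zeta_n(o;\theta(p_r;a_r))\circ\xi_n(\mathrm{id}_o;\zeta_{m_r}(p_r;a_r))=\zeta_m(\gamma(o;p);a)\circ\psi(o;p;fa).$$ An *algebra 2-cell* $(f,\zeta)\Rightarrow(g,\kappa)$ is a $\mathcal V$-transformation $\lambda\colon f\Rightarrow g$, not necessarily invertible, with $\kappa_n(o;a)\circ\xi_n(\mathrm{id}_o;\lambda_{a_1},\dots,\lambda_{a_n})=\lambda_{\theta_n(o;a)}\circ\zeta_n(o;a)$ for all $n$. These form a 2-category $\mathcal O\text{-}\mathbf{PsAlg}$.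 An *$\mathcal O$-algebra* is a pseudoalgebra all of whose $\varphi$ are identities, and a *strict $\mathcal O$-map* is a pseudomorphism all of whose $\zeta_n$ are identities; $\mathcal O\text{-}\mathbf{AlgSt}$ is the 2-category of $\mathcal O$-algebras, strict $\mathcal O$-maps and algebra 2-cells. **Theorem.** The inclusion of 2-categories $\mathbb J\colon\mathcal O\text{-}\mathbf{AlgSt}\to\mathcal O\text{-}\mathbf{PsAlg}$ has a left 2-adjoint strictification 2-functor $\mathbf{St}\colon\mathcal O\text{-}\mathbf{PsAlg}\to\mathcal O\text{-}\mathbf{AlgSt}$ (that is, there are 2-natural unit $\mathrm{Id}\to\mathbb J\,\mathbf{St}$ and counit $\mathbf{St}\,\mathbb J\to\mathrm{Id}$ satisfying the triangle identities), and every component $\mathcal A\to\mathbb J\,\mathbf{St}\,\mathcal A$ of the unit is an internal equivalence in $\mathcal O\text{-}\mathbf{PsAlg}$: it has an inverse 1-cell up to invertible 2-cells. -/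

import Mathlib

open CategoryTheory CategoryTheory.Limits

universe v u

attribute [-instance] CategoryTheory.catToReflQuiver

/-- A category internal to `V`.  Composition is written in diagrammatic order: its domain is the
object of pairs `(f, g)` with `tgt f = src g`. -/
structure ICat (V : Type u) [Category.{v} V] [HasFiniteLimits V] where
  Ob : V
  Mor : V
  src : Mor ⟶ Ob
  tgt : Mor ⟶ Ob
  ident : Ob ⟶ Mor
  comp : pullback tgt src ⟶ Mor
  ident_src : ident ≫ src = 𝟙 Ob
  ident_tgt : ident ≫ tgt = 𝟙 Ob
  comp_src : comp ≫ src = pullback.fst tgt src ≫ src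
  comp_tgt : comp ≫ tgt = pullback.snd tgt src ≫ tgt
  ident_comp : pullback.lift (src ≫ ident) (𝟙 Mor) (by simp [ident_tgt]) ≫ comp = 𝟙 Mor
  comp_ident : pullback.lift (𝟙 Mor) (tgt ≫ ident) (by simp [ident_src]) ≫ comp = 𝟙 Mor
  assoc : ∀ {X : V} (f g h : X ⟶ Mor) (hfg : f ≫ tgt = g ≫ src) (hgh : g ≫ tgt = h ≫ src),
    pullback.lift (pullback.lift f g hfg ≫ comp) h (by simp [comp_tgt, pullback.lift_snd_assoc, hgh]) ≫ comp =
      pullback.lift f (pullback.lift g h hgh ≫ comp) (by simp [comp_src, pullback.lift_fst_assoc, hfg]) ≫ comp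

namespace ICat

variable {V : Type u} [Category.{v} V] [HasFiniteLimits V]

attribute [simp] ident_src ident_tgt comp_src comp_tgt

attribute [local simp] pullback.lift_fst pullback.lift_fst_assoc pullback.lift_snd
  pullback.lift_snd_assoc prod.lift_fst prod.lift_fst_assoc prod.lift_snd prod.lift_snd_assoc

/-- The composite of a composable pair of generalized morphisms `f, g : X ⟶ Mor`. -/
noncomputable def cmp (C : ICat V) {X : V} (f g : X ⟶ C.Mor) (h : f ≫ C.tgt = g ≫ C.src) :
    X ⟶ C.Mor :=
  pullback.lift f g h ≫ C.comp

section

variable (C : ICat V) {X Y : V}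

@[simp]
theorem ident_src' (x : X ⟶ C.Ob) : x ≫ C.ident ≫ C.src = x := by simp

@[simp]
theorem ident_tgt' (x : X ⟶ C.Ob) : x ≫ C.ident ≫ C.tgt = x := by simp

@[simp]
theorem cmp_src (f g : X ⟶ C.Mor) (h : f ≫ C.tgt = g ≫ C.src) :
    C.cmp f g h ≫ C.src = f ≫ C.src := by
  simp [cmp]

@[simp]
theorem cmp_tgt (f g : X ⟶ C.Mor) (h : f ≫ C.tgt = g ≫ C.src) :
    C.cmp f g h ≫ C.tgt = g ≫ C.tgt := by
  simp [cmp]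

@[simp]
theorem precomp_cmp (x : Y ⟶ X) (f g : X ⟶ C.Mor) (h : f ≫ C.tgt = g ≫ C.src) :
    x ≫ C.cmp f g h = C.cmp (x ≫ f) (x ≫ g) (by simp [h]) := by
  unfold cmp
  rw [← Category.assoc]
  congr 1
  ext <;> simp

theorem cmp_congr {f f' g g' : X ⟶ C.Mor} {h : f ≫ C.tgt = g ≫ C.src} (hf : f = f')
    (hg : g = g') : C.cmp f g h = C.cmp f' g' (by rw [← hf, ← hg, h]) := by
  subst hf hg
  rfl

@[simp]
theorem ident_cmp (x : X ⟶ C.Ob) (f : X ⟶ C.Mor) (h : (x ≫ C.ident) ≫ C.tgt = f ≫ C.src) :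
    C.cmp (x ≫ C.ident) f h = f := by
  have hx : x = f ≫ C.src := by simpa using h
  subst hx
  have := congrArg (fun t => f ≫ t) C.ident_comp
  simp only [Category.comp_id] at this
  refine Eq.trans ?_ this
  unfold cmp
  rw [← Category.assoc]
  congr 1
  ext <;> simp

@[simp]
theorem cmp_ident (x : X ⟶ C.Ob) (f : X ⟶ C.Mor) (h : f ≫ C.tgt = (x ≫ C.ident) ≫ C.src) :
    C.cmp f (x ≫ C.ident) h = f := by
  have hx : x = f ≫ C.tgt := by simpa using h.symm
  subst hx
  have := congrArg (fun t => f ≫ t) C.comp_ident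
  simp only [Category.comp_id] at this
  refine Eq.trans ?_ this
  unfold cmp
  rw [← Category.assoc]
  congr 1
  ext <;> simp

@[simp]
theorem ident_cmp_assoc {Z : V} (y : X ⟶ Z) (x : Z ⟶ C.Ob) (f : X ⟶ C.Mor)
    (h : (y ≫ x ≫ C.ident) ≫ C.tgt = f ≫ C.src) : C.cmp (y ≫ x ≫ C.ident) f h = f := by
  rw [C.cmp_congr (f' := (y ≫ x) ≫ C.ident) (by simp) rfl, ident_cmp]

@[simp]
theorem cmp_ident_assoc {Z : V} (y : X ⟶ Z) (x : Z ⟶ C.Ob) (f : X ⟶ C.Mor)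
    (h : f ≫ C.tgt = (y ≫ x ≫ C.ident) ≫ C.src) : C.cmp f (y ≫ x ≫ C.ident) h = f := by
  rw [C.cmp_congr (g' := (y ≫ x) ≫ C.ident) rfl (by simp), cmp_ident]

@[simp]
theorem ident_cmp_assoc₂ {Z W : V} (z : X ⟶ W) (y : W ⟶ Z) (x : Z ⟶ C.Ob) (f : X ⟶ C.Mor)
    (h : (z ≫ y ≫ x ≫ C.ident) ≫ C.tgt = f ≫ C.src) : C.cmp (z ≫ y ≫ x ≫ C.ident) f h = f := by
  rw [C.cmp_congr (f' := (z ≫ y ≫ x) ≫ C.ident) (by simp) rfl, ident_cmp]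

@[simp]
theorem cmp_ident_assoc₂ {Z W : V} (z : X ⟶ W) (y : W ⟶ Z) (x : Z ⟶ C.Ob) (f : X ⟶ C.Mor)
    (h : f ≫ C.tgt = (z ≫ y ≫ x ≫ C.ident) ≫ C.src) : C.cmp f (z ≫ y ≫ x ≫ C.ident) h = f := by
  rw [C.cmp_congr (g' := (z ≫ y ≫ x) ≫ C.ident) rfl (by simp), cmp_ident]

@[simp]
theorem cmp_assoc (f g k : X ⟶ C.Mor) (h : f ≫ C.tgt = g ≫ C.src)
    (h' : C.cmp f g h ≫ C.tgt = k ≫ C.src) :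
    C.cmp (C.cmp f g h) k h' =
      C.cmp f (C.cmp g k (by simpa using h')) (by simpa using h) :=
  C.assoc f g k h (by simpa using h')

end

/-- Internal functors. -/
@[ext]
structure Fun (C D : ICat V) where
  obj : C.Ob ⟶ D.Ob
  mor : C.Mor ⟶ D.Mor
  mor_src : mor ≫ D.src = C.src ≫ obj
  mor_tgt : mor ≫ D.tgt = C.tgt ≫ obj
  ident_mor : C.ident ≫ mor = obj ≫ D.ident
  comp_mor : C.comp ≫ mor =
    D.cmp (pullback.fst C.tgt C.src ≫ mor) (pullback.snd C.tgt C.src ≫ mor)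
      (by simp only [Category.assoc, mor_src, mor_tgt, pullback.condition_assoc])

attribute [simp] Fun.mor_src Fun.mor_tgt Fun.ident_mor

@[simp]
theorem cmp_mor {C D : ICat V} (F : Fun C D) {X : V} (f g : X ⟶ C.Mor)
    (h : f ≫ C.tgt = g ≫ C.src) :
    C.cmp f g h ≫ F.mor = D.cmp (f ≫ F.mor) (g ≫ F.mor)
      (by simp only [Category.assoc, Fun.mor_src, Fun.mor_tgt, reassoc_of% h]) := by
  unfold cmp
  rw [Category.assoc, F.comp_mor, precomp_cmp]
  simp [cmp]

@[simp]
theorem cmp_src_assoc (C : ICat V) {X Z : V} (f g : X ⟶ C.Mor) (h : f ≫ C.tgt = g ≫ C.src)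
    (k : C.Ob ⟶ Z) : C.cmp f g h ≫ C.src ≫ k = f ≫ C.src ≫ k := by
  rw [← Category.assoc, cmp_src, Category.assoc]

@[simp]
theorem cmp_tgt_assoc (C : ICat V) {X Z : V} (f g : X ⟶ C.Mor) (h : f ≫ C.tgt = g ≫ C.src)
    (k : C.Ob ⟶ Z) : C.cmp f g h ≫ C.tgt ≫ k = g ≫ C.tgt ≫ k := by
  rw [← Category.assoc, cmp_tgt, Category.assoc]

instance : CategoryStruct (ICat V) where
  Hom := Fun
  id C :=
    { obj := 𝟙 _
      mor := 𝟙 _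
      mor_src := by simp
      mor_tgt := by simp
      ident_mor := by simp
      comp_mor := by
        simp only [Category.comp_id, cmp]
        have : pullback.lift (pullback.fst C.tgt C.src) (pullback.snd C.tgt C.src)
          pullback.condition = 𝟙 _ := by ext <;> simp
        rw [this, Category.id_comp] }
  comp F G :=
    { obj := F.obj ≫ G.obj
      mor := F.mor ≫ G.mor
      mor_src := by simp [reassoc_of% F.mor_src]
      mor_tgt := by simp [reassoc_of% F.mor_tgt]
      ident_mor := by simp [reassoc_of% F.ident_mor]
      comp_mor := by rw [reassoc_of% F.comp_mor]; simp }

@[simp] theorem id_obj (C : ICat V) : Fun.obj (𝟙 C) = 𝟙 C.Ob := rfl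
@[simp] theorem id_mor (C : ICat V) : Fun.mor (𝟙 C) = 𝟙 C.Mor := rfl
@[simp] theorem comp_obj {C D E : ICat V} (F : C ⟶ D) (G : D ⟶ E) :
    Fun.obj (F ≫ G) = F.obj ≫ G.obj := rfl
@[simp] theorem comp_mor {C D E : ICat V} (F : C ⟶ D) (G : D ⟶ E) :
    Fun.mor (F ≫ G) = F.mor ≫ G.mor := rfl

@[ext]
theorem hom_ext {C D : ICat V} {F G : C ⟶ D} (h₀ : F.obj = G.obj) (h₁ : F.mor = G.mor) : F = G :=
  Fun.ext h₀ h₁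

/-- Internal natural transformations. -/
@[ext]
structure Trans {C D : ICat V} (F G : Fun C D) where
  app : C.Ob ⟶ D.Mor
  app_src : app ≫ D.src = F.obj
  app_tgt : app ≫ D.tgt = G.obj
  naturality : D.cmp F.mor (C.tgt ≫ app) (by simp [app_src]) =
    D.cmp (C.src ≫ app) G.mor (by simp [app_tgt])

attribute [simp] Trans.app_src Trans.app_tgt

section

variable {C D : ICat V} {X : V}

@[simp]
theorem mor_src_assoc (F : Fun C D) (k : D.Ob ⟶ X) : F.mor ≫ D.src ≫ k = C.src ≫ F.obj ≫ k := by
  rw [← Category.assoc, F.mor_src, Category.assoc]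

@[simp]
theorem mor_tgt_assoc (F : Fun C D) (k : D.Ob ⟶ X) : F.mor ≫ D.tgt ≫ k = C.tgt ≫ F.obj ≫ k := by
  rw [← Category.assoc, F.mor_tgt, Category.assoc]

@[simp]
theorem ident_mor_assoc (F : Fun C D) (k : D.Mor ⟶ X) :
    C.ident ≫ F.mor ≫ k = F.obj ≫ D.ident ≫ k := by
  rw [← Category.assoc, F.ident_mor, Category.assoc]

@[simp]
theorem app_src_assoc {F G : Fun C D} (α : Trans F G) (k : D.Ob ⟶ X) :
    α.app ≫ D.src ≫ k = F.obj ≫ k := by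
  rw [← Category.assoc, α.app_src]

@[simp]
theorem app_tgt_assoc {F G : Fun C D} (α : Trans F G) (k : D.Ob ⟶ X) :
    α.app ≫ D.tgt ≫ k = G.obj ≫ k := by
  rw [← Category.assoc, α.app_tgt]

end

/-- Naturality on generalized morphisms. -/
theorem Trans.naturality' {C D : ICat V} {F G : Fun C D} (α : Trans F G) {X : V}
    (m : X ⟶ C.Mor) :
    D.cmp (m ≫ F.mor) (m ≫ C.tgt ≫ α.app) (by simp) =
      D.cmp (m ≫ C.src ≫ α.app) (m ≫ G.mor) (by simp) := by
  have := congrArg (fun t => m ≫ t) α.naturality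
  simpa using this

/-- The category of internal functors `C ⟶ D`. -/
@[reducible]
noncomputable def homCat (C D : ICat V) : Category (C ⟶ D) where
  Hom F G := Trans F G
  id F :=
    { app := F.obj ≫ D.ident
      app_src := by simp
      app_tgt := by simp
      naturality := by
        rw [D.cmp_congr (f' := F.mor) (g' := (C.tgt ≫ F.obj) ≫ D.ident) rfl (by simp), cmp_ident,
          D.cmp_congr (f' := (C.src ≫ F.obj) ≫ D.ident) (g' := F.mor) (by simp) rfl, ident_cmp] }
  comp {F G H} α β :=
    { app := D.cmp α.app β.app (by simp)
      app_src := by simp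
      app_tgt := by simp
      naturality := by
        simp only [precomp_cmp]
        rw [← cmp_assoc _ _ _ _ (by simp) (by simp),
          D.cmp_congr (α.naturality) rfl, cmp_assoc, D.cmp_congr rfl β.naturality, ← cmp_assoc] }
  id_comp α := by
    apply Trans.ext
    exact D.ident_cmp _ _ _
  comp_id α := by
    apply Trans.ext
    exact D.cmp_ident _ _ _
  assoc α β κ := by
    apply Trans.ext
    exact D.cmp_assoc _ _ _ _ _

section

attribute [local instance] homCat

variable {C D : ICat V}

theorem homCat_ext {F G : C ⟶ D} {α β : F ⟶ G} (h : α.app = β.app) : α = β :=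
  Trans.ext h

theorem homCat_id_app (F : C ⟶ D) : Trans.app (𝟙 F) = F.obj ≫ D.ident := rfl

theorem homCat_comp_app {F G H : C ⟶ D} (α : F ⟶ G) (β : G ⟶ H) :
    Trans.app (α ≫ β) = D.cmp α.app β.app (by simp) := rfl

theorem homCat_eqToHom_app {F G : C ⟶ D} (h : F = G) :
    Trans.app (eqToHom h) = F.obj ≫ D.ident := by
  subst h
  rfl

attribute [local simp] homCat_id_app homCat_comp_app homCat_eqToHom_app

attribute [local ext] homCat_ext

/-- Precomposition of a transformation with a functor. -/
def preWhisker {B C D : ICat V} (F : B ⟶ C) {G H : C ⟶ D} (α : G ⟶ H) : F ≫ G ⟶ F ≫ H :=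
  Trans.mk (F.obj ≫ α.app) (by simp) (by simp) (by simpa using α.naturality' F.mor)

/-- Postcomposition of a transformation with a functor. -/
def postWhisker {B C D : ICat V} {F G : B ⟶ C} (α : F ⟶ G) (H : C ⟶ D) : F ≫ H ⟶ G ≫ H :=
  Trans.mk (α.app ≫ H.mor) (by simp [reassoc_of% α.app_src]) (by simp [reassoc_of% α.app_tgt])
    (by simpa using congrArg (fun t => t ≫ H.mor) α.naturality)

@[simp]
theorem preWhisker_app {B C D : ICat V} (F : B ⟶ C) {G H : C ⟶ D} (α : G ⟶ H) :
    Trans.app (preWhisker F α) = F.obj ≫ α.app := rfl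

@[simp]
theorem postWhisker_app {B C D : ICat V} {F G : B ⟶ C} (α : F ⟶ G) (H : C ⟶ D) :
    Trans.app (postWhisker α H) = α.app ≫ H.mor := rfl

/-- The 2-category `Cat(V)` of internal categories, functors and natural transformations. -/
noncomputable instance : Bicategory (ICat V) where
  homCategory := homCat
  whiskerLeft F _ _ α := preWhisker F α
  whiskerRight α H := postWhisker α H
  associator F G H := eqToIso (by ext <;> simp)
  leftUnitor F := eqToIso (by ext <;> simp)
  rightUnitor F := eqToIso (by ext <;> simp)
  whiskerLeft_id F G := by ext; simp
  whiskerLeft_comp F _ _ _ α β := by ext; simp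
  id_whiskerLeft α := by ext; simp [← Category.assoc]
  comp_whiskerLeft F G _ _ α := by ext; simp [← Category.assoc]
  id_whiskerRight F G := by ext; simp
  comp_whiskerRight α β F := by ext; simp
  whiskerRight_id α := by ext; simp [← Category.assoc]
  whiskerRight_comp α F G := by ext; simp [← Category.assoc]
  whisker_assoc F _ _ α G := by ext; simp [← Category.assoc]
  whisker_exchange {_ _ _} {F G} {H K} α β := by ext; simpa using (β.naturality' α.app).symm
  pentagon F G H K := by ext; simp [← Category.assoc]; simp
  triangle F G := by ext; simp [← Category.assoc]; simp

end

open Bicategory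

section

variable {B C D E : ICat V}

@[ext]
theorem trans_ext {F G : C ⟶ D} {α β : F ⟶ G} (h : α.app = β.app) : α = β :=
  Trans.ext h

@[simp]
theorem id_app (F : C ⟶ D) : Trans.app (𝟙 F) = F.obj ≫ D.ident := rfl

@[simp]
theorem comp_app {F G H : C ⟶ D} (α : F ⟶ G) (β : G ⟶ H) :
    Trans.app (α ≫ β) = D.cmp α.app β.app (by simp) := rfl

@[simp]
theorem eqToHom_app {F G : C ⟶ D} (h : F = G) :
    Trans.app (eqToHom h) = F.obj ≫ D.ident := by
  subst h
  rfl

@[simp]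
theorem whiskerLeft_app (F : B ⟶ C) {G H : C ⟶ D} (α : G ⟶ H) :
    Trans.app (F ◁ α) = F.obj ≫ α.app := rfl

@[simp]
theorem whiskerRight_app {F G : B ⟶ C} (α : F ⟶ G) (H : C ⟶ D) :
    Trans.app (α ▷ H) = α.app ≫ H.mor := rfl

end

instance : Bicategory.Strict (ICat V) where
  id_comp F := by ext <;> simp
  comp_id F := by ext <;> simp
  assoc F G H := by ext <;> simp

/-! ### Finite products in `Cat(V)` -/

variable (V) in
/-- The trivial internal category. -/
noncomputable def terminal : ICat V where
  Ob := ⊤_ V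
  Mor := ⊤_ V
  src := 𝟙 _
  tgt := 𝟙 _
  ident := 𝟙 _
  comp := terminal.from _
  ident_src := by simp
  ident_tgt := by simp
  comp_src := Subsingleton.elim _ _
  comp_tgt := Subsingleton.elim _ _
  ident_comp := Subsingleton.elim _ _
  comp_ident := Subsingleton.elim _ _
  assoc _ _ _ _ _ := Subsingleton.elim _ _

instance (X : V) : Subsingleton (X ⟶ (terminal V).Mor) :=
  inferInstanceAs (Subsingleton (X ⟶ ⊤_ V))

/-- The unique functor to the trivial internal category. -/
noncomputable def toTerminal (C : ICat V) : C ⟶ terminal V :=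
  Fun.mk (terminal.from C.Ob) (terminal.from C.Mor) (Subsingleton.elim (α := _ ⟶ ⊤_ V) _ _)
    (Subsingleton.elim (α := _ ⟶ ⊤_ V) _ _) (Subsingleton.elim _ _) (Subsingleton.elim _ _)

/-- The product of two internal categories. -/
noncomputable def times (C D : ICat V) : ICat V where
  Ob := C.Ob ⨯ D.Ob
  Mor := C.Mor ⨯ D.Mor
  src := prod.map C.src D.src
  tgt := prod.map C.tgt D.tgt
  ident := prod.map C.ident D.ident
  comp := prod.lift
    (C.cmp (pullback.fst _ _ ≫ prod.fst) (pullback.snd _ _ ≫ prod.fst)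
      (by
        have := congrArg (fun t => t ≫ prod.fst)
          (pullback.condition (f := prod.map C.tgt D.tgt) (g := prod.map C.src D.src))
        simpa using this))
    (D.cmp (pullback.fst _ _ ≫ prod.snd) (pullback.snd _ _ ≫ prod.snd)
      (by
        have := congrArg (fun t => t ≫ prod.snd)
          (pullback.condition (f := prod.map C.tgt D.tgt) (g := prod.map C.src D.src))
        simpa using this))
  ident_src := by ext <;> simp
  ident_tgt := by ext <;> simp
  comp_src := by ext <;> simp
  comp_tgt := by ext <;> simp
  ident_comp := by ext <;> simp
  comp_ident := by ext <;> simp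
  assoc f g h hfg hgh := by ext <;> simp

/-- The product of a finite family of internal categories. -/
noncomputable def pi {ι : Type} [Finite ι] (C : ι → ICat V) : ICat V where
  Ob := ∏ᶜ fun i => (C i).Ob
  Mor := ∏ᶜ fun i => (C i).Mor
  src := Limits.Pi.map fun i => (C i).src
  tgt := Limits.Pi.map fun i => (C i).tgt
  ident := Limits.Pi.map fun i => (C i).ident
  comp := Limits.Pi.lift fun i =>
    (C i).cmp (pullback.fst _ _ ≫ Limits.Pi.π _ i) (pullback.snd _ _ ≫ Limits.Pi.π _ i)
      (by
        have := congrArg (fun t => t ≫ Limits.Pi.π _ i)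
          (pullback.condition (f := Limits.Pi.map fun i => (C i).tgt)
            (g := Limits.Pi.map fun i => (C i).src))
        simpa using this)
  ident_src := by ext; simp
  ident_tgt := by ext; simp
  comp_src := by ext; simp
  comp_tgt := by ext; simp
  ident_comp := by ext; simp
  comp_ident := by ext; simp
  assoc f g h hfg hgh := by ext; simp

section

variable {X C D : ICat V}

/-- First projection. -/
noncomputable def fst : times C D ⟶ C :=
  Fun.mk (C := times C D) (prod.fst : C.Ob ⨯ D.Ob ⟶ C.Ob) (prod.fst : C.Mor ⨯ D.Mor ⟶ C.Mor)
    (by simp [times]) (by simp [times]) (by simp [times]) (by simp [times])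

/-- Second projection. -/
noncomputable def snd : times C D ⟶ D :=
  Fun.mk (C := times C D) (prod.snd : C.Ob ⨯ D.Ob ⟶ D.Ob) (prod.snd : C.Mor ⨯ D.Mor ⟶ D.Mor)
    (by simp [times]) (by simp [times]) (by simp [times]) (by simp [times])

theorem times_ob_ext {Z : V} {f g : Z ⟶ (times C D).Ob}
    (h₁ : f ≫ Fun.obj fst = g ≫ Fun.obj fst) (h₂ : f ≫ Fun.obj snd = g ≫ Fun.obj snd) : f = g :=
  Limits.prod.hom_ext h₁ h₂

theorem times_mor_ext {Z : V} {f g : Z ⟶ (times C D).Mor}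
    (h₁ : f ≫ Fun.mor fst = g ≫ Fun.mor fst) (h₂ : f ≫ Fun.mor snd = g ≫ Fun.mor snd) : f = g :=
  Limits.prod.hom_ext h₁ h₂

/-- The map into the object of objects of a product with given components. -/
noncomputable def liftOb {Z : V} (f : Z ⟶ C.Ob) (g : Z ⟶ D.Ob) : Z ⟶ (times C D).Ob :=
  prod.lift f g

/-- The map into the object of morphisms of a product with given components. -/
noncomputable def liftMor {Z : V} (f : Z ⟶ C.Mor) (g : Z ⟶ D.Mor) : Z ⟶ (times C D).Mor :=
  prod.lift f g

@[simp]
theorem liftOb_fst {Z : V} (f : Z ⟶ C.Ob) (g : Z ⟶ D.Ob) : liftOb f g ≫ Fun.obj fst = f :=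
  prod.lift_fst f g

@[simp]
theorem liftOb_snd {Z : V} (f : Z ⟶ C.Ob) (g : Z ⟶ D.Ob) : liftOb f g ≫ Fun.obj snd = g :=
  prod.lift_snd f g

@[simp]
theorem liftMor_fst {Z : V} (f : Z ⟶ C.Mor) (g : Z ⟶ D.Mor) : liftMor f g ≫ Fun.mor fst = f :=
  prod.lift_fst f g

@[simp]
theorem liftMor_snd {Z : V} (f : Z ⟶ C.Mor) (g : Z ⟶ D.Mor) : liftMor f g ≫ Fun.mor snd = g :=
  prod.lift_snd f g

@[simp]
theorem liftMor_src {Z : V} (f : Z ⟶ C.Mor) (g : Z ⟶ D.Mor) :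
    liftMor f g ≫ (times C D).src = liftOb (f ≫ C.src) (g ≫ D.src) :=
  prod.lift_map f g C.src D.src

@[simp]
theorem liftMor_tgt {Z : V} (f : Z ⟶ C.Mor) (g : Z ⟶ D.Mor) :
    liftMor f g ≫ (times C D).tgt = liftOb (f ≫ C.tgt) (g ≫ D.tgt) :=
  prod.lift_map f g C.tgt D.tgt

@[simp]
theorem liftOb_ident {Z : V} (f : Z ⟶ C.Ob) (g : Z ⟶ D.Ob) :
    liftOb f g ≫ (times C D).ident = liftMor (f ≫ C.ident) (g ≫ D.ident) :=
  prod.lift_map f g C.ident D.ident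

@[simp]
theorem precomp_liftOb {Y Z : V} (x : Y ⟶ Z) (f : Z ⟶ C.Ob) (g : Z ⟶ D.Ob) :
    x ≫ liftOb f g = liftOb (x ≫ f) (x ≫ g) :=
  prod.comp_lift x f g

@[simp]
theorem precomp_liftMor {Y Z : V} (x : Y ⟶ Z) (f : Z ⟶ C.Mor) (g : Z ⟶ D.Mor) :
    x ≫ liftMor f g = liftMor (x ≫ f) (x ≫ g) :=
  prod.comp_lift x f g

@[simp]
theorem cmp_liftMor {Z : V} (f f' : Z ⟶ C.Mor) (g g' : Z ⟶ D.Mor)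
    (h : liftMor f g ≫ (times C D).tgt = liftMor f' g' ≫ (times C D).src) :
    (times C D).cmp (liftMor f g) (liftMor f' g') h =
      liftMor
        (C.cmp f f' (by
          have := congrArg (fun t => t ≫ Fun.obj fst) h
          simpa only [liftMor_tgt, liftMor_src, liftOb_fst] using this))
        (D.cmp g g' (by
          have := congrArg (fun t => t ≫ Fun.obj snd) h
          simpa only [liftMor_tgt, liftMor_src, liftOb_snd] using this)) := by
  apply times_mor_ext <;> simp

/-- The functor into a product with given components. -/
noncomputable def lift (F : X ⟶ C) (G : X ⟶ D) : X ⟶ times C D :=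
  Fun.mk (liftOb F.obj G.obj) (liftMor F.mor G.mor) (by simp) (by simp) (by simp)
    (by simp [Fun.comp_mor])

@[simp] theorem lift_obj (F : X ⟶ C) (G : X ⟶ D) : Fun.obj (lift F G) = liftOb F.obj G.obj := rfl
@[simp] theorem lift_mor (F : X ⟶ C) (G : X ⟶ D) : Fun.mor (lift F G) = liftMor F.mor G.mor := rfl

@[simp]
theorem lift_fst (F : X ⟶ C) (G : X ⟶ D) : lift F G ≫ fst = F := by ext <;> simp

@[simp]
theorem lift_snd (F : X ⟶ C) (G : X ⟶ D) : lift F G ≫ snd = G := by ext <;> simp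

theorem precomp_lift {Y : ICat V} (H : Y ⟶ X) (F : X ⟶ C) (G : X ⟶ D) :
    H ≫ lift F G = lift (H ≫ F) (H ≫ G) := by ext <;> simp

theorem times_hom_ext {F G : X ⟶ times C D} (h₁ : F ≫ fst = G ≫ fst) (h₂ : F ≫ snd = G ≫ snd) :
    F = G := by
  apply hom_ext
  · exact times_ob_ext (congrArg Fun.obj h₁) (congrArg Fun.obj h₂)
  · exact times_mor_ext (congrArg Fun.mor h₁) (congrArg Fun.mor h₂)

/-- The transformation into a product with given components. -/
noncomputable def lift₂ {F F' : X ⟶ C} {G G' : X ⟶ D} (α : F ⟶ F') (β : G ⟶ G') :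
    lift F G ⟶ lift F' G' :=
  Trans.mk (liftMor α.app β.app) (by simp) (by simp) (by simp [α.naturality, β.naturality])

@[simp]
theorem lift₂_app {F F' : X ⟶ C} {G G' : X ⟶ D} (α : F ⟶ F') (β : G ⟶ G') :
    Trans.app (lift₂ α β) = liftMor α.app β.app := rfl

end

section

variable {ι : Type} [Finite ι] {X : ICat V} {C : ι → ICat V}

/-- The projections of a finite product. -/
noncomputable def proj (i : ι) : pi C ⟶ C i :=
  Fun.mk (C := pi C) (Limits.Pi.π (fun i => (C i).Ob) i) (Limits.Pi.π (fun i => (C i).Mor) i)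
    (by simp [pi]) (by simp [pi]) (by simp [pi]) (by simp [pi])

theorem pi_ob_ext {Z : V} {f g : Z ⟶ (pi C).Ob}
    (h : ∀ i, f ≫ Fun.obj (proj (C := C) i) = g ≫ Fun.obj (proj (C := C) i)) : f = g :=
  Limits.Pi.hom_ext f g h

theorem pi_mor_ext {Z : V} {f g : Z ⟶ (pi C).Mor}
    (h : ∀ i, f ≫ Fun.mor (proj (C := C) i) = g ≫ Fun.mor (proj (C := C) i)) : f = g :=
  Limits.Pi.hom_ext f g h

/-- The map into the object of objects of a finite product with given components. -/
noncomputable def piLiftOb {Z : V} (f : ∀ i, Z ⟶ (C i).Ob) : Z ⟶ (pi C).Ob :=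
  Limits.Pi.lift f

/-- The map into the object of morphisms of a finite product with given components. -/
noncomputable def piLiftMor {Z : V} (f : ∀ i, Z ⟶ (C i).Mor) : Z ⟶ (pi C).Mor :=
  Limits.Pi.lift f

@[simp]
theorem piLiftOb_proj {Z : V} (f : ∀ i, Z ⟶ (C i).Ob) (i : ι) :
    piLiftOb f ≫ Fun.obj (proj i) = f i :=
  Limits.Pi.lift_π f i

@[simp]
theorem piLiftMor_proj {Z : V} (f : ∀ i, Z ⟶ (C i).Mor) (i : ι) :
    piLiftMor f ≫ Fun.mor (proj i) = f i :=
  Limits.Pi.lift_π f i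

@[simp]
theorem piLiftMor_src {Z : V} (f : ∀ i, Z ⟶ (C i).Mor) :
    piLiftMor f ≫ (pi C).src = piLiftOb fun i => f i ≫ (C i).src :=
  Limits.Pi.hom_ext _ _ fun i => by simp [piLiftMor, piLiftOb, pi]

@[simp]
theorem piLiftMor_tgt {Z : V} (f : ∀ i, Z ⟶ (C i).Mor) :
    piLiftMor f ≫ (pi C).tgt = piLiftOb fun i => f i ≫ (C i).tgt :=
  Limits.Pi.hom_ext _ _ fun i => by simp [piLiftMor, piLiftOb, pi]

@[simp]
theorem piLiftOb_ident {Z : V} (f : ∀ i, Z ⟶ (C i).Ob) :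
    piLiftOb f ≫ (pi C).ident = piLiftMor fun i => f i ≫ (C i).ident :=
  Limits.Pi.hom_ext _ _ fun i => by simp [piLiftMor, piLiftOb, pi]

@[simp]
theorem precomp_piLiftOb {Y Z : V} (x : Y ⟶ Z) (f : ∀ i, Z ⟶ (C i).Ob) :
    x ≫ piLiftOb f = piLiftOb fun i => x ≫ f i :=
  pi_ob_ext fun i => by simp

@[simp]
theorem precomp_piLiftMor {Y Z : V} (x : Y ⟶ Z) (f : ∀ i, Z ⟶ (C i).Mor) :
    x ≫ piLiftMor f = piLiftMor fun i => x ≫ f i :=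
  pi_mor_ext fun i => by simp

@[simp]
theorem cmp_piLiftMor {Z : V} (f g : ∀ i, Z ⟶ (C i).Mor)
    (h : piLiftMor f ≫ (pi C).tgt = piLiftMor g ≫ (pi C).src) :
    (pi C).cmp (piLiftMor f) (piLiftMor g) h = piLiftMor fun i =>
      (C i).cmp (f i) (g i) (by
        have := congrArg (fun t => t ≫ Fun.obj (proj i)) h
        simpa only [piLiftMor_tgt, piLiftMor_src, piLiftOb_proj] using this) :=
  pi_mor_ext fun i => by simp

/-- The functor into a finite product with given components. -/
noncomputable def piLift (F : ∀ i, X ⟶ C i) : X ⟶ pi C :=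
  Fun.mk (piLiftOb fun i => (F i).obj) (piLiftMor fun i => (F i).mor) (by simp) (by simp)
    (by simp) (by simp [Fun.comp_mor])

@[simp]
theorem piLift_obj (F : ∀ i, X ⟶ C i) : Fun.obj (piLift F) = piLiftOb fun i => (F i).obj := rfl

@[simp]
theorem piLift_mor (F : ∀ i, X ⟶ C i) : Fun.mor (piLift F) = piLiftMor fun i => (F i).mor := rfl

@[simp]
theorem piLift_proj (F : ∀ i, X ⟶ C i) (i : ι) : piLift F ≫ proj i = F i := by ext <;> simp

theorem precomp_piLift {Y : ICat V} (H : Y ⟶ X) (F : ∀ i, X ⟶ C i) :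
    H ≫ piLift F = piLift fun i => H ≫ F i := by ext <;> simp

theorem pi_hom_ext {F G : X ⟶ pi C} (h : ∀ i, F ≫ proj i = G ≫ proj i) : F = G := by
  apply hom_ext
  · exact pi_ob_ext fun i => congrArg Fun.obj (h i)
  · exact pi_mor_ext fun i => congrArg Fun.mor (h i)

/-- The transformation into a finite product with given components. -/
noncomputable def piLift₂ {F G : ∀ i, X ⟶ C i} (α : ∀ i, F i ⟶ G i) : piLift F ⟶ piLift G :=
  Trans.mk (piLiftMor fun i => (α i).app) (by simp) (by simp) (by simp [Trans.naturality])

@[simp]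
theorem piLift₂_app {F G : ∀ i, X ⟶ C i} (α : ∀ i, F i ⟶ G i) :
    Trans.app (piLift₂ α) = piLiftMor fun i => (α i).app := rfl

end

end ICat

open Bicategory

/-- A 2-cell is an identity if its source and target agree and it is the identity of them. -/
def IsIdentity₂ {B : Type*} [Bicategory B] {a b : B} {f g : a ⟶ b} (α : f ⟶ g) : Prop :=
  ∃ h : f = g, α = eqToHom h

/-- Juxtaposition of blocks: `(x₁₁, …, x₁ₘ₁), …, (xₙ₁, …, xₙₘₙ)` becomes a single sequence of
length `m₁ + ⋯ + mₙ`. -/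
abbrev flatten {n : ℕ} {m : Fin n → ℕ} {α : Type*} (x : ∀ r, Fin (m r) → α) :
    Fin (∑ r, m r) → α :=
  fun k => x (finSigmaFinEquiv.symm k).1 (finSigmaFinEquiv.symm k).2

theorem sum_flatten {n : ℕ} {m : Fin n → ℕ} (l : ∀ r, Fin (m r) → ℕ) :
    ∑ r, ∑ s, l r s = ∑ k, flatten l k := by
  rw [← Fintype.sum_sigma (fun x : (r : Fin n) × Fin (m r) => l x.1 x.2)]
  exact (Equiv.sum_comp finSigmaFinEquiv.symm
    (fun x : (r : Fin n) × Fin (m r) => l x.1 x.2)).symm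

/-- The bijection `(r, s) ↦ (ρ r, s)` permuting blocks. -/
def blockPerm {n : ℕ} (ρ : Equiv.Perm (Fin n)) (m : Fin n → ℕ) :
    Fin (∑ r, m (ρ r)) ≃ Fin (∑ r, m r) :=
  (finSigmaFinEquiv.symm.trans (Equiv.sigmaCongrLeft (β := fun r => Fin (m r)) ρ)).trans
    finSigmaFinEquiv

/-- The block sum `(r, s) ↦ (r, τ r s)` of permutations. -/
def blockSum {n : ℕ} {m : Fin n → ℕ} (τ : ∀ r, Equiv.Perm (Fin (m r))) :
    Equiv.Perm (Fin (∑ r, m r)) :=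
  (finSigmaFinEquiv.symm.trans (Equiv.sigmaCongrRight τ)).trans finSigmaFinEquiv

/-- The data of an operad in `Cat(V)`. -/
structure OperadData (V : Type u) [Category.{v} V] [HasFiniteLimits V] where
  obj : ℕ → ICat V
  /-- the symmetric group actions -/
  perm : ∀ {n : ℕ}, Equiv.Perm (Fin n) → (obj n ⟶ obj n)
  one : ICat.terminal V ⟶ obj 1
  γ : ∀ {n : ℕ} (m : Fin n → ℕ), ICat.times (obj n) (ICat.pi fun r => obj (m r)) ⟶ obj (∑ r, m r)

namespace OperadData

variable {V : Type u} [Category.{v} V] [HasFiniteLimits V] (O : OperadData V)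

/-- The identification of `O(m)` with `O(n)` for `m = n`. -/
def cast {m n : ℕ} (h : m = n) : O.obj m ⟶ O.obj n :=
  eqToHom (congrArg O.obj h)

/-- For a bijection `e`, the right action `o ↦ o · e`, where `O(n)` and `O(n')` are identified
if `n = n'`. -/
def reindex {n' n : ℕ} (e : Fin n' ≃ Fin n) : O.obj n ⟶ O.obj n' :=
  O.cast (Fin.equiv_iff_eq.mp ⟨e⟩).symm ≫
    O.perm (e.trans (finCongr (Fin.equiv_iff_eq.mp ⟨e⟩).symm))

/-- `γ(o; p₁, …, pₙ)` for generalized elements `o, p₁, …, pₙ`. -/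
noncomputable def comp {X : ICat V} {n : ℕ} {m : Fin n → ℕ} (o : X ⟶ O.obj n)
    (p : ∀ r, X ⟶ O.obj (m r)) : X ⟶ O.obj (∑ r, m r) :=
  ICat.lift o (ICat.piLift p) ≫ O.γ m

theorem precomp_comp {X Y : ICat V} (H : Y ⟶ X) {n : ℕ} {m : Fin n → ℕ} (o : X ⟶ O.obj n)
    (p : ∀ r, X ⟶ O.obj (m r)) : H ≫ O.comp o p = O.comp (H ≫ o) fun r => H ≫ p r := by
  unfold comp
  rw [← Category.assoc, ICat.precomp_lift, ICat.precomp_piLift]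

/-- The operadic unit as a generalized element. -/
noncomputable def unit (X : ICat V) : X ⟶ O.obj 1 :=
  ICat.toTerminal X ≫ O.one

end OperadData

/-- Operads in `Cat(V)`.  The axioms are stated on generalized elements. -/
structure Operad (V : Type u) [Category.{v} V] [HasFiniteLimits V] extends OperadData V where
  perm_one : ∀ n : ℕ, perm (1 : Equiv.Perm (Fin n)) = 𝟙 (obj n)
  /-- the symmetric groups act from the right -/
  perm_mul : ∀ {n : ℕ} (ρ σ : Equiv.Perm (Fin n)), perm (ρ * σ) = perm ρ ≫ perm σ
  /-- `γ(1; p) = p` -/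
  unit_comp : ∀ {X : ICat V} {m : ℕ} (p : X ⟶ obj m),
    toOperadData.comp (toOperadData.unit X) (fun _ : Fin 1 => p) ≫
      toOperadData.cast (by simp) = p
  /-- `γ(o; 1, …, 1) = o` -/
  comp_unit : ∀ {X : ICat V} {n : ℕ} (o : X ⟶ obj n),
    toOperadData.comp o (fun _ : Fin n => toOperadData.unit X) ≫ toOperadData.cast (by simp) = o
  /-- `γ(o; γ(p₁; q₁₁, …), …, γ(pₙ; qₙ₁, …)) = γ(γ(o; p₁, …, pₙ); q₁₁, …)` -/
  assoc : ∀ {X : ICat V} {n : ℕ} {m : Fin n → ℕ} {l : ∀ r, Fin (m r) → ℕ} (o : X ⟶ obj n)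
    (p : ∀ r, X ⟶ obj (m r)) (q : ∀ r s, X ⟶ obj (l r s)),
    toOperadData.comp o (fun r => toOperadData.comp (p r) (q r)) ≫
        toOperadData.cast (sum_flatten l) =
      toOperadData.comp (m := flatten l) (toOperadData.comp o p)
        (fun k => q (finSigmaFinEquiv.symm k).1 (finSigmaFinEquiv.symm k).2)
  /-- `γ(oρ; p_{ρ(1)}, …, p_{ρ(n)}) = γ(o; p₁, …, pₙ) · ρ(m)` for the block permutation `ρ(m)` -/
  comp_perm : ∀ {X : ICat V} {n : ℕ} {m : Fin n → ℕ} (ρ : Equiv.Perm (Fin n)) (o : X ⟶ obj n)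
    (p : ∀ r, X ⟶ obj (m r)),
    toOperadData.comp (o ≫ perm ρ) (fun r => p (ρ r)) =
      toOperadData.comp o p ≫ toOperadData.reindex (blockPerm ρ m)
  /-- `γ(o; p₁τ₁, …, pₙτₙ) = γ(o; p₁, …, pₙ) · (τ₁ ⊕ ⋯ ⊕ τₙ)` -/
  comp_blockSum : ∀ {X : ICat V} {n : ℕ} {m : Fin n → ℕ} (τ : ∀ r, Equiv.Perm (Fin (m r)))
    (o : X ⟶ obj n) (p : ∀ r, X ⟶ obj (m r)),
    toOperadData.comp o (fun r => p r ≫ perm (τ r)) = toOperadData.comp o p ≫ perm (blockSum τ)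

/-- Reduced operads: `O(0)` is the trivial internal category, by means of the (unique)
isomorphism `zero`. -/
structure ReducedOperad (V : Type u) [Category.{v} V] [HasFiniteLimits V] extends Operad V where
  zero : ICat.terminal V ≅ obj 0

namespace ReducedOperad

variable {V : Type u} [Category.{v} V] [HasFiniteLimits V] (O : ReducedOperad V)

/-- The arities `1, …, 1, 0, 1, …, 1` with `0` in position `r`. -/
def degenArity {n : ℕ} (r : Fin n) (i : Fin n) : ℕ :=
  if i = r then 0 else 1

/-- The generalized elements `1, …, 1, 0, 1, …, 1` with `0 ∈ O(0)` in position `r` and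
`1 ∈ O(1)` elsewhere. -/
noncomputable def degen (X : ICat V) {n : ℕ} (r i : Fin n) : X ⟶ O.obj (degenArity r i) :=
  if h : i = r then ICat.toTerminal X ≫ O.zero.hom ≫ O.cast (by simp [degenArity, h])
  else O.unit X ≫ O.cast (by simp [degenArity, h])

end ReducedOperad

/-- An internal category `A` with functors `O(n) × Aⁿ ⟶ A`. -/
structure ActionData {V : Type u} [Category.{v} V] [HasFiniteLimits V] (O : ReducedOperad V) where
  carrier : ICat V
  θ : ∀ n : ℕ, ICat.times (O.obj n) (ICat.pi fun _ : Fin n => carrier) ⟶ carrier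

namespace ActionData

variable {V : Type u} [Category.{v} V] [HasFiniteLimits V] {O : ReducedOperad V} (A : ActionData O)

/-- `θₙ(o; a₁, …, aₙ)` for generalized elements `o, a₁, …, aₙ`. -/
noncomputable def act {X : ICat V} {n : ℕ} (o : X ⟶ O.obj n) (a : Fin n → (X ⟶ A.carrier)) :
    X ⟶ A.carrier :=
  ICat.lift o (ICat.piLift a) ≫ A.θ n

/-- The 2-cell `θₙ(id; α₁, …, αₙ)`. -/
noncomputable def act₂ {X : ICat V} {n : ℕ} (o : X ⟶ O.obj n) {a b : Fin n → (X ⟶ A.carrier)}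
    (α : ∀ i, a i ⟶ b i) : A.act o a ⟶ A.act o b :=
  ICat.lift₂ (𝟙 o) (ICat.piLift₂ α) ▷ A.θ n

theorem precomp_act {X Y : ICat V} (H : Y ⟶ X) {n : ℕ} (o : X ⟶ O.obj n)
    (a : Fin n → (X ⟶ A.carrier)) : H ≫ A.act o a = A.act (H ≫ o) fun i => H ≫ a i := by
  unfold act
  rw [← Category.assoc, ICat.precomp_lift, ICat.precomp_piLift]

/-- The 2-cells `act₂` on underlying maps. -/
theorem act₂_app {X : ICat V} {n : ℕ} (o : X ⟶ O.obj n) {a b : Fin n → (X ⟶ A.carrier)}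
    (α : ∀ i, a i ⟶ b i) : ICat.Trans.app (A.act₂ o α) =
      ICat.liftMor (o.obj ≫ (O.obj n).ident) (ICat.piLiftMor fun i => (α i).app) ≫ (A.θ n).mor :=
  rfl

theorem act₂_comp {X : ICat V} {n : ℕ} (o : X ⟶ O.obj n) {a b c : Fin n → (X ⟶ A.carrier)}
    (α : ∀ i, a i ⟶ b i) (β : ∀ i, b i ⟶ c i) :
    A.act₂ o (fun i => α i ≫ β i) = A.act₂ o α ≫ A.act₂ o β := by
  have h : ICat.lift₂ (𝟙 o) (ICat.piLift₂ fun i => α i ≫ β i) =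
      ICat.lift₂ (𝟙 o) (ICat.piLift₂ α) ≫ ICat.lift₂ (𝟙 o) (ICat.piLift₂ β) := by
    ext
    simp
  exact (congrArg (fun t => t ▷ A.θ n) h).trans (comp_whiskerRight _ _ _)

end ActionData

/-- The domain `O(n) × ∏ᵣ (O(mᵣ) × A^{mᵣ})` of the composition 2-cells. -/
noncomputable abbrev phiDomain {V : Type u} [Category.{v} V] [HasFiniteLimits V]
    (O : ReducedOperad V) (A : ICat V) {n : ℕ} (m : Fin n → ℕ) : ICat V :=
  ICat.times (O.obj n)
    (ICat.pi fun r => ICat.times (O.obj (m r)) (ICat.pi fun _ : Fin (m r) => A))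

/-- An action together with invertible composition 2-cells
`φ(n; m₁, …, mₙ) : θₙ ∘ (id × ∏ᵣ θ_{mᵣ}) ⟹ θₘ ∘ (γ × id) ∘ π`. -/
structure PsAlgData {V : Type u} [Category.{v} V] [HasFiniteLimits V] (O : ReducedOperad V) extends
    ActionData O where
  φ : ∀ {n : ℕ} (m : Fin n → ℕ),
    toActionData.act (X := phiDomain O carrier m) ICat.fst
        (fun r => toActionData.act (ICat.snd ≫ ICat.proj r ≫ ICat.fst)
          (fun s => ICat.snd ≫ ICat.proj r ≫ ICat.snd ≫ ICat.proj s)) ≅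
      toActionData.act (X := phiDomain O carrier m)
        (O.comp ICat.fst (fun r => ICat.snd ≫ ICat.proj r ≫ ICat.fst))
        (flatten fun r s => ICat.snd ≫ ICat.proj r ≫ ICat.snd ≫ ICat.proj s)

namespace PsAlgData

variable {V : Type u} [Category.{v} V] [HasFiniteLimits V] {O : ReducedOperad V} (A : PsAlgData O)

/-- The generalized element of the domain of `φ` with given components. -/
noncomputable def phiLift {X : ICat V} {n : ℕ} {m : Fin n → ℕ} (o : X ⟶ O.obj n)
    (p : ∀ r, X ⟶ O.obj (m r)) (a : ∀ r, Fin (m r) → (X ⟶ A.carrier)) :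
    X ⟶ phiDomain O A.carrier m :=
  ICat.lift o (ICat.piLift fun r => ICat.lift (p r) (ICat.piLift (a r)))

theorem phiLift_fst {X : ICat V} {n : ℕ} {m : Fin n → ℕ} (o : X ⟶ O.obj n)
    (p : ∀ r, X ⟶ O.obj (m r)) (a : ∀ r, Fin (m r) → (X ⟶ A.carrier)) :
    A.phiLift o p a ≫ ICat.fst = o :=
  ICat.lift_fst _ _

theorem phiLift_proj_fst {X : ICat V} {n : ℕ} {m : Fin n → ℕ} (o : X ⟶ O.obj n)
    (p : ∀ r, X ⟶ O.obj (m r)) (a : ∀ r, Fin (m r) → (X ⟶ A.carrier)) (r : Fin n) :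
    A.phiLift o p a ≫ ICat.snd ≫ ICat.proj r ≫ ICat.fst = p r := by
  unfold phiLift
  rw [← Category.assoc, ICat.lift_snd, ← Category.assoc, ICat.piLift_proj, ICat.lift_fst]

theorem phiLift_proj_snd {X : ICat V} {n : ℕ} {m : Fin n → ℕ} (o : X ⟶ O.obj n)
    (p : ∀ r, X ⟶ O.obj (m r)) (a : ∀ r, Fin (m r) → (X ⟶ A.carrier)) (r : Fin n)
    (s : Fin (m r)) :
    A.phiLift o p a ≫ ICat.snd ≫ ICat.proj r ≫ ICat.snd ≫ ICat.proj s = a r s := by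
  unfold phiLift
  rw [← Category.assoc, ICat.lift_snd, ← Category.assoc, ICat.piLift_proj, ← Category.assoc,
    ICat.lift_snd, ICat.piLift_proj]

/-- The component of `φ` at generalized elements: the whiskering of `φ` along the functor
with components `o`, `p`, `a`. -/
noncomputable def phiAt {X : ICat V} {n : ℕ} {m : Fin n → ℕ} (o : X ⟶ O.obj n)
    (p : ∀ r, X ⟶ O.obj (m r)) (a : ∀ r, Fin (m r) → (X ⟶ A.carrier)) :
    A.act o (fun r => A.act (p r) (a r)) ≅ A.act (O.comp o p) (flatten a) :=
  eqToIso (by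
      simp only [ActionData.precomp_act]
      simp only [phiLift_fst, phiLift_proj_fst, phiLift_proj_snd]) ≪≫
    whiskerLeftIso (A.phiLift o p a) (A.φ m) ≪≫
    eqToIso (by
      simp only [ActionData.precomp_act, OperadData.precomp_comp, flatten]
      simp only [phiLift_fst, phiLift_proj_fst, phiLift_proj_snd])

theorem phiAt_app {X : ICat V} {n : ℕ} {m : Fin n → ℕ} (o : X ⟶ O.obj n)
    (p : ∀ r, X ⟶ O.obj (m r)) (a : ∀ r, Fin (m r) → (X ⟶ A.carrier)) :
    (A.phiAt o p a).hom.app = (A.phiLift o p a).obj ≫ (A.φ m).hom.app := by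
  simp [phiAt]

end PsAlgData

namespace ICat

variable {V : Type u} [Category.{v} V] [HasFiniteLimits V]

theorem isIdentity₂_iff {C D : ICat V} {F G : C ⟶ D} (α : F ⟶ G) :
    IsIdentity₂ α ↔ α.app = F.obj ≫ D.ident := by
  constructor
  · rintro ⟨h, rfl⟩
    simp
  · intro h
    have h₀ : F.obj = G.obj := by
      have := α.app_tgt
      rw [h] at this
      simpa using this
    have h₁ : F.mor = G.mor := by
      have := α.naturality
      simp only [h, cmp_ident_assoc, ident_cmp_assoc] at this
      exact this
    exact ⟨ICat.hom_ext h₀ h₁, by ext; simp [h]⟩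

theorem isIdentity₂_of_app {C D : ICat V} {F G : C ⟶ D} (α : F ⟶ G) (x : C.Ob ⟶ D.Ob)
    (h : α.app = x ≫ D.ident) : IsIdentity₂ α := by
  rw [isIdentity₂_iff, h]
  have := α.app_src
  rw [h] at this
  rw [← this]
  simp

end ICat

theorem ActionData.act₂_isIdentity {V : Type u} [Category.{v} V] [HasFiniteLimits V]
    {O : ReducedOperad V} (A : ActionData O) {X : ICat V} {n : ℕ} (o : X ⟶ O.obj n)
    {a b : Fin n → (X ⟶ A.carrier)} (α : ∀ i, a i ⟶ b i) (h : ∀ i, IsIdentity₂ (α i)) :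
    IsIdentity₂ (A.act₂ o α) := by
  simp only [ICat.isIdentity₂_iff] at h ⊢
  rw [ActionData.act₂_app]
  simp only [h]
  rw [← ICat.piLiftOb_ident, ← ICat.liftOb_ident, Category.assoc, ICat.Fun.ident_mor]
  simp [act]

theorem PsAlgData.phiAt_congr {V : Type u} [Category.{v} V] [HasFiniteLimits V]
    {O : ReducedOperad V} (A : PsAlgData O) {X : ICat V} {n : ℕ} {m : Fin n → ℕ}
    {o o' : X ⟶ O.obj n} {p p' : ∀ r, X ⟶ O.obj (m r)}
    {a a' : ∀ r, Fin (m r) → (X ⟶ A.carrier)} (ho : o = o') (hp : p = p') (ha : a = a') :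
    (A.phiAt o p a).hom.app = (A.phiAt o' p' a').hom.app := by
  subst ho hp ha
  rfl

/-- `O`-pseudoalgebras.  Equations between 2-cells whose boundaries agree only up to the
equations already imposed on 1-cells are equations between the underlying maps `Ob ⟶ Mor`. -/
structure PsAlg {V : Type u} [Category.{v} V] [HasFiniteLimits V] (O : ReducedOperad V) extends
    PsAlgData O where
  /-- `θ(oρ; a_{ρ(1)}, …, a_{ρ(n)}) = θ(o; a₁, …, aₙ)` -/
  act_perm : ∀ {X : ICat V} {n : ℕ} (ρ : Equiv.Perm (Fin n)) (o : X ⟶ O.obj n)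
    (a : Fin n → (X ⟶ carrier)),
    toActionData.act (o ≫ O.perm ρ) (fun i => a (ρ i)) = toActionData.act o a
  /-- `φ(o; 1, …, 0, …, 1; a)` is the identity; here the entry `a r` is not used, since it is
  indexed by the empty set. -/
  phi_degen : ∀ {X : ICat V} {n : ℕ} (r : Fin n) (o : X ⟶ O.obj n) (a : Fin n → (X ⟶ carrier)),
    IsIdentity₂ (toPsAlgData.phiAt o (O.degen X r) (fun i _ => a i)).hom
  /-- `θ(1; a) = a` -/
  act_unit : ∀ {X : ICat V} (a : X ⟶ carrier),
    toActionData.act (O.unit X) (fun _ : Fin 1 => a) = a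
  phi_perm : ∀ {X : ICat V} {n : ℕ} {m : Fin n → ℕ} (ρ : Equiv.Perm (Fin n)) (o : X ⟶ O.obj n)
    (p : ∀ r, X ⟶ O.obj (m r)) (a : ∀ r, Fin (m r) → (X ⟶ carrier)),
    (toPsAlgData.phiAt (o ≫ O.perm ρ) (fun r => p (ρ r)) (fun r => a (ρ r))).hom.app =
      (toPsAlgData.phiAt o p a).hom.app
  phi_perm_inner : ∀ {X : ICat V} {n : ℕ} {m : Fin n → ℕ} (τ : ∀ r, Equiv.Perm (Fin (m r)))
    (o : X ⟶ O.obj n) (p : ∀ r, X ⟶ O.obj (m r)) (a : ∀ r, Fin (m r) → (X ⟶ carrier)),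
    (toPsAlgData.phiAt o (fun r => p r ≫ O.perm (τ r)) (fun r s => a r (τ r s))).hom.app =
      (toPsAlgData.phiAt o p a).hom.app
  phi_unit_left : ∀ {X : ICat V} {n : ℕ} (p : X ⟶ O.obj n) (a : Fin n → (X ⟶ carrier)),
    IsIdentity₂ (toPsAlgData.phiAt (O.unit X) (fun _ : Fin 1 => p) (fun _ => a)).hom
  phi_unit_right : ∀ {X : ICat V} {n : ℕ} (o : X ⟶ O.obj n) (a : Fin n → (X ⟶ carrier)),
    IsIdentity₂ (toPsAlgData.phiAt o (fun _ => O.unit X) (fun i (_ : Fin 1) => a i)).hom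
  /-- The two composites `θ(o; θ(p; θ(q; a))) ⟹ θ(γ(γ(o; p); q); a)` agree. -/
  phi_assoc : ∀ {X : ICat V} {n : ℕ} {m : Fin n → ℕ} {l : ∀ r, Fin (m r) → ℕ} (o : X ⟶ O.obj n)
    (p : ∀ r, X ⟶ O.obj (m r)) (q : ∀ r s, X ⟶ O.obj (l r s))
    (a : ∀ r s, Fin (l r s) → (X ⟶ carrier)),
    ICat.Trans.app ((toPsAlgData.phiAt o p (fun r s => toActionData.act (q r s) (a r s))).hom ≫
        (toPsAlgData.phiAt (m := flatten l) (O.comp o p)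
          (fun k => q (finSigmaFinEquiv.symm k).1 (finSigmaFinEquiv.symm k).2)
          (fun k => a (finSigmaFinEquiv.symm k).1 (finSigmaFinEquiv.symm k).2)).hom) =
      ICat.Trans.app (toActionData.act₂ o (fun r => (toPsAlgData.phiAt (p r) (q r) (a r)).hom) ≫
        (toPsAlgData.phiAt o (fun r => O.comp (p r) (q r)) (fun r => flatten (a r))).hom)

namespace PsAlg

variable {V : Type u} [Category.{v} V] [HasFiniteLimits V] {O : ReducedOperad V}

/-- A pseudoalgebra is a (strict) algebra if all composition 2-cells are identities. -/
def IsStrict (A : PsAlg O) : Prop :=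
  ∀ {n : ℕ} (m : Fin n → ℕ), IsIdentity₂ (A.φ m).hom

/-- A functor `f` together with invertible 2-cells `ζₙ : ξₙ ∘ (id × fⁿ) ⟹ f ∘ θₙ`. -/
structure PsMorData (A B : PsAlg O) where
  f : A.carrier ⟶ B.carrier
  ζ : ∀ n : ℕ,
    B.act (X := ICat.times (O.obj n) (ICat.pi fun _ : Fin n => A.carrier)) ICat.fst
      (fun i => (ICat.snd ≫ ICat.proj i) ≫ f) ≅ A.θ n ≫ f

namespace PsMorData

variable {A B C : PsAlg O} (F : PsMorData A B)

/-- The component of `ζₙ` at generalized elements: the whiskering of `ζₙ` along the functor with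
components `o`, `a`. -/
noncomputable def zetaAt {X : ICat V} {n : ℕ} (o : X ⟶ O.obj n) (a : Fin n → (X ⟶ A.carrier)) :
    B.act o (fun i => a i ≫ F.f) ≅ A.act o a ≫ F.f :=
  eqToIso (by
      rw [ActionData.precomp_act]
      simp only [← Category.assoc, ICat.lift_fst, ICat.lift_snd, ICat.piLift_proj]) ≪≫
    whiskerLeftIso (ICat.lift o (ICat.piLift a)) (F.ζ n) ≪≫
    eqToIso (by rw [ActionData.act, Category.assoc])

theorem zetaAt_app {X : ICat V} {n : ℕ} (o : X ⟶ O.obj n) (a : Fin n → (X ⟶ A.carrier)) :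
    (F.zetaAt o a).hom.app = (ICat.lift o (ICat.piLift a)).obj ≫ (F.ζ n).hom.app := by
  simp [zetaAt]

theorem zetaAt_congr {X : ICat V} {n : ℕ} {o o' : X ⟶ O.obj n} {a a' : Fin n → (X ⟶ A.carrier)}
    (ho : o = o') (ha : a = a') : (F.zetaAt o a).hom.app = (F.zetaAt o' a').hom.app := by
  subst ho ha
  rfl

theorem ext_app {F G : PsMorData A B} (hf : F.f = G.f)
    (hζ : ∀ n, (F.ζ n).hom.app = (G.ζ n).hom.app) : F = G := by
  obtain ⟨f, ζ⟩ := F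
  obtain ⟨g, κ⟩ := G
  obtain rfl : f = g := hf
  have : ζ = κ := by
    funext n
    ext
    exact hζ n
  rw [this]

end PsMorData

/-- `O`-pseudomorphisms. -/
structure PsMor (A B : PsAlg O) extends PsMorData A B where
  zeta_zero : IsIdentity₂ (ζ 0).hom
  zeta_unit : ∀ {X : ICat V} (a : X ⟶ A.carrier),
    IsIdentity₂ (toPsMorData.zetaAt (O.unit X) (fun _ : Fin 1 => a)).hom
  zeta_perm : ∀ {X : ICat V} {n : ℕ} (ρ : Equiv.Perm (Fin n)) (o : X ⟶ O.obj n)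
    (a : Fin n → (X ⟶ A.carrier)),
    (toPsMorData.zetaAt (o ≫ O.perm ρ) (fun i => a (ρ i))).hom.app =
      (toPsMorData.zetaAt o a).hom.app
  /-- The two composites `ξ(o; ξ(p; f a)) ⟹ f θ(γ(o; p); a)` agree. -/
  zeta_phi : ∀ {X : ICat V} {n : ℕ} {m : Fin n → ℕ} (o : X ⟶ O.obj n)
    (p : ∀ r, X ⟶ O.obj (m r)) (a : ∀ r, Fin (m r) → (X ⟶ A.carrier)),
    B.act₂ o (fun r => (toPsMorData.zetaAt (p r) (a r)).hom) ≫
        (toPsMorData.zetaAt o (fun r => A.act (p r) (a r))).hom ≫ (A.phiAt o p a).hom ▷ f =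
      (B.phiAt o p (fun r s => a r s ≫ f)).hom ≫ (toPsMorData.zetaAt (O.comp o p) (flatten a)).hom

namespace PsMor

variable {A B C D : PsAlg O}

/-- A pseudomorphism is strict if all the 2-cells `ζₙ` are identities. -/
def IsStrict (F : PsMor A B) : Prop :=
  ∀ n : ℕ, IsIdentity₂ (F.ζ n).hom

theorem ext_app {F G : PsMor A B} (hf : F.f = G.f)
    (hζ : ∀ n, (F.ζ n).hom.app = (G.ζ n).hom.app) : F = G := by
  obtain ⟨F, _, _, _, _⟩ := F
  obtain ⟨G, _, _, _, _⟩ := G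
  obtain rfl : F = G := PsMorData.ext_app hf hζ
  rfl

/-- The coherence between `ζ` and `φ` on underlying maps. -/
theorem zeta_phi_app (F : PsMor A B) {X : ICat V} {n : ℕ} {m : Fin n → ℕ} (o : X ⟶ O.obj n)
    (p : ∀ r, X ⟶ O.obj (m r)) (a : ∀ r, Fin (m r) → (X ⟶ A.carrier)) :
    B.carrier.cmp (B.act₂ o (fun r => (F.zetaAt (p r) (a r)).hom)).app
        (B.carrier.cmp (F.zetaAt o (fun r => A.act (p r) (a r))).hom.app
          ((A.phiAt o p a).hom.app ≫ F.f.mor) (by simp)) (by simp) =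
      B.carrier.cmp (B.phiAt o p (fun r s => a r s ≫ F.f)).hom.app
        (F.zetaAt (O.comp o p) (flatten a)).hom.app
        (by rw [ICat.Trans.app_tgt, ICat.Trans.app_src]) :=
  congrArg ICat.Trans.app (F.zeta_phi o p a)

theorem zetaAt_precomp (F : PsMorData A B) {X Y : ICat V} (H : Y ⟶ X) {n : ℕ} (o : X ⟶ O.obj n)
    (a : Fin n → (X ⟶ A.carrier)) :
    H.obj ≫ (F.zetaAt o a).hom.app = (F.zetaAt (H ≫ o) (fun i => H ≫ a i)).hom.app := by
  rw [PsMorData.zetaAt_app, PsMorData.zetaAt_app]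
  simp [← Category.assoc]

/-- Naturality of `ζₙ` with respect to 2-cells between generalized elements. -/
theorem zeta_natural (F : PsMorData A B) {X : ICat V} {n : ℕ} (o : X ⟶ O.obj n)
    {a b : Fin n → (X ⟶ A.carrier)} (α : ∀ i, a i ⟶ b i) :
    B.act₂ o (fun i => α i ▷ F.f) ≫ (F.zetaAt o b).hom =
      (F.zetaAt o a).hom ≫ A.act₂ o α ▷ F.f := by
  ext
  have h := (F.ζ n).hom.naturality' (ICat.lift₂ (𝟙 o) (ICat.piLift₂ α)).app
  simp only [ICat.comp_app, PsMorData.zetaAt_app, ICat.whiskerRight_app, ActionData.act₂_app]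
  refine Eq.trans (B.carrier.cmp_congr ?_ ?_) (h.trans (B.carrier.cmp_congr ?_ ?_))
  · simp only [ActionData.act, ICat.comp_mor, ICat.lift_mor, ICat.piLift_mor, ← Category.assoc]
    congr 1
    apply ICat.times_mor_ext
    · simp
    · apply ICat.pi_mor_ext
      simp [← Category.assoc]
  · simp only [ICat.lift₂_app, ← Category.assoc]
    simp
  · simp only [ICat.lift₂_app, ← Category.assoc]
    simp
  · simp

theorem act_id (A : PsAlg O) (n : ℕ) :
    A.act (X := ICat.times (O.obj n) (ICat.pi fun _ : Fin n => A.carrier)) ICat.fst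
      (fun i => (ICat.snd ≫ ICat.proj i) ≫ 𝟙 A.carrier) = A.θ n ≫ 𝟙 A.carrier := by
  simp only [Category.comp_id, ActionData.act]
  have : ICat.lift ICat.fst (ICat.piLift fun i => ICat.snd ≫ ICat.proj i) =
      𝟙 (ICat.times (O.obj n) (ICat.pi fun _ : Fin n => A.carrier)) := by
    apply ICat.times_hom_ext
    · simp
    · apply ICat.pi_hom_ext
      intro i
      rw [ICat.lift_snd, ICat.piLift_proj, Category.id_comp]
  rw [this, Category.id_comp]

/-- The data of the identity pseudomorphism. -/
noncomputable def idData (A : PsAlg O) : PsMorData A A where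
  f := 𝟙 A.carrier
  ζ n := eqToIso (act_id A n)

theorem idData_zetaAt_app (A : PsAlg O) {X : ICat V} {n : ℕ} (o : X ⟶ O.obj n)
    (a : Fin n → (X ⟶ A.carrier)) :
    ((idData A).zetaAt o a).hom.app = (A.act o a).obj ≫ A.carrier.ident := by
  rw [PsMorData.zetaAt_app, idData, eqToIso.hom, ICat.eqToHom_app, act_id]
  simp [ActionData.act]

/-- The identity pseudomorphism. -/
noncomputable def id (A : PsAlg O) : PsMor A A where
  toPsMorData := idData A
  zeta_zero := ⟨act_id A 0, rfl⟩
  zeta_unit a := by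
    rw [ICat.isIdentity₂_iff, idData_zetaAt_app]
    simp [idData]
  zeta_perm ρ o a := by
    rw [idData_zetaAt_app, idData_zetaAt_app, A.act_perm]
  zeta_phi o p a := by
    ext
    have h : IsIdentity₂ (A.act₂ o (fun r => ((idData A).zetaAt (p r) (a r)).hom)) :=
      A.act₂_isIdentity _ _ fun r => ICat.isIdentity₂_of_app _ _ (idData_zetaAt_app A _ _)
    rw [ICat.isIdentity₂_iff] at h
    simp only [ICat.comp_app, idData_zetaAt_app, ICat.whiskerRight_app, h, ICat.ident_cmp,
      ICat.cmp_ident]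
    rw [show (idData A).f.mor = 𝟙 _ from rfl, Category.comp_id]
    exact A.phiAt_congr rfl rfl (by funext r s; exact (Category.comp_id _).symm)

/-- The data of a composite of pseudomorphisms. -/
noncomputable def compData (F : PsMorData A B) (G : PsMorData B C) : PsMorData A C where
  f := F.f ≫ G.f
  ζ n := eqToIso (by simp only [Category.assoc]) ≪≫
    G.zetaAt ICat.fst (fun i => (ICat.snd ≫ ICat.proj i) ≫ F.f) ≪≫
    whiskerRightIso (F.ζ n) G.f ≪≫ eqToIso (Category.assoc _ _ _)

theorem compData_zeta_app (F : PsMorData A B) (G : PsMorData B C) (n : ℕ) :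
    ((compData F G).ζ n).hom.app =
      C.carrier.cmp (G.zetaAt ICat.fst (fun i => (ICat.snd ≫ ICat.proj i) ≫ F.f)).hom.app
        ((F.ζ n).hom.app ≫ G.f.mor) (by simp) := by
  simp [compData]

theorem compData_zetaAt_app (F : PsMorData A B) (G : PsMorData B C) {X : ICat V} {n : ℕ}
    (o : X ⟶ O.obj n) (a : Fin n → (X ⟶ A.carrier)) :
    ((compData F G).zetaAt o a).hom.app =
      C.carrier.cmp (G.zetaAt o (fun i => a i ≫ F.f)).hom.app
        ((F.zetaAt o a).hom.app ≫ G.f.mor) (by simp) := by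
  rw [PsMorData.zetaAt_app, compData_zeta_app, ICat.precomp_cmp]
  apply ICat.cmp_congr
  · rw [zetaAt_precomp]
    apply PsMorData.zetaAt_congr
    · simp
    · funext i
      simp only [← Category.assoc, ICat.lift_snd, ICat.piLift_proj]
  · rw [PsMorData.zetaAt_app, Category.assoc]

theorem comp_zeta_phi (F : PsMor A B) (G : PsMor B C) {X : ICat V} {n : ℕ} {m : Fin n → ℕ}
    (o : X ⟶ O.obj n) (p : ∀ r, X ⟶ O.obj (m r)) (a : ∀ r, Fin (m r) → (X ⟶ A.carrier)) :
    C.act₂ o (fun r => (G.zetaAt (p r) (fun s => a r s ≫ F.f)).hom ≫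
          (F.zetaAt (p r) (a r)).hom ▷ G.f) ≫
        (G.zetaAt o (fun r => A.act (p r) (a r) ≫ F.f)).hom ≫
          (F.zetaAt o (fun r => A.act (p r) (a r))).hom ▷ G.f ≫
            ((A.phiAt o p a).hom ▷ F.f) ▷ G.f =
      (C.phiAt o p (fun r s => (a r s ≫ F.f) ≫ G.f)).hom ≫
        (G.zetaAt (O.comp o p) (flatten fun r s => a r s ≫ F.f)).hom ≫
          (F.zetaAt (O.comp o p) (flatten a)).hom ▷ G.f := by
  have h₁ := zeta_natural G.toPsMorData o (fun r => (F.zetaAt (p r) (a r)).hom)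
  have h₂ := G.zeta_phi o p (fun r s => a r s ≫ F.f)
  have h₃ := congrArg (fun t => t ▷ G.f) (F.zeta_phi o p a)
  simp only [comp_whiskerRight] at h₃
  rw [ActionData.act₂_comp]
  refine (Category.assoc _ _ _).trans ?_
  rw [reassoc_of% h₁, h₃]
  exact (reassoc_of% h₂) _

/-- Composition of pseudomorphisms. -/
noncomputable def comp (F : PsMor A B) (G : PsMor B C) : PsMor A C where
  toPsMorData := compData F.toPsMorData G.toPsMorData
  zeta_zero := by
    have hF := F.zeta_zero
    have hG := G.zeta_zero
    rw [ICat.isIdentity₂_iff] at hF hG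
    refine ICat.isIdentity₂_of_app _ (ICat.Fun.obj (B.act
      (X := ICat.times (O.obj 0) (ICat.pi fun _ : Fin 0 => A.carrier)) ICat.fst
      (fun i => (ICat.snd ≫ ICat.proj i) ≫ F.f)) ≫ G.f.obj) ?_
    rw [compData_zeta_app]
    simp only [hF, PsMorData.zetaAt_app, hG, ← Category.assoc, ICat.ident_cmp]
    simp
  zeta_unit a := by
    have hF := F.zeta_unit a
    have hG := G.zeta_unit (a ≫ F.f)
    rw [ICat.isIdentity₂_iff] at hF hG
    refine ICat.isIdentity₂_of_app _
      (ICat.Fun.obj (B.act (O.unit _) (fun _ => a ≫ F.f)) ≫ G.f.obj) ?_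
    rw [compData_zetaAt_app]
    simp only [hF, hG, ICat.ident_cmp]
    simp
  zeta_perm ρ o a := by
    simp only [compData_zetaAt_app]
    apply ICat.cmp_congr
    · exact G.zeta_perm ρ o (fun i => a i ≫ F.f)
    · rw [F.zeta_perm]
  zeta_phi o p a := by
    ext
    have h := congrArg ICat.Trans.app (comp_zeta_phi F G o p a)
    simp only [ICat.comp_app, compData_zetaAt_app, ActionData.act₂_app,
      ICat.whiskerRight_app] at h ⊢
    refine Eq.trans ?_ (h.trans ?_)
    · refine ICat.cmp_congr _ rfl ?_
      rw [ICat.cmp_assoc]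
      refine ICat.cmp_congr _ rfl (ICat.cmp_congr _ rfl ?_)
      simp [compData]
    · refine ICat.cmp_congr _ ?_ rfl
      exact C.phiAt_congr rfl rfl (by funext r s; exact Category.assoc _ _ _)

end PsMor

end PsAlg

namespace PsAlg

variable {V : Type u} [Category.{v} V] [HasFiniteLimits V] {O : ReducedOperad V}

/-- Algebra 2-cells `(f, ζ) ⟹ (g, κ)`: the 2-cells `τ : f ⟹ g` such that the two composites
`ξ(o; f a) ⟹ g θ(o; a)` agree. -/
structure PsCell {A B : PsAlg O} (F G : PsMor A B) where
  τ : F.f ⟶ G.f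
  tau_zeta : ∀ {X : ICat V} {n : ℕ} (o : X ⟶ O.obj n) (a : Fin n → (X ⟶ A.carrier)),
    B.act₂ o (fun i => a i ◁ τ) ≫ (G.zetaAt o a).hom = (F.zetaAt o a).hom ≫ A.act o a ◁ τ

namespace PsCell

variable {A B C D : PsAlg O}

theorem ext_app {F G : PsMor A B} {α β : PsCell F G} (h : α.τ.app = β.τ.app) : α = β := by
  obtain ⟨α, _⟩ := α
  obtain ⟨β, _⟩ := β
  obtain rfl : α = β := ICat.trans_ext h
  rfl

/-- The identity 2-cell. -/
noncomputable def id (F : PsMor A B) : PsCell F F where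
  τ := 𝟙 F.f
  tau_zeta o a := by
    have h : IsIdentity₂ (B.act₂ o (fun i => a i ◁ 𝟙 F.f)) :=
      B.act₂_isIdentity _ _ fun i => ⟨rfl, by simp⟩
    rw [ICat.isIdentity₂_iff] at h
    ext
    rw [ICat.comp_app, ICat.comp_app, ICat.cmp_congr _ h rfl, ICat.ident_cmp, whiskerLeft_id,
      ICat.cmp_congr _ rfl (ICat.id_app _), ICat.cmp_ident]

/-- Vertical composition. -/
noncomputable def vcomp {F G H : PsMor A B} (α : PsCell F G) (β : PsCell G H) : PsCell F H where
  τ := α.τ ≫ β.τ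
  tau_zeta o a := by
    have h : B.act₂ o (fun i => a i ◁ (α.τ ≫ β.τ)) =
        B.act₂ o (fun i => a i ◁ α.τ) ≫ B.act₂ o (fun i => a i ◁ β.τ) := by
      rw [← ActionData.act₂_comp]
      simp
    rw [h, Category.assoc, β.tau_zeta, ← Category.assoc, α.tau_zeta, Category.assoc]
    simp

/-- Precomposition of a 2-cell with a pseudomorphism. -/
noncomputable def whiskerL (F : PsMor A B) {G H : PsMor B C} (α : PsCell G H) :
    PsCell (F.comp G) (F.comp H) where
  τ := F.f ◁ α.τ
  tau_zeta o a := by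
    have h : C.act₂ o (fun i => (a i ≫ F.f) ◁ α.τ) ≫ (H.zetaAt o (fun i => a i ≫ F.f)).hom ≫
        (F.zetaAt o a).hom ▷ H.f =
        (G.zetaAt o (fun i => a i ≫ F.f)).hom ≫ (F.zetaAt o a).hom ▷ G.f ≫
          (A.act o a ≫ F.f) ◁ α.τ := by
      rw [← whisker_exchange, ← Category.assoc, α.tau_zeta]
      exact Category.assoc _ _ _
    ext
    replace h := congrArg ICat.Trans.app h
    simp only [ICat.comp_app, PsMor.comp, PsMor.compData_zetaAt_app, ActionData.act₂_app,
      ICat.cmp_assoc] at h ⊢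
    refine Eq.trans (ICat.cmp_congr _ ?_ rfl) (h.trans (ICat.cmp_congr _ rfl
      (ICat.cmp_congr _ rfl ?_)))
    · simp only [PsMor.compData, ICat.whiskerLeft_app, ICat.comp_obj, Category.assoc]
    · simp only [PsMor.compData, ICat.whiskerLeft_app, ICat.comp_obj, Category.assoc]

/-- Postcomposition of a 2-cell with a pseudomorphism. -/
noncomputable def whiskerR {F G : PsMor A B} (α : PsCell F G) (H : PsMor B C) :
    PsCell (F.comp H) (G.comp H) where
  τ := α.τ ▷ H.f
  tau_zeta o a := by
    have h : C.act₂ o (fun i => (a i ◁ α.τ) ▷ H.f) ≫ (H.zetaAt o (fun i => a i ≫ G.f)).hom ≫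
        (G.zetaAt o a).hom ▷ H.f =
        (H.zetaAt o (fun i => a i ≫ F.f)).hom ≫ (F.zetaAt o a).hom ▷ H.f ≫
          (A.act o a ◁ α.τ) ▷ H.f := by
      rw [← comp_whiskerRight, ← α.tau_zeta, comp_whiskerRight, ← Category.assoc,
        PsMor.zeta_natural]
      exact Category.assoc _ _ _
    ext
    replace h := congrArg ICat.Trans.app h
    simp only [ICat.comp_app, PsMor.comp, PsMor.compData_zetaAt_app, ActionData.act₂_app,
      ICat.cmp_assoc] at h ⊢
    refine Eq.trans (ICat.cmp_congr _ ?_ rfl) (h.trans (ICat.cmp_congr _ rfl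
      (ICat.cmp_congr _ rfl ?_)))
    · simp only [PsMor.compData, ICat.whiskerLeft_app, ICat.whiskerRight_app, Category.assoc]
    · simp only [PsMor.compData, ICat.whiskerLeft_app, ICat.whiskerRight_app, Category.assoc]

end PsCell

noncomputable instance : CategoryStruct (PsAlg O) where
  Hom := PsMor
  id := PsMor.id
  comp := PsMor.comp

/-- The category of pseudomorphisms `A ⟶ B` and algebra 2-cells. -/
@[reducible]
noncomputable def homCat (A B : PsAlg O) : Category (A ⟶ B) where
  Hom F G := PsCell F G
  id F := PsCell.id F
  comp α β := PsCell.vcomp α β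
  id_comp α := PsCell.ext_app (congrArg ICat.Trans.app (Category.id_comp α.τ))
  comp_id α := PsCell.ext_app (congrArg ICat.Trans.app (Category.comp_id α.τ))
  assoc α β κ := PsCell.ext_app (congrArg ICat.Trans.app (Category.assoc α.τ β.τ κ.τ))

theorem psMor_id_comp {A B : PsAlg O} (F : A ⟶ B) : 𝟙 A ≫ F = F := by
  refine PsMor.ext_app (Category.id_comp F.f) fun n => ?_
  refine (PsMor.compData_zeta_app _ _ _).trans ?_
  have h : ICat.lift ICat.fst (ICat.piLift fun i => (ICat.snd ≫ ICat.proj i) ≫ 𝟙 A.carrier) =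
      𝟙 (ICat.times (O.obj n) (ICat.pi fun _ : Fin n => A.carrier)) := by
    apply ICat.times_hom_ext
    · simp
    · apply ICat.pi_hom_ext
      intro i
      rw [ICat.lift_snd, ICat.piLift_proj, Category.id_comp, Category.comp_id]
  have h₁ : (F.zetaAt ICat.fst fun i => (ICat.snd ≫ ICat.proj i) ≫
      PsMorData.f (PsMor.toPsMorData (𝟙 A))).hom.app = (F.ζ n).hom.app := by
    refine (PsMorData.zetaAt_app _ _ _).trans ?_
    refine (congrArg (fun t => ICat.Fun.obj t ≫ (F.ζ n).hom.app) h).trans ?_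
    simp
  have h₂ : ICat.Trans.app (((PsMor.toPsMorData (𝟙 A)).ζ n).hom) =
      _ ≫ A.carrier.ident := ICat.eqToHom_app (PsMor.act_id A n)
  refine (ICat.cmp_congr _ h₁ ((congrArg (fun t => t ≫ F.f.mor) h₂).trans
    ((Category.assoc _ _ _).trans (congrArg (fun t => _ ≫ t) F.f.ident_mor)))).trans ?_
  exact ICat.cmp_ident_assoc _ _ _ _ _

theorem psMor_comp_id {A B : PsAlg O} (F : A ⟶ B) : F ≫ 𝟙 B = F := by
  refine PsMor.ext_app (Category.comp_id F.f) fun n => ?_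
  refine (PsMor.compData_zeta_app _ _ _).trans ?_
  refine (ICat.cmp_congr _ (PsMor.idData_zetaAt_app _ _ _) (Category.comp_id _)).trans ?_
  exact ICat.ident_cmp _ _ _ _

theorem psMor_assoc {A B C D : PsAlg O} (F : A ⟶ B) (G : B ⟶ C) (H : C ⟶ D) :
    (F ≫ G) ≫ H = F ≫ G ≫ H := by
  refine PsMor.ext_app (Category.assoc F.f G.f H.f) fun n => ?_
  refine (PsMor.compData_zeta_app _ _ _).trans (Eq.trans ?_ (PsMor.compData_zeta_app _ _ _).symm)
  have h₁ := PsMor.compData_zetaAt_app G.toPsMorData H.toPsMorData ICat.fst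
    (fun i : Fin n => (ICat.snd ≫ ICat.proj i) ≫ F.f)
  have h₂ := (congrArg (fun t => t ≫ H.f.mor)
    (PsMor.compData_zeta_app F.toPsMorData G.toPsMorData n)).trans (ICat.cmp_mor _ _ _ _)
  have h₃ : (H.zetaAt ICat.fst fun i : Fin n => (ICat.snd ≫ ICat.proj i) ≫
      PsMorData.f (PsMor.toPsMorData (F ≫ G))).hom.app =
      (H.zetaAt ICat.fst fun i => ((ICat.snd ≫ ICat.proj i) ≫ F.f) ≫ G.f).hom.app :=
    PsMorData.zetaAt_congr _ rfl (by funext i; exact (Category.assoc _ _ _).symm)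
  have h₄ : (F.ζ n).hom.app ≫ ICat.Fun.mor (PsMorData.f (PsMor.toPsMorData (G ≫ H))) =
      ((F.ζ n).hom.app ≫ G.f.mor) ≫ H.f.mor := (Category.assoc _ _ _).symm
  refine (ICat.cmp_congr _ h₃ h₂).trans (Eq.trans ?_ (ICat.cmp_congr _ h₁ h₄).symm)
  rw [ICat.cmp_assoc]

section

attribute [local instance] homCat

variable {A B C : PsAlg O}

theorem homCat_ext {F G : A ⟶ B} {α β : F ⟶ G} (h : α.τ.app = β.τ.app) : α = β :=
  PsCell.ext_app h

theorem homCat_id_app (F : A ⟶ B) :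
    ICat.Trans.app (PsCell.τ (𝟙 F)) = ICat.Fun.obj F.f ≫ B.carrier.ident := rfl

theorem homCat_comp_app {F G H : A ⟶ B} (α : F ⟶ G) (β : G ⟶ H) :
    ICat.Trans.app (PsCell.τ (α ≫ β)) = B.carrier.cmp α.τ.app β.τ.app (by simp) := rfl

theorem homCat_eqToHom_app {F G : A ⟶ B} (h : F = G) :
    ICat.Trans.app (PsCell.τ (eqToHom h)) = ICat.Fun.obj F.f ≫ B.carrier.ident := by
  subst h
  rfl

theorem id_f_obj (A : PsAlg O) :
    ICat.Fun.obj (PsMorData.f (PsMor.toPsMorData (𝟙 A))) = 𝟙 A.carrier.Ob := rfl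

theorem id_f_mor (A : PsAlg O) :
    ICat.Fun.mor (PsMorData.f (PsMor.toPsMorData (𝟙 A))) = 𝟙 A.carrier.Mor := rfl

theorem comp_f_obj (F : A ⟶ B) (G : B ⟶ C) :
    ICat.Fun.obj (PsMorData.f (PsMor.toPsMorData (F ≫ G))) = F.f.obj ≫ G.f.obj := rfl

theorem comp_f_mor (F : A ⟶ B) (G : B ⟶ C) :
    ICat.Fun.mor (PsMorData.f (PsMor.toPsMorData (F ≫ G))) = F.f.mor ≫ G.f.mor := rfl

theorem whiskerL_app (F : A ⟶ B) {G H : B ⟶ C} (α : G ⟶ H) :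
    ICat.Trans.app (PsCell.τ (PsCell.whiskerL F α)) = F.f.obj ≫ α.τ.app := rfl

theorem whiskerR_app {F G : A ⟶ B} (α : F ⟶ G) (H : B ⟶ C) :
    ICat.Trans.app (PsCell.τ (PsCell.whiskerR α H)) = α.τ.app ≫ H.f.mor := rfl

attribute [local simp] homCat_id_app homCat_comp_app homCat_eqToHom_app id_f_obj id_f_mor
  comp_f_obj comp_f_mor whiskerL_app whiskerR_app

attribute [local ext] homCat_ext

/-- The 2-category of `O`-pseudoalgebras, `O`-pseudomorphisms and algebra 2-cells. -/
noncomputable instance : Bicategory (PsAlg O) where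
  homCategory := homCat
  whiskerLeft F _ _ α := PsCell.whiskerL F α
  whiskerRight α H := PsCell.whiskerR α H
  associator F G H := eqToIso (psMor_assoc F G H)
  leftUnitor F := eqToIso (psMor_id_comp F)
  rightUnitor F := eqToIso (psMor_comp_id F)
  whiskerLeft_id F G := by ext; simp
  whiskerLeft_comp F _ _ _ α β := by ext; simp
  id_whiskerLeft α := by ext; simp [← Category.assoc]
  comp_whiskerLeft F G _ _ α := by ext; simp [← Category.assoc]
  id_whiskerRight F G := by ext; simp
  comp_whiskerRight α β F := by ext; simp
  whiskerRight_id α := by ext; simp [← Category.assoc]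
  whiskerRight_comp α F G := by ext; simp [← Category.assoc]
  whisker_assoc F _ _ α G := by ext; simp [← Category.assoc]
  whisker_exchange {_ _ _} {F G} {H K} α β := by ext; simpa using (β.τ.naturality' α.τ.app).symm
  pentagon F G H K := by ext; simp [← Category.assoc]; simp
  triangle F G := by ext; simp [← Category.assoc]; simp

end

instance : Bicategory.Strict (PsAlg O) where
  id_comp F := psMor_id_comp F
  comp_id F := psMor_comp_id F
  assoc F G H := psMor_assoc F G H

theorem isStrict_id (A : PsAlg O) : PsMor.IsStrict (𝟙 A) := fun n => ⟨PsMor.act_id A n, rfl⟩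

theorem isStrict_comp {A B C : PsAlg O} {F : A ⟶ B} {G : B ⟶ C} (hF : PsMor.IsStrict F)
    (hG : PsMor.IsStrict G) : PsMor.IsStrict (F ≫ G) := by
  intro n
  have hF := hF n
  have hG := hG n
  rw [ICat.isIdentity₂_iff] at hF hG
  refine ICat.isIdentity₂_of_app _ (ICat.Fun.obj (B.act
    (X := ICat.times (O.obj n) (ICat.pi fun _ : Fin n => A.carrier)) ICat.fst
    (fun i => (ICat.snd ≫ ICat.proj i) ≫ F.f)) ≫ G.f.obj) ?_
  refine (PsMor.compData_zeta_app _ _ _).trans ?_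
  simp only [hF, PsMorData.zetaAt_app, hG, ← Category.assoc, ICat.ident_cmp]
  simp

end PsAlg

/-- Strict `O`-algebras. -/
structure AlgSt {V : Type u} [Category.{v} V] [HasFiniteLimits V] (O : ReducedOperad V) where
  alg : PsAlg O
  isStrict : alg.IsStrict

namespace AlgSt

variable {V : Type u} [Category.{v} V] [HasFiniteLimits V] {O : ReducedOperad V}

/-- Strict `O`-maps. -/
@[ext]
structure StMor (A B : AlgSt O) where
  mor : A.alg ⟶ B.alg
  isStrict : PsAlg.PsMor.IsStrict mor

noncomputable instance : CategoryStruct (AlgSt O) where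
  Hom := StMor
  id A := ⟨𝟙 A.alg, PsAlg.isStrict_id _⟩
  comp F G := ⟨F.mor ≫ G.mor, PsAlg.isStrict_comp F.isStrict G.isStrict⟩

/-- The category of strict maps `A ⟶ B` and algebra 2-cells. -/
@[reducible]
noncomputable def homCat (A B : AlgSt O) : Category (A ⟶ B) where
  Hom F G := F.mor ⟶ G.mor
  id F := 𝟙 F.mor
  comp α β := CategoryStruct.comp (obj := A.alg ⟶ B.alg) α β
  id_comp _ := Category.id_comp (obj := A.alg ⟶ B.alg) _
  comp_id _ := Category.comp_id (obj := A.alg ⟶ B.alg) _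
  assoc _ _ _ := Category.assoc (obj := A.alg ⟶ B.alg) _ _ _

section

attribute [local instance] homCat

/-- An isomorphism in `homCat A B` from one in the category of pseudomorphisms. -/
noncomputable def homIso {A B : AlgSt O} {F G : A ⟶ B} (e : F.mor ≅ G.mor) : F ≅ G where
  hom := e.hom
  inv := e.inv
  hom_inv_id := e.hom_inv_id
  inv_hom_id := e.inv_hom_id

/-- The 2-category of strict `O`-algebras, strict `O`-maps and algebra 2-cells. -/
noncomputable instance : Bicategory (AlgSt O) where
  homCategory := homCat
  whiskerLeft F _ _ α := Bicategory.whiskerLeft (B := PsAlg O) F.mor α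
  whiskerRight α H := Bicategory.whiskerRight (B := PsAlg O) α H.mor
  associator F G H := homIso (α_ F.mor G.mor H.mor)
  leftUnitor F := homIso (λ_ F.mor)
  rightUnitor F := homIso (ρ_ F.mor)
  whiskerLeft_id _ _ := Bicategory.whiskerLeft_id (B := PsAlg O) _ _
  whiskerLeft_comp _ _ _ _ _ _ := Bicategory.whiskerLeft_comp (B := PsAlg O) _ _ _
  id_whiskerLeft _ := Bicategory.id_whiskerLeft (B := PsAlg O) _
  comp_whiskerLeft _ _ _ _ _ := Bicategory.comp_whiskerLeft (B := PsAlg O) _ _ _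
  id_whiskerRight _ _ := Bicategory.id_whiskerRight (B := PsAlg O) _ _
  comp_whiskerRight _ _ _ := Bicategory.comp_whiskerRight (B := PsAlg O) _ _ _
  whiskerRight_id _ := Bicategory.whiskerRight_id (B := PsAlg O) _
  whiskerRight_comp _ _ _ := Bicategory.whiskerRight_comp (B := PsAlg O) _ _ _
  whisker_assoc _ _ _ _ _ := Bicategory.whisker_assoc (B := PsAlg O) _ _ _
  whisker_exchange _ _ := Bicategory.whisker_exchange (B := PsAlg O) _ _
  pentagon _ _ _ _ := Bicategory.pentagon (B := PsAlg O) _ _ _ _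
  triangle _ _ := Bicategory.triangle (B := PsAlg O) _ _

end

theorem eqToHom_mor {A B : AlgSt O} {F G : A ⟶ B} (h : F = G) (h' : F.mor = G.mor) :
    (eqToHom h : F ⟶ G) = (eqToHom h' : F.mor ⟶ G.mor) := by
  subst h
  rfl

instance : Bicategory.Strict (AlgSt O) where
  id_comp F := StMor.ext (Category.id_comp F.mor)
  comp_id F := StMor.ext (Category.comp_id F.mor)
  assoc F G H := StMor.ext (Category.assoc F.mor G.mor H.mor)
  leftUnitor_eqToIso F := by
    apply Iso.ext
    exact (congrArg Iso.hom (Bicategory.Strict.leftUnitor_eqToIso F.mor)).trans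
      (eqToHom_mor (F := 𝟙 _ ≫ F) (G := F) (StMor.ext (Category.id_comp F.mor))
        (Category.id_comp F.mor)).symm
  rightUnitor_eqToIso F := by
    apply Iso.ext
    exact (congrArg Iso.hom (Bicategory.Strict.rightUnitor_eqToIso F.mor)).trans
      (eqToHom_mor (F := F ≫ 𝟙 _) (G := F) (StMor.ext (Category.comp_id F.mor))
        (Category.comp_id F.mor)).symm
  associator_eqToIso F G H := by
    apply Iso.ext
    exact (congrArg Iso.hom (Bicategory.Strict.associator_eqToIso F.mor G.mor H.mor)).trans
      (eqToHom_mor (F := (F ≫ G) ≫ H) (G := F ≫ G ≫ H) (StMor.ext (Category.assoc F.mor G.mor H.mor))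
        (Category.assoc F.mor G.mor H.mor)).symm

variable (O) in
/-- The inclusion 2-functor from strict algebras to pseudoalgebras. -/
noncomputable def inclusion : StrictPseudofunctor (AlgSt O) (PsAlg O) :=
  StrictPseudofunctor.mk''
    { obj := fun A => A.alg
      map := fun F => F.mor
      map₂ := fun α => α
      map₂_id := fun _ => rfl
      map₂_comp := fun _ _ => rfl
      map_id := fun _ => rfl
      map_comp := fun _ _ => rfl
      map₂_whisker_left := fun F _ _ α => by simp; rfl
      map₂_whisker_right := fun α G => by simp; rfl }

end AlgSt

/-! ### 2-adjunctions and internal equivalences -/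

universe w₁ v₁ u₁ w₂ v₂ u₂

section

variable {B : Type u₁} [Bicategory.{w₁, v₁} B] [Bicategory.Strict B]
  {C : Type u₂} [Bicategory.{w₂, v₂} C] [Bicategory.Strict C]

/-- 2-natural transformations between 2-functors of strict 2-categories. -/
structure TwoNatTrans (F G : StrictPseudofunctor B C) where
  app : ∀ b : B, F.obj b ⟶ G.obj b
  naturality : ∀ {a b : B} (f : a ⟶ b), F.map f ≫ app b = app a ≫ G.map f
  naturality₂ : ∀ {a b : B} {f g : a ⟶ b} (η : f ⟶ g),
    F.map₂ η ▷ app b ≫ eqToHom (naturality g) = eqToHom (naturality f) ≫ app a ◁ G.map₂ η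

/-- A 2-adjunction `F ⊣ G` of 2-functors: a 2-natural unit and a 2-natural counit that satisfy the
triangle identities. -/
structure TwoAdjunction (F : StrictPseudofunctor B C) (G : StrictPseudofunctor C B) where
  unit : TwoNatTrans (StrictPseudofunctor.id B) (F.comp G)
  counit : TwoNatTrans (G.comp F) (StrictPseudofunctor.id C)
  left_triangle : ∀ b : B, F.map (unit.app b) ≫ counit.app (F.obj b) = 𝟙 (F.obj b)
  right_triangle : ∀ c : C, unit.app (G.obj c) ≫ G.map (counit.app c) = 𝟙 (G.obj c)

/-- Internal equivalences in a 2-category: 1-cells with a pseudo-inverse. -/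
def IsInternalEquivalence {a b : B} (f : a ⟶ b) : Prop :=
  ∃ g : b ⟶ a, Nonempty (𝟙 a ≅ f ≫ g) ∧ Nonempty (g ≫ f ≅ 𝟙 b)

end

/-! The objects of the strictification of A are words (o; a₁, …, aₙ), taken modulo permutation of
the arguments and omission of arguments equal to the base point θ₀; they form the object `FreeOb`.
The morphisms are pulled back from A along the evaluation ε : (o; a) ↦ θ(o; a). So ε is fully
faithful by construction, and η : a ↦ (1; a) satisfies εη = 1 and ηε ≅ 1.

`FreeOb` is a colimit, and operations on n words at once have to descend to it, although products
are only known to preserve connected colimits. The defining diagram is connected, because omitting a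
base point links length n + 1 with length n; this is where O(0) being trivial matters. Descending
one variable at a time gives `exists_desc`, with uniqueness `desc_ext`. From then on an identity
between operations on classes is checked on representing words over discrete categories, where it is
an operad or pseudoalgebra axiom.

Operadic composition of words acts on classes. The isomorphism φ depends only on the classes of the
inner words (`Rel.phi_eq`), so it gives isomorphisms θ(o; ε s₁, …, ε sₙ) ≅ ε(o · s). Transport of θ
along them is the action on morphisms. A transported functor is determined by the original functor
and the components of the isomorphism, and the associativity coherence of φ says that two successive
transports have the same components as the single one (`stZetaAt_comp`). Hence the action is
strictly associative (`stAction_comp`), and ε is a pseudomorphism whose structure isomorphisms are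
the φ.

For the universal property, let F = (f, ζ) be a pseudomorphism from A to a strict algebra. The
assignment (o; a) ↦ ξ(o; f a) is well defined on classes, and ζ makes it isomorphic to f ε.
Transport of f ε along ζ is a strict map that extends F along η (`descFun_act`, `stUnit_stDesc`). It
is the only one: the component of 1 ≅ ηε at the class of a word is the structure isomorphism of η at
that word, and a strict map G sends it to the structure isomorphism of Gη, so G is recovered from Gη
(`st_hom_ext`). For 2-cells, conjugation by 1 ≅ ηε shows that restriction along η is bijective
(`st_cell_ext`, `stUnitFun_stCell_app`). The 2-functor, the counit and the triangle identities
follow by comparison after restriction along η, and εη = 1, ηε ≅ 1 is the required internal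
equivalence. -/

namespace ICat

variable {V : Type u} [Category.{v} V] [HasFiniteLimits V]

attribute [local simp] pullback.lift_fst pullback.lift_fst_assoc pullback.lift_snd
  pullback.lift_snd_assoc prod.lift_fst prod.lift_fst_assoc prod.lift_snd prod.lift_snd_assoc

/-! ### Discrete internal categories -/

/-- The discrete internal category on an object. -/
noncomputable def disc (X : V) : ICat V where
  Ob := X
  Mor := X
  src := 𝟙 X
  tgt := 𝟙 X
  ident := 𝟙 X
  comp := pullback.fst _ _
  ident_src := by simp
  ident_tgt := by simp
  comp_src := by simp
  comp_tgt := by simpa using pullback.condition (f := 𝟙 X) (g := 𝟙 X)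
  ident_comp := by simp
  comp_ident := by simp
  assoc f g h hfg hgh := by simp

/-- The functor out of a discrete internal category with given values. -/
noncomputable def ofOb {X : V} {C : ICat V} (x : X ⟶ C.Ob) : disc X ⟶ C :=
  Fun.mk (C := disc X) x (x ≫ C.ident) (by simp [disc]) (by simp [disc]) (by simp [disc])
    (by
      -- Composable pairs in a discrete category lie on the diagonal, so the two projections agree.
      have h : pullback.snd (disc X).tgt (disc X).src = pullback.fst (disc X).tgt (disc X).src := by
        have := pullback.condition (f := (disc X).tgt) (g := (disc X).src)
        exact ((Category.comp_id _).symm.trans this.symm).trans (Category.comp_id _)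
      refine ((C.ident_cmp (pullback.fst (disc X).tgt (disc X).src ≫ x)
          (pullback.fst (disc X).tgt (disc X).src ≫ x ≫ C.ident)
          ((Category.assoc _ _ _).trans ((ident_tgt' C _).trans
            ((congrArg (fun t => pullback.fst (disc X).tgt (disc X).src ≫ t)
              ((Category.assoc _ _ _).trans (ident_src' C x))).symm.trans
                (Category.assoc _ _ _).symm)))).symm.trans
        (C.cmp_congr (Category.assoc _ _ _) ?_))
      exact congrArg (fun t => t ≫ x ≫ C.ident) h.symm)

/-- Preservation of identities forces the morphism part, since every morphism of `disc X` is an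
identity. So functors out of `disc X` are the same as maps X ⟶ C.Ob, and statements about
generalized functors can be tested on maps of V. -/
theorem disc_hom_ext {X : V} {C : ICat V} {F G : disc X ⟶ C} (h : F.obj = G.obj) : F = G := by
  have key : ∀ H : disc X ⟶ C, H.mor = H.obj ≫ C.ident := fun H =>
    (Category.id_comp H.mor).symm.trans H.ident_mor
  exact hom_ext h (by rw [key F, key G, h])

theorem ofOb_obj_eq {X : V} {C : ICat V} (F : disc X ⟶ C) : ofOb (X := X) F.obj = F :=
  disc_hom_ext rfl

theorem comp_ofOb {X Y : V} {C : ICat V} (y : Y ⟶ X) (x : X ⟶ C.Ob) :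
    ofOb (C := disc X) y ≫ ofOb x = ofOb (y ≫ x) :=
  disc_hom_ext rfl

/-! ### Functors into a full image -/

section Induced

variable (A : ICat V) {S : V} (e : S ⟶ A.Ob)

/-- The object of triples `(u, s, t)` of a morphism `u : e s ⟶ e t` of `A` and `s`, `t` in `S`. -/
noncomputable abbrev InducedMor : V := pullback (prod.lift A.src A.tgt) (prod.map e e)

/-- The underlying morphism of `A`. -/
noncomputable def inducedVal : A.InducedMor e ⟶ A.Mor := pullback.fst _ _

/-- The source. -/
noncomputable def inducedSrc : A.InducedMor e ⟶ S := pullback.snd _ _ ≫ prod.fst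

/-- The target. -/
noncomputable def inducedTgt : A.InducedMor e ⟶ S := pullback.snd _ _ ≫ prod.snd

theorem inducedVal_src : A.inducedVal e ≫ A.src = A.inducedSrc e ≫ e := by
  have := congrArg (fun t => t ≫ prod.fst)
    (pullback.condition (f := prod.lift A.src A.tgt) (g := prod.map e e))
  rw [Category.assoc, prod.lift_fst, Category.assoc, prod.map_fst, ← Category.assoc] at this
  exact this

theorem inducedVal_tgt : A.inducedVal e ≫ A.tgt = A.inducedTgt e ≫ e := by
  have := congrArg (fun t => t ≫ prod.snd)
    (pullback.condition (f := prod.lift A.src A.tgt) (g := prod.map e e))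
  rw [Category.assoc, prod.lift_snd, Category.assoc, prod.map_snd, ← Category.assoc] at this
  exact this

variable {A e}

theorem inducedMor_ext {X : V} {f g : X ⟶ A.InducedMor e}
    (h₀ : f ≫ A.inducedVal e = g ≫ A.inducedVal e) (h₁ : f ≫ A.inducedSrc e = g ≫ A.inducedSrc e)
    (h₂ : f ≫ A.inducedTgt e = g ≫ A.inducedTgt e) : f = g := by
  apply pullback.hom_ext h₀
  apply prod.hom_ext
  · simpa [inducedSrc] using h₁
  · simpa [inducedTgt] using h₂

/-- The map into `InducedMor` with given components. -/
noncomputable def inducedMk {X : V} (u : X ⟶ A.Mor) (s t : X ⟶ S) (hs : u ≫ A.src = s ≫ e)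
    (ht : u ≫ A.tgt = t ≫ e) : X ⟶ A.InducedMor e :=
  pullback.lift u (prod.lift s t) (by ext <;> simp [hs, ht])

section

variable {X : V} (u : X ⟶ A.Mor) (s t : X ⟶ S) (hs : u ≫ A.src = s ≫ e)
    (ht : u ≫ A.tgt = t ≫ e)

@[simp]
theorem inducedMk_val : inducedMk u s t hs ht ≫ A.inducedVal e = u := by
  simp [inducedMk, inducedVal]

@[simp]
theorem inducedMk_src : inducedMk u s t hs ht ≫ A.inducedSrc e = s := by
  simp [inducedMk, inducedSrc]

@[simp]
theorem inducedMk_tgt : inducedMk u s t hs ht ≫ A.inducedTgt e = t := by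
  simp [inducedMk, inducedTgt]

end

variable (A e)

theorem inducedComp_aux : (pullback.fst (A.inducedTgt e) (A.inducedSrc e) ≫ A.inducedVal e) ≫ A.tgt =
    (pullback.snd (A.inducedTgt e) (A.inducedSrc e) ≫ A.inducedVal e) ≫ A.src := by
  rw [Category.assoc, Category.assoc, inducedVal_src, inducedVal_tgt, pullback.condition_assoc]

/-- Composition of triples. -/
noncomputable def inducedComp : pullback (A.inducedTgt e) (A.inducedSrc e) ⟶ A.InducedMor e :=
  inducedMk (A.cmp (pullback.fst _ _ ≫ A.inducedVal e) (pullback.snd _ _ ≫ A.inducedVal e)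
    (A.inducedComp_aux e)) (pullback.fst _ _ ≫ A.inducedSrc e) (pullback.snd _ _ ≫ A.inducedTgt e)
    (by simp [inducedVal_src]) (by simp [inducedVal_tgt])

theorem lift_inducedComp {X : V} (f g : X ⟶ A.InducedMor e)
    (h : f ≫ A.inducedTgt e = g ≫ A.inducedSrc e) :
    pullback.lift f g h ≫ A.inducedComp e =
      inducedMk (A.cmp (f ≫ A.inducedVal e) (g ≫ A.inducedVal e)
        (by simp [inducedVal_src, inducedVal_tgt, reassoc_of% h]))
        (f ≫ A.inducedSrc e) (g ≫ A.inducedTgt e)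
        (by simp [inducedVal_src]) (by simp [inducedVal_tgt]) := by
  apply inducedMor_ext <;> simp [inducedComp]

theorem inducedComp_val : A.inducedComp e ≫ A.inducedVal e =
    A.cmp (pullback.fst _ _ ≫ A.inducedVal e) (pullback.snd _ _ ≫ A.inducedVal e)
      (A.inducedComp_aux e) :=
  inducedMk_val _ _ _ _ _

/-- The full image of a map `e : S ⟶ A.Ob`: objects are those of `S`, morphisms `s ⟶ t` are the
morphisms `e s ⟶ e t` of `A`. -/
noncomputable def induced : ICat V where
  Ob := S
  Mor := A.InducedMor e
  src := A.inducedSrc e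
  tgt := A.inducedTgt e
  ident := inducedMk (e ≫ A.ident) (𝟙 S) (𝟙 S) (by simp) (by simp)
  comp := A.inducedComp e
  ident_src := by simp
  ident_tgt := by simp
  comp_src := by simp [inducedComp]
  comp_tgt := by simp [inducedComp]
  ident_comp := by
    rw [lift_inducedComp]
    apply inducedMor_ext <;> simp
  comp_ident := by
    rw [lift_inducedComp]
    apply inducedMor_ext <;> simp
  assoc f g h hfg hgh := by
    simp only [lift_inducedComp]
    apply inducedMor_ext <;> simp

/-- The fully faithful functor from the full image. -/
noncomputable def inducedFun : A.induced e ⟶ A :=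
  Fun.mk (C := A.induced e) e (A.inducedVal e) (A.inducedVal_src e) (A.inducedVal_tgt e)
    (inducedMk_val (e ≫ A.ident) (𝟙 S) (𝟙 S) (by simp) (by simp)) (A.inducedComp_val e)

variable {A e}

theorem induced_mor_ext {X : V} {f g : X ⟶ (A.induced e).Mor}
    (h₀ : f ≫ (A.inducedFun e).mor = g ≫ (A.inducedFun e).mor)
    (h₁ : f ≫ (A.induced e).src = g ≫ (A.induced e).src)
    (h₂ : f ≫ (A.induced e).tgt = g ≫ (A.induced e).tgt) : f = g :=
  inducedMor_ext h₀ h₁ h₂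

/-- The generalized morphism of the full image with given components. -/
noncomputable def inducedHom {X : V} (u : X ⟶ A.Mor) (s t : X ⟶ (A.induced e).Ob)
    (hs : u ≫ A.src = s ≫ (A.inducedFun e).obj) (ht : u ≫ A.tgt = t ≫ (A.inducedFun e).obj) :
    X ⟶ (A.induced e).Mor :=
  inducedMk u s t hs ht

section

variable {X : V} (u : X ⟶ A.Mor) (s t : X ⟶ (A.induced e).Ob)
    (hs : u ≫ A.src = s ≫ (A.inducedFun e).obj) (ht : u ≫ A.tgt = t ≫ (A.inducedFun e).obj)

@[simp]
theorem inducedHom_mor : inducedHom u s t hs ht ≫ (A.inducedFun e).mor = u :=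
  inducedMk_val u s t hs ht

@[simp]
theorem inducedHom_src : inducedHom u s t hs ht ≫ (A.induced e).src = s :=
  inducedMk_src u s t hs ht

@[simp]
theorem inducedHom_tgt : inducedHom u s t hs ht ≫ (A.induced e).tgt = t :=
  inducedMk_tgt u s t hs ht

end

/-- The full image is a pullback: its morphisms are determined by their endpoints and their image in
A. The object map has to be compared separately, because `e` need not be monic. -/
theorem induced_hom_ext {X : ICat V} {F G : X ⟶ A.induced e} (h₀ : F.obj = G.obj)
    (h : F ≫ A.inducedFun e = G ≫ A.inducedFun e) : F = G := by
  apply hom_ext h₀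
  apply induced_mor_ext (congrArg Fun.mor h)
  · rw [F.mor_src, G.mor_src, h₀]
  · rw [F.mor_tgt, G.mor_tgt, h₀]

/-- The functor into the full image with given underlying functor and given values on objects. -/
noncomputable def inducedLift {X : ICat V} (F : X ⟶ A) (x : X.Ob ⟶ (A.induced e).Ob)
    (h : F.obj = x ≫ (A.inducedFun e).obj) : X ⟶ A.induced e :=
  Fun.mk (D := A.induced e) x
    (inducedHom F.mor (X.src ≫ x) (X.tgt ≫ x) (by simp only [Fun.mor_src, h, Category.assoc])
      (by simp only [Fun.mor_tgt, h, Category.assoc]))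
    (by simp) (by simp)
    (by
      apply induced_mor_ext
      · rw [Category.assoc, inducedHom_mor, Category.assoc, Fun.ident_mor, Fun.ident_mor, h,
          Category.assoc]
      · rw [Category.assoc, inducedHom_src, Category.assoc, ident_src, ← Category.assoc, ident_src,
          Category.id_comp, Category.comp_id]
      · rw [Category.assoc, inducedHom_tgt, Category.assoc, ident_tgt, ← Category.assoc, ident_tgt,
          Category.id_comp, Category.comp_id])
    (by
      apply induced_mor_ext
      · rw [cmp_mor]
        simp only [Category.assoc, inducedHom_mor, F.comp_mor]
      · rw [cmp_src]
        simp only [Category.assoc, inducedHom_src]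
        rw [← Category.assoc, X.comp_src, Category.assoc]
      · rw [cmp_tgt]
        simp only [Category.assoc, inducedHom_tgt]
        rw [← Category.assoc, X.comp_tgt, Category.assoc])

theorem inducedLift_comp {X : ICat V} (F : X ⟶ A) (x : X.Ob ⟶ (A.induced e).Ob)
    (h : F.obj = x ≫ (A.inducedFun e).obj) : inducedLift F x h ≫ A.inducedFun e = F :=
  hom_ext h.symm (inducedHom_mor F.mor (X.src ≫ x) (X.tgt ≫ x)
    (by simp only [Fun.mor_src, h, Category.assoc]) (by simp only [Fun.mor_tgt, h, Category.assoc]))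

/-- Transformations into the full image are transformations of the underlying functors. -/
noncomputable def inducedTrans {X : ICat V} {F G : X ⟶ A.induced e}
    (α : F ≫ A.inducedFun e ⟶ G ≫ A.inducedFun e) : F ⟶ G :=
  Trans.mk (D := A.induced e)
    (inducedHom α.app F.obj G.obj α.app_src α.app_tgt)
    (by simp) (by simp)
    (by
      apply induced_mor_ext
      · have := α.naturality
        simpa using this
      · simp
      · simp)

theorem inducedTrans_app_mor {X : ICat V} {F G : X ⟶ A.induced e}
    (α : F ≫ A.inducedFun e ⟶ G ≫ A.inducedFun e) :
    Trans.app (inducedTrans α) ≫ (A.inducedFun e).mor = α.app :=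
  inducedHom_mor α.app F.obj G.obj α.app_src α.app_tgt

/-- The endpoints of the components are prescribed by F and G, so only the underlying morphisms of A
remain to be compared. -/
theorem induced_trans_ext {X : ICat V} {F G : X ⟶ A.induced e} {α β : F ⟶ G}
    (h : α.app ≫ (A.inducedFun e).mor = β.app ≫ (A.inducedFun e).mor) : α = β := by
  apply trans_ext
  apply induced_mor_ext h
  · rw [α.app_src, β.app_src]
  · rw [α.app_tgt, β.app_tgt]

/-- Isomorphisms of functors into the full image. -/
noncomputable def inducedIso {X : ICat V} {F G : X ⟶ A.induced e}
    (α : F ≫ A.inducedFun e ≅ G ≫ A.inducedFun e) : F ≅ G where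
  hom := inducedTrans α.hom
  inv := inducedTrans α.inv
  hom_inv_id := by
    apply induced_trans_ext
    have := congrArg Trans.app α.hom_inv_id
    rw [comp_app, id_app] at this
    rw [comp_app, id_app, cmp_mor, cmp_congr _ (inducedTrans_app_mor _) (inducedTrans_app_mor _),
      this, Category.assoc, Fun.ident_mor, comp_obj, Category.assoc]
  inv_hom_id := by
    apply induced_trans_ext
    have := congrArg Trans.app α.inv_hom_id
    rw [comp_app, id_app] at this
    rw [comp_app, id_app, cmp_mor, cmp_congr _ (inducedTrans_app_mor _) (inducedTrans_app_mor _),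
      this, Category.assoc, Fun.ident_mor, comp_obj, Category.assoc]

theorem inducedIso_hom_app_mor {X : ICat V} {F G : X ⟶ A.induced e}
    (α : F ≫ A.inducedFun e ≅ G ≫ A.inducedFun e) :
    Trans.app (inducedIso α).hom ≫ (A.inducedFun e).mor = α.hom.app :=
  inducedTrans_app_mor _

end Induced

/-! ### Transport of functors along families of isomorphisms -/

/-- A family of isomorphisms of `A` indexed by `X` with its family of inverses. -/
structure IsoFam (A : ICat V) (X : V) where
  hom : X ⟶ A.Mor
  inv : X ⟶ A.Mor
  inv_src : inv ≫ A.src = hom ≫ A.tgt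
  inv_tgt : inv ≫ A.tgt = hom ≫ A.src
  hom_inv : A.cmp hom inv inv_src.symm = (hom ≫ A.src) ≫ A.ident
  inv_hom : A.cmp inv hom inv_tgt = (hom ≫ A.tgt) ≫ A.ident

section Conj

variable {A : ICat V} {X : ICat V}

/-- The cancellation that makes conjugation compatible with composition. -/
theorem IsoFam.hom_inv_cmp (α : IsoFam A X.Ob) {Z : V} (z : Z ⟶ X.Ob) (f : Z ⟶ A.Mor)
    (h : z ≫ α.hom ≫ A.src = f ≫ A.src) :
    A.cmp (z ≫ α.hom) (A.cmp (z ≫ α.inv) f (by simpa [α.inv_tgt] using h)) (by simp [α.inv_src]) =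
      f := by
  rw [← cmp_assoc _ _ _ _ (by simp [α.inv_src]) (by simpa [α.inv_tgt] using h)]
  have := congrArg (fun t => z ≫ t) α.hom_inv
  simp only [precomp_cmp, Category.assoc] at this
  rw [A.cmp_congr this rfl]
  simp

/-- The functor obtained from `F` by transport along isomorphisms `F x ≅ y`. -/
noncomputable def conj (F : X ⟶ A) (α : IsoFam A X.Ob) (h : α.hom ≫ A.src = F.obj) : X ⟶ A :=
  Fun.mk (α.hom ≫ A.tgt)
    (A.cmp (X.src ≫ α.inv) (A.cmp F.mor (X.tgt ≫ α.hom) (by simp [h]))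
      (by simp [h, α.inv_tgt]))
    (by simp [α.inv_src]) (by simp)
    (by
      simp only [precomp_cmp, Fun.ident_mor]
      simp only [← Category.assoc, X.ident_src, X.ident_tgt, Category.id_comp, ident_cmp]
      rw [α.inv_hom])
    (by
      simp only [precomp_cmp, F.comp_mor, cmp_assoc]
      refine cmp_congr _ (by simp only [← Category.assoc, X.comp_src])
        (cmp_congr _ rfl ?_)
      -- Insert α followed by its inverse at the middle object; the result is the composite of the
      -- two conjugated morphisms.
      refine Eq.trans ?_ ((α.hom_inv_cmp (pullback.fst X.tgt X.src ≫ X.tgt)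
        (A.cmp (pullback.snd X.tgt X.src ≫ F.mor) (pullback.snd X.tgt X.src ≫ X.tgt ≫ α.hom)
          (by simp [h])) (by simp [h, pullback.condition_assoc])).symm.trans
        (cmp_congr _ (Category.assoc _ _ _) (cmp_congr _ (by simp [pullback.condition_assoc]) rfl)))
      exact cmp_congr _ rfl (by simp only [← Category.assoc, X.comp_tgt]))

theorem conj_obj (F : X ⟶ A) (α : IsoFam A X.Ob) (h : α.hom ≫ A.src = F.obj) :
    Fun.obj (conj F α h) = α.hom ≫ A.tgt := rfl

/-- The isomorphism from a functor to its transport. -/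
noncomputable def conjIso (F : X ⟶ A) (α : IsoFam A X.Ob) (h : α.hom ≫ A.src = F.obj) :
    F ≅ conj F α h where
  hom := Trans.mk α.hom h rfl (by
    simp only [conj]
    rw [α.hom_inv_cmp _ _ (by simp [h])])
  inv := Trans.mk α.inv (by rw [conj_obj, α.inv_src]) (by rw [α.inv_tgt, h]) (by
    simp only [conj, cmp_assoc]
    congr 1
    have := congrArg (fun t => X.tgt ≫ t) α.hom_inv
    simp only [precomp_cmp, Category.assoc] at this
    rw [A.cmp_congr rfl this]
    simp)
  hom_inv_id := by
    ext
    exact α.hom_inv.trans (by rw [h]; rfl)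
  inv_hom_id := by
    ext
    exact α.inv_hom

/-- Inverses are unique. -/
theorem inv_unique {Z : V} {f g g' : Z ⟶ A.Mor} (h₁ : g ≫ A.tgt = f ≫ A.src)
    (h₂ : f ≫ A.tgt = g' ≫ A.src) (hgf : A.cmp g f h₁ = (f ≫ A.tgt) ≫ A.ident)
    (hfg' : A.cmp f g' h₂ = (f ≫ A.src) ≫ A.ident) : g = g' := by
  have h := A.cmp_assoc g f g' h₁ (by simpa using h₂)
  rw [A.cmp_congr hgf rfl, A.cmp_congr rfl hfg', ident_cmp, cmp_ident] at h
  exact h.symm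

/-- Two functors isomorphic to `F` by isomorphisms with equal components are equal. -/
theorem eq_of_iso_from {F F' G H : X ⟶ A} (α : F ≅ G) (β : F' ⟶ H) (hF : F = F')
    (h : α.hom.app = β.app) : G = H := by
  subst hF
  have h₁ : IsIdentity₂ (α.inv ≫ β) := by
    rw [isIdentity₂_iff, comp_app]
    have := congrArg Trans.app α.inv_hom_id
    rw [comp_app, id_app] at this
    rw [← this]
    exact cmp_congr _ rfl h.symm
  exact h₁.1

/-- The composite of α with the inverse of β has identity components, and a transformation with
identity components has equal source and target. Together with `eq_of_iso_from`, this reduces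
equalities of functors, hence all strictness claims below, to equalities of components. -/
theorem eq_of_iso_to {F G H H' : X ⟶ A} (α : F ⟶ H) (β : G ≅ H') (hH : H = H')
    (h : α.app = β.hom.app) : F = G := by
  subst hH
  have h₁ : IsIdentity₂ (α ≫ β.inv) := by
    have := congrArg Trans.app β.hom_inv_id
    rw [comp_app, id_app] at this
    refine isIdentity₂_of_app _ G.obj ?_
    rw [comp_app, ← this]
    exact cmp_congr _ h rfl
  exact h₁.1

end Conj

end ICat

/-! ### Juxtaposition of blocks -/

/-- The offset of a block is written as a sum over all indices with an indicator, so that it can be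
reindexed when blocks are nested. -/
theorem finSigmaFinEquiv_val {n : ℕ} {m : Fin n → ℕ} (x : (r : Fin n) × Fin (m r)) :
    (finSigmaFinEquiv x : ℕ) = (∑ i, if i < x.1 then m i else 0) + x.2 := by
  rw [finSigmaFinEquiv_apply]
  congr 1
  rw [← Finset.sum_filter]
  refine Finset.sum_bij (fun i _ => Fin.castLE x.1.2.le i) ?_ ?_ ?_ ?_
  · intro i _
    exact Finset.mem_filter.mpr ⟨Finset.mem_univ _, i.2⟩
  · intro i _ j _ h
    simpa [Fin.ext_iff] using h
  · intro j hj
    have hj : j < x.1 := by simpa using hj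
    exact ⟨⟨j, hj⟩, Finset.mem_univ _, rfl⟩
  · intro i _
    rfl

/-- The offset of a later block is at least the offset of the present block plus its length, which
exceeds every position in the present block. -/
theorem finSigmaFinEquiv_lt_of_lex {n : ℕ} {m : Fin n → ℕ} {x y : (r : Fin n) × Fin (m r)}
    (h : x.1 < y.1 ∨ (x.1 = y.1 ∧ (x.2 : ℕ) < y.2)) :
    finSigmaFinEquiv x < finSigmaFinEquiv y := by
  rw [Fin.lt_def, finSigmaFinEquiv_val, finSigmaFinEquiv_val]
  obtain ⟨x, s⟩ := x
  obtain ⟨y, t⟩ := y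
  rcases h with h | ⟨h, h'⟩
  · have h₁ : (∑ i, if i < x then m i else 0) + m x ≤ ∑ i, if i < y then m i else 0 := by
      have : m x = ∑ i, if i = x then m i else 0 := by simp
      rw [this, ← Finset.sum_add_distrib]
      refine Finset.sum_le_sum fun i _ => ?_
      by_cases h₂ : i < x
      · simp [h₂, h₂.ne, h₂.trans h]
      · by_cases h₃ : i = x
        · subst h₃
          simp [show i < y from h]
        · simp [h₂, h₃]
    have := s.2
    simp only at *
    omega
  · obtain rfl : x = y := h
    simp only at *
    omega

theorem finSigmaFinEquiv_lt_iff {n : ℕ} {m : Fin n → ℕ} {x y : (r : Fin n) × Fin (m r)} :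
    finSigmaFinEquiv x < finSigmaFinEquiv y ↔
      (x.1 < y.1 ∨ (x.1 = y.1 ∧ (x.2 : ℕ) < y.2)) := by
  refine ⟨fun h => ?_, finSigmaFinEquiv_lt_of_lex⟩
  by_contra hc
  push Not at hc
  rcases lt_trichotomy x.1 y.1 with h₁ | h₁ | h₁
  · exact absurd h₁ (not_lt.mpr hc.1)
  · rcases lt_or_eq_of_le (hc.2 h₁) with h₂ | h₂
    · exact absurd h (not_lt.mpr (finSigmaFinEquiv_lt_of_lex (Or.inr ⟨h₁.symm, h₂⟩)).le)
    · have : x = y := by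
        obtain ⟨r, s⟩ := x
        obtain ⟨r', s'⟩ := y
        obtain rfl : r = r' := h₁
        obtain rfl : s = s' := Fin.ext h₂.symm
        rfl
      exact absurd h (this ▸ lt_irrefl _)
  · exact absurd h (not_lt.mpr (finSigmaFinEquiv_lt_of_lex (Or.inl h₁)).le)

theorem flatten_finSigmaFinEquiv {n : ℕ} {m : Fin n → ℕ} {α : Type*} (x : ∀ r, Fin (m r) → α)
    (y : (r : Fin n) × Fin (m r)) : flatten x (finSigmaFinEquiv y) = x y.1 y.2 := by
  have key : ∀ z, z = y → x z.1 z.2 = x y.1 y.2 := by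
    rintro z rfl
    rfl
  exact key _ (Equiv.symm_apply_apply _ _)

/-- Lexicographically, the pairs before (r, s) are all pairs in earlier rows and the earlier pairs
in row r. -/
theorem sum_lt_finSigmaFinEquiv {n : ℕ} {m : Fin n → ℕ} (l : ∀ r, Fin (m r) → ℕ) (r : Fin n)
    (s : Fin (m r)) :
    (∑ k, if k < finSigmaFinEquiv ⟨r, s⟩ then flatten l k else 0) =
      (∑ i, if i < r then ∑ j, l i j else 0) + ∑ j, if j < s then l r j else 0 := by
  rw [← Equiv.sum_comp finSigmaFinEquiv, Fintype.sum_sigma]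
  have h : ∀ i, (∑ j, if finSigmaFinEquiv ⟨i, j⟩ < finSigmaFinEquiv (⟨r, s⟩ : (r : Fin n) × Fin (m r))
      then flatten l (finSigmaFinEquiv ⟨i, j⟩) else 0) =
      (if i < r then ∑ j, l i j else 0) + if i = r then
        ∑ j : Fin (m i), (if (j : ℕ) < s then l i j else 0) else 0 := by
    intro i
    have hf : ∀ j, flatten l (finSigmaFinEquiv ⟨i, j⟩) = l i j := fun j =>
      flatten_finSigmaFinEquiv l ⟨i, j⟩
    rw [Finset.sum_congr rfl fun j _ => by rw [hf j]]
    simp only [finSigmaFinEquiv_lt_iff]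
    by_cases h₁ : i < r
    · simp [h₁, h₁.ne]
    · by_cases h₂ : i = r
      · simp [h₂]
      · simp [h₁, h₂]
  rw [Finset.sum_congr rfl fun i _ => h i, Finset.sum_add_distrib]
  simp

/-- Both sides are offset plus position. The index t' is t in a type that is only propositionally
equal, so it enters through its value alone. -/
theorem finSigmaFinEquiv_assoc {n : ℕ} {m : Fin n → ℕ} {l : ∀ r, Fin (m r) → ℕ} (r : Fin n)
    (s : Fin (m r)) (t : Fin (l r s)) (t' : Fin (flatten l (finSigmaFinEquiv ⟨r, s⟩)))
    (ht : (t' : ℕ) = t) :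
    (finSigmaFinEquiv (n := fun r => ∑ s, l r s) ⟨r, finSigmaFinEquiv ⟨s, t⟩⟩ : ℕ) =
      finSigmaFinEquiv (n := flatten l) ⟨finSigmaFinEquiv ⟨r, s⟩, t'⟩ := by
  rw [finSigmaFinEquiv_val, finSigmaFinEquiv_val, finSigmaFinEquiv_val]
  simp only
  rw [sum_lt_finSigmaFinEquiv, ht, add_assoc]

/-- Associativity of juxtaposition, up to the cast between the two expressions for the total length.
It is the half of the associativity of word composition that concerns the arguments. -/
theorem flatten_flatten {n : ℕ} {m : Fin n → ℕ} {l : ∀ r, Fin (m r) → ℕ} {α : Type*}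
    (x : ∀ r s, Fin (l r s) → α) (i : Fin (∑ r, ∑ s, l r s)) :
    flatten (fun r => flatten (x r)) i =
      flatten (m := flatten l)
        (fun k => x (finSigmaFinEquiv.symm k).1 (finSigmaFinEquiv.symm k).2)
        (Fin.cast (sum_flatten l) i) := by
  obtain ⟨⟨r, j⟩, rfl⟩ := finSigmaFinEquiv.surjective i
  obtain ⟨⟨s, t⟩, rfl⟩ := finSigmaFinEquiv.surjective j
  have hl : l r s = flatten l (finSigmaFinEquiv ⟨r, s⟩) := (flatten_finSigmaFinEquiv l ⟨r, s⟩).symm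
  have h := finSigmaFinEquiv_assoc r s t (Fin.cast hl t) rfl
  have h' : Fin.cast (sum_flatten l)
      (finSigmaFinEquiv (n := fun r => ∑ s, l r s) ⟨r, finSigmaFinEquiv ⟨s, t⟩⟩) =
      finSigmaFinEquiv (n := flatten l) ⟨finSigmaFinEquiv ⟨r, s⟩, Fin.cast hl t⟩ := Fin.ext h
  rw [h', flatten_finSigmaFinEquiv, flatten_finSigmaFinEquiv, flatten_finSigmaFinEquiv]
  -- The pair (r, s) is recovered from its position only up to propositional equality, and the type
  -- of t depends on it; generalizing over the pair removes the dependency.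
  have key : ∀ (y : (r : Fin n) × Fin (m r)) (hy : y = ⟨r, s⟩) (t' : Fin (l y.1 y.2)),
      (t' : ℕ) = t → x r s t = x y.1 y.2 t' := by
    rintro y rfl t' ht
    exact congrArg _ (Fin.ext ht.symm)
  exact key _ (Equiv.symm_apply_apply _ _) _ rfl

/-! ### Words -/

theorem OperadData.cast_cast {V : Type u} [Category.{v} V] [HasFiniteLimits V] (O : OperadData V)
    {m n : ℕ} (h : m = n) (h' : n = m) : O.cast h ≫ O.cast h' = 𝟙 _ := by
  subst h
  exact Category.comp_id _

/-- A generalized element of `⨆ₙ O(n) × Aⁿ`. -/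
structure Word {V : Type u} [Category.{v} V] [HasFiniteLimits V] (O : ReducedOperad V)
    (A X : ICat V) where
  n : ℕ
  op : X ⟶ O.obj n
  arg : Fin n → (X ⟶ A)

namespace Word

variable {V : Type u} [Category.{v} V] [HasFiniteLimits V] {O : ReducedOperad V} {A X Y : ICat V}

/-- The length is part of a word, so equality of words absorbs the casts between the O(n). The
operad laws thereby become plain equations in `comp_comp`, `unit_comp` and `comp_unit`. -/
theorem ext_cast {w w' : Word O A X} (hn : w.n = w'.n) (ho : w.op ≫ O.cast hn = w'.op)
    (ha : ∀ i, w.arg i = w'.arg (Fin.cast hn i)) : w = w' := by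
  obtain ⟨n, o, a⟩ := w
  obtain ⟨n', o', a'⟩ := w'
  obtain rfl : n = n' := hn
  obtain rfl : a = a' := funext ha
  obtain rfl : o = o' := (Category.comp_id o).symm.trans ho
  rfl

/-- Precomposition of a word with a functor. -/
def pull (H : Y ⟶ X) (w : Word O A X) : Word O A Y :=
  ⟨w.n, H ≫ w.op, fun i => H ≫ w.arg i⟩

/-- The word `(γ(o; p₁, …, pₙ); a₁, …, aₙ)` for words `(pᵣ; aᵣ)`. -/
noncomputable def comp {n : ℕ} (o : X ⟶ O.obj n) (w : Fin n → Word O A X) : Word O A X :=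
  ⟨∑ r, (w r).n, O.comp o (fun r => (w r).op), flatten fun r => (w r).arg⟩

/-- The word `(1; a)`. -/
noncomputable def unit (a : X ⟶ A) : Word O A X :=
  ⟨1, O.unit X, fun _ => a⟩

variable (O A X) in
/-- The word `(0;)`. -/
noncomputable def zero : Word O A X :=
  ⟨0, ICat.toTerminal X ≫ O.zero.hom, Fin.elim0⟩

/-- The words `(1; a₁), …, (0;), …, (1; aₙ)` with `(0;)` in position `r`. -/
noncomputable def degen {n : ℕ} (r : Fin n) (a : Fin n → (X ⟶ A)) (i : Fin n) : Word O A X :=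
  if i = r then zero O A X else unit (a i)

theorem degen_self {n : ℕ} (r : Fin n) (a : Fin n → (X ⟶ A)) :
    degen (O := O) r a r = zero O A X := by
  simp [degen]

theorem degen_of_ne {n : ℕ} {r i : Fin n} (h : i ≠ r) (a : Fin n → (X ⟶ A)) :
    degen (O := O) r a i = unit (a i) := by
  simp [degen, h]

theorem comp_comp {n : ℕ} {m : Fin n → ℕ} (o : X ⟶ O.obj n) (p : ∀ r, X ⟶ O.obj (m r))
    (w : ∀ r, Fin (m r) → Word O A X) :
    comp o (fun r => comp (p r) (w r)) = comp (O.comp o p) (flatten w) := by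
  refine ext_cast (sum_flatten fun r s => (w r s).n) ?_ ?_
  · exact O.assoc o p fun r s => (w r s).op
  · intro i
    exact flatten_flatten (fun r s => (w r s).arg) i

theorem unit_comp (w : Word O A X) : comp (O.unit X) (fun _ : Fin 1 => w) = w := by
  refine ext_cast (by simp [comp]) (O.unit_comp w.op) ?_
  intro i
  obtain ⟨⟨r, s⟩, rfl⟩ := finSigmaFinEquiv.surjective i
  obtain rfl : r = 0 := Subsingleton.elim _ _
  refine (flatten_finSigmaFinEquiv (fun _ : Fin 1 => w.arg) ⟨0, s⟩).trans ?_
  refine congrArg w.arg (Fin.ext ?_)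
  change (s : ℕ) = (finSigmaFinEquiv (n := fun _ : Fin 1 => w.n) ⟨0, s⟩ : ℕ)
  rw [finSigmaFinEquiv_val]
  simp

theorem comp_unit {n : ℕ} (o : X ⟶ O.obj n) (a : Fin n → (X ⟶ A)) :
    comp o (fun i => unit (a i)) = ⟨n, o, a⟩ := by
  refine ext_cast (by simp [comp, unit]) (O.comp_unit o) ?_
  intro i
  obtain ⟨⟨r, s⟩, rfl⟩ := finSigmaFinEquiv.surjective i
  refine (flatten_finSigmaFinEquiv (fun i (_ : Fin 1) => a i) ⟨r, s⟩).trans ?_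
  refine congrArg a (Fin.ext ?_)
  change (r : ℕ) = (finSigmaFinEquiv (n := fun _ : Fin n => 1) ⟨r, s⟩ : ℕ)
  have : (s : ℕ) = 0 := Nat.lt_one_iff.mp s.2
  rw [finSigmaFinEquiv_apply]
  simp [this]

theorem pull_comp (H : Y ⟶ X) {n : ℕ} (o : X ⟶ O.obj n) (w : Fin n → Word O A X) :
    pull H (comp o w) = comp (H ≫ o) (fun r => pull H (w r)) := by
  refine ext_cast rfl ?_ fun i => rfl
  exact (Category.comp_id _).trans (O.precomp_comp H o fun r => (w r).op)

theorem precomp_unit (H : Y ⟶ X) : H ≫ O.unit X = O.unit Y := by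
  unfold OperadData.unit
  rw [← Category.assoc]
  congr 1
  apply ICat.hom_ext <;> exact Subsingleton.elim (α := _ ⟶ ⊤_ V) _ _

theorem pull_unit (H : Y ⟶ X) (a : X ⟶ A) : pull H (unit (O := O) a) = unit (H ≫ a) := by
  refine ext_cast rfl ?_ fun i => rfl
  exact (Category.comp_id _).trans (precomp_unit H)

theorem pull_zero (H : Y ⟶ X) : pull H (zero O A X) = zero O A Y := by
  refine ext_cast rfl ?_ fun i => Fin.elim0 i
  refine (Category.comp_id _).trans ?_
  refine (Category.assoc _ _ _).symm.trans (congrArg (fun t => t ≫ O.zero.hom) ?_)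
  apply ICat.hom_ext <;> exact Subsingleton.elim (α := _ ⟶ ⊤_ V) _ _

theorem pull_degen (H : Y ⟶ X) {n : ℕ} (r : Fin n) (a : Fin n → (X ⟶ A)) (i : Fin n) :
    pull H (degen (O := O) r a i) = degen r (fun i => H ≫ a i) i := by
  by_cases h : i = r
  · subst h
    rw [degen_self, degen_self, pull_zero]
  · rw [degen_of_ne h, degen_of_ne h, pull_unit]

theorem pull_pull {Z : ICat V} (H : Y ⟶ X) (K : Z ⟶ Y) (w : Word O A X) :
    pull K (pull H w) = pull (K ≫ H) w := by
  refine ext_cast rfl ?_ fun i => (Category.assoc _ _ _).symm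
  exact (Category.comp_id _).trans (Category.assoc _ _ _).symm

/-- The degenerate words in terms of the degenerate families of the operad. -/
theorem degen_eq {n : ℕ} (r : Fin n) (a : Fin n → (X ⟶ A)) (i : Fin n) :
    (⟨ReducedOperad.degenArity r i, O.degen X r i, fun _ => a i⟩ : Word O A X) = degen r a i := by
  by_cases h : i = r
  · subst h
    rw [degen_self]
    refine ext_cast (by simp [ReducedOperad.degenArity, zero]) ?_ ?_
    · simp only [ReducedOperad.degen, zero, dif_pos, Category.assoc]
      exact congrArg _ ((congrArg _ (O.cast_cast _ _)).trans (Category.comp_id _))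
    · intro j
      exact Fin.elim0 (Fin.cast (by simp [ReducedOperad.degenArity]) j)
  · rw [degen_of_ne h]
    refine ext_cast (by simp [ReducedOperad.degenArity, unit, h]) ?_ ?_
    · simp only [ReducedOperad.degen, unit, h, dif_neg, not_false_eq_true, Category.assoc]
      exact (congrArg _ (O.cast_cast _ _)).trans (Category.comp_id _)
    · intro j
      rfl

end Word

/-! ### Values of words and the isomorphisms φ on words -/

namespace PsAlg

variable {V : Type u} [Category.{v} V] [HasFiniteLimits V] {O : ReducedOperad V} (A : PsAlg O)
  {X Y : ICat V}

/-- The value `θ(o; a)` of a word `(o; a)`. -/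
noncomputable def eval (w : Word O A.carrier X) : X ⟶ A.carrier :=
  A.act w.op w.arg

theorem eval_pull (H : Y ⟶ X) (w : Word O A.carrier X) :
    A.eval (Word.pull H w) = H ≫ A.eval w :=
  (A.precomp_act H w.op w.arg).symm

theorem eval_unit (a : X ⟶ A.carrier) : A.eval (Word.unit a) = a :=
  A.act_unit a

/-- The composition isomorphisms, on words. -/
noncomputable def phiCell {n : ℕ} (o : X ⟶ O.obj n) (w : Fin n → Word O A.carrier X) :
    A.act o (fun r => A.eval (w r)) ≅ A.eval (Word.comp o w) :=
  A.phiAt o (fun r => (w r).op) (fun r => (w r).arg)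

/-- The components of the composition isomorphisms. -/
noncomputable def phi {n : ℕ} (o : X ⟶ O.obj n) (w : Fin n → Word O A.carrier X) :
    X.Ob ⟶ A.carrier.Mor :=
  (A.phiCell o w).hom.app

/-- The components of the inverses of the composition isomorphisms. -/
noncomputable def phiInv {n : ℕ} (o : X ⟶ O.obj n) (w : Fin n → Word O A.carrier X) :
    X.Ob ⟶ A.carrier.Mor :=
  (A.phiCell o w).inv.app

theorem phi_src {n : ℕ} (o : X ⟶ O.obj n) (w : Fin n → Word O A.carrier X) :
    A.phi o w ≫ A.carrier.src = (A.act o (fun r => A.eval (w r))).obj :=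
  ICat.Trans.app_src _

theorem phi_tgt {n : ℕ} (o : X ⟶ O.obj n) (w : Fin n → Word O A.carrier X) :
    A.phi o w ≫ A.carrier.tgt = (A.eval (Word.comp o w)).obj :=
  ICat.Trans.app_tgt _

theorem phiInv_src {n : ℕ} (o : X ⟶ O.obj n) (w : Fin n → Word O A.carrier X) :
    A.phiInv o w ≫ A.carrier.src = (A.eval (Word.comp o w)).obj :=
  ICat.Trans.app_src _

theorem phiInv_tgt {n : ℕ} (o : X ⟶ O.obj n) (w : Fin n → Word O A.carrier X) :
    A.phiInv o w ≫ A.carrier.tgt = (A.act o (fun r => A.eval (w r))).obj :=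
  ICat.Trans.app_tgt _

theorem phi_phiInv {n : ℕ} (o : X ⟶ O.obj n) (w : Fin n → Word O A.carrier X) :
    A.carrier.cmp (A.phi o w) (A.phiInv o w) (by rw [phi_tgt, phiInv_src]) =
      (A.act o (fun r => A.eval (w r))).obj ≫ A.carrier.ident :=
  congrArg ICat.Trans.app (A.phiCell o w).hom_inv_id

theorem phiInv_phi {n : ℕ} (o : X ⟶ O.obj n) (w : Fin n → Word O A.carrier X) :
    A.carrier.cmp (A.phiInv o w) (A.phi o w) (by rw [phi_src, phiInv_tgt]) =
      (A.eval (Word.comp o w)).obj ≫ A.carrier.ident :=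
  congrArg ICat.Trans.app (A.phiCell o w).inv_hom_id

theorem phi_precomp (H : Y ⟶ X) {n : ℕ} (o : X ⟶ O.obj n) (w : Fin n → Word O A.carrier X) :
    H.obj ≫ A.phi o w = A.phi (H ≫ o) (fun r => Word.pull H (w r)) := by
  unfold phi phiCell
  rw [PsAlgData.phiAt_app, PsAlgData.phiAt_app, ← Category.assoc, ← ICat.comp_obj]
  congr 2
  simp only [PsAlgData.phiLift, ICat.precomp_lift, ICat.precomp_piLift]
  rfl

/-- Inverses are unique. The two families may have different lengths, since only the components are
compared. -/
theorem phiInv_congr {n n' : ℕ} {o : X ⟶ O.obj n} {o' : X ⟶ O.obj n'}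
    {w : Fin n → Word O A.carrier X} {w' : Fin n' → Word O A.carrier X}
    (h : A.phi o w = A.phi o' w') : A.phiInv o w = A.phiInv o' w' := by
  have hs := congrArg (fun t => t ≫ A.carrier.src) h
  have ht := congrArg (fun t => t ≫ A.carrier.tgt) h
  simp only [phi_src, phi_tgt] at hs ht
  refine ICat.inv_unique (f := A.phi o w) (by rw [phi_src, phiInv_tgt])
    (by rw [phi_tgt, phiInv_src, ht]) ?_ ?_
  · rw [phiInv_phi, phi_tgt]
  · rw [ICat.cmp_congr _ h rfl, phi_phiInv, phi_src, hs]

theorem phiInv_precomp (H : Y ⟶ X) {n : ℕ} (o : X ⟶ O.obj n) (w : Fin n → Word O A.carrier X) :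
    H.obj ≫ A.phiInv o w = A.phiInv (H ≫ o) (fun r => Word.pull H (w r)) := by
  refine ICat.inv_unique (f := H.obj ≫ A.phi o w) ?_ ?_ ?_ ?_
  · rw [Category.assoc, Category.assoc, phi_src, phiInv_tgt]
  · rw [phi_precomp, phi_tgt, phiInv_src]
  · rw [← ICat.precomp_cmp _ _ _ _ (by rw [phi_src, phiInv_tgt]), phiInv_phi, ← phi_tgt]
    simp only [Category.assoc]
  · rw [ICat.cmp_congr _ (A.phi_precomp H o w) rfl, phi_phiInv, phi_precomp, phi_src]

theorem phi_unit_comp (w : Word O A.carrier X) :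
    A.phi (O.unit X) (fun _ : Fin 1 => w) = (A.eval w).obj ≫ A.carrier.ident := by
  have h := (ICat.isIdentity₂_iff _).mp (A.phi_unit_left w.op w.arg)
  refine h.trans ?_
  exact congrArg (fun t => ICat.Fun.obj t ≫ A.carrier.ident) (A.act_unit _)

theorem phi_comp_unit {n : ℕ} (o : X ⟶ O.obj n) (a : Fin n → (X ⟶ A.carrier)) :
    A.phi o (fun i => Word.unit (a i)) = (A.act o a).obj ≫ A.carrier.ident := by
  have h := (ICat.isIdentity₂_iff _).mp (A.phi_unit_right o a)
  refine h.trans ?_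
  simp only [A.act_unit]

theorem phiCell_degen {n : ℕ} (r : Fin n) (o : X ⟶ O.obj n) (a : Fin n → (X ⟶ A.carrier)) :
    IsIdentity₂ (A.phiCell o (Word.degen r a)).hom := by
  have h := A.phi_degen r o a
  have e : (fun i => (⟨ReducedOperad.degenArity r i, O.degen X r i, fun _ => a i⟩ :
    Word O A.carrier X)) = Word.degen r a := funext fun i => Word.degen_eq r a i
  rw [← e]
  exact h

/-- The associativity coherence `phi_assoc` in terms of words; every later use of that axiom goes
through this form. -/
theorem phi_comp {n : ℕ} {m : Fin n → ℕ} (o : X ⟶ O.obj n) (p : ∀ r, X ⟶ O.obj (m r))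
    (w : ∀ r, Fin (m r) → Word O A.carrier X) :
    A.carrier.cmp (A.phi o (fun r => ⟨m r, p r, fun s => A.eval (w r s)⟩))
        (A.phi (O.comp o p) (flatten w)) (by rw [phi_tgt, phi_src]; rfl) =
      A.carrier.cmp (A.act₂ o (fun r => (A.phiCell (p r) (w r)).hom)).app
        (A.phi o (fun r => Word.comp (p r) (w r))) (by rw [phi_src, ICat.Trans.app_tgt]) :=
  A.phi_assoc o p (fun r s => (w r s).op) (fun r s => (w r s).arg)

theorem phi_perm_outer {n : ℕ} (ρ : Equiv.Perm (Fin n)) (o : X ⟶ O.obj n)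
    (w : Fin n → Word O A.carrier X) :
    A.phi (o ≫ O.perm ρ) (fun r => w (ρ r)) = A.phi o w :=
  A.phi_perm ρ o (fun r => (w r).op) (fun r => (w r).arg)

/-! ### The relation between words with equal values -/

/-- Permutations of the arguments. -/
def PermRel (w w' : Word O A.carrier X) : Prop :=
  ∃ ρ : Equiv.Perm (Fin w'.n), w = ⟨w'.n, w'.op ≫ O.perm ρ, fun i => w'.arg (ρ i)⟩

/-- Omission of an argument that is the base point. -/
def DegenRel (w w' : Word O A.carrier X) : Prop :=
  ∃ (s : Fin w'.n) (a : Fin w'.n → (X ⟶ A.carrier)),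
    (∀ i, w'.arg i = A.eval (Word.degen s a i)) ∧ w = Word.comp w'.op (Word.degen s a)

/-- The relation generated by permutations of arguments and omission of base points. -/
def Rel (w w' : Word O A.carrier X) : Prop :=
  A.PermRel w w' ∨ A.DegenRel w w'

variable {A}

/-- Permutations are handled by equivariance of θ. For an omission, φ at a degenerate family is an
identity 2-cell, so its source and target coincide. -/
theorem Rel.eval_eq {w w' : Word O A.carrier X} (h : A.Rel w w') : A.eval w = A.eval w' := by
  rcases h with ⟨ρ, rfl⟩ | ⟨s, a, ha, rfl⟩
  · exact A.act_perm ρ w'.op w'.arg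
  · refine (A.phiCell_degen s w'.op a).1.symm.trans ?_
    rw [← funext ha]
    rfl

theorem Rel.pull {w w' : Word O A.carrier X} (h : A.Rel w w') (H : Y ⟶ X) :
    A.Rel (Word.pull H w) (Word.pull H w') := by
  rcases h with ⟨ρ, rfl⟩ | ⟨s, a, ha, rfl⟩
  · left
    refine ⟨ρ, Word.ext_cast rfl ?_ fun i => rfl⟩
    exact (Category.comp_id _).trans (Category.assoc _ _ _).symm
  · right
    refine ⟨s, fun i => H ≫ a i, fun i => ?_, ?_⟩
    · refine Eq.trans (congrArg (fun t => H ≫ t) (ha i)) ?_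
      exact (A.eval_pull H _).symm.trans (congrArg A.eval (Word.pull_degen H s a i))
    · rw [Word.pull_comp]
      exact congrArg _ (funext fun i => Word.pull_degen H s a i)

/-- A common form of families of words that agree except for one permuted entry. -/
theorem PermRel.family {n : ℕ} {w w' : Fin n → Word O A.carrier X} {r : Fin n}
    (hne : ∀ i, i ≠ r → w i = w' i) (h : A.PermRel (w r) (w' r)) :
    ∃ τ : ∀ i, Equiv.Perm (Fin (w' i).n),
      w = fun i => ⟨(w' i).n, (w' i).op ≫ O.perm (τ i), fun j => (w' i).arg (τ i j)⟩ := by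
  have : ∀ i, ∃ τ : Equiv.Perm (Fin (w' i).n),
      w i = ⟨(w' i).n, (w' i).op ≫ O.perm τ, fun j => (w' i).arg (τ j)⟩ := by
    intro i
    by_cases hi : i = r
    · subst hi
      exact h
    · refine ⟨1, ?_⟩
      rw [hne i hi, O.perm_one, Category.comp_id]
      rfl
  choose τ hτ using this
  exact ⟨τ, funext hτ⟩

/-- A common form of families of words that agree except for one degenerate entry. -/
theorem DegenRel.family {n : ℕ} {w w' : Fin n → Word O A.carrier X} {r : Fin n}
    (hne : ∀ i, i ≠ r → w i = w' i) (h : A.DegenRel (w r) (w' r)) :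
    ∃ (k : Fin (∑ i, (w' i).n)) (a : Fin (∑ i, (w' i).n) → (X ⟶ A.carrier))
      (e : ∀ i, Fin (w' i).n → Word O A.carrier X),
      flatten e = Word.degen k a ∧ (∀ i j, (w' i).arg j = A.eval (e i j)) ∧
      (∀ i, IsIdentity₂ (A.phiCell (w' i).op (e i)).hom) ∧
      w = fun i => Word.comp (w' i).op (e i) := by
  obtain ⟨s, a, ha, hw⟩ := h
  -- Only the arguments of block r are replaced by those of the omission. In the juxtaposed word,
  -- the omission then takes place at the single position k of (r, s), and every other block is
  -- filled with one-letter words.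
  let a' : ∀ i, Fin (w' i).n → (X ⟶ A.carrier) := Function.update (fun i => (w' i).arg) r a
  have ha' : a' r = a := Function.update_self _ _ _
  have hne' : ∀ i, i ≠ r → a' i = (w' i).arg := fun i hi => Function.update_of_ne hi _ _
  let k : Fin (∑ i, (w' i).n) := finSigmaFinEquiv ⟨r, s⟩
  let e : ∀ i, Fin (w' i).n → Word O A.carrier X := fun i j =>
    Word.degen k (flatten a') (finSigmaFinEquiv ⟨i, j⟩)
  have her : e r = Word.degen s a := by
    funext j
    by_cases hj : j = s
    · subst hj
      rw [Word.degen_self]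
      exact Word.degen_self _ _
    · rw [Word.degen_of_ne hj]
      refine (Word.degen_of_ne ?_ _).trans ?_
      · intro hc
        have := finSigmaFinEquiv.injective hc
        exact hj (by simpa using this)
      · rw [flatten_finSigmaFinEquiv]
        simp only [ha']
  have hei : ∀ i, i ≠ r → e i = fun j => Word.unit ((w' i).arg j) := by
    intro i hi
    funext j
    refine (Word.degen_of_ne ?_ _).trans ?_
    · intro hc
      have := finSigmaFinEquiv.injective hc
      exact hi (congrArg Sigma.fst this)
    · rw [flatten_finSigmaFinEquiv]
      simp only [hne' i hi]
  refine ⟨k, flatten a', e, ?_, ?_, ?_, ?_⟩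
  · funext j
    simp [flatten, e]
  · intro i j
    by_cases hi : i = r
    · subst hi
      rw [her]
      exact ha j
    · rw [hei i hi, eval_unit]
  · intro i
    by_cases hi : i = r
    · subst hi
      rw [her]
      exact A.phiCell_degen _ _ _
    · rw [hei i hi]
      exact ICat.isIdentity₂_of_app _ _ (A.phi_comp_unit _ _)
  · funext i
    by_cases hi : i = r
    · subst hi
      rw [her]
      exact hw
    · rw [hei i hi, Word.comp_unit]
      exact hne i hi

/-- Permutations inside blocks act on the juxtaposition by their block sum. An omission inside a
block is an omission in the juxtaposition, by associativity of word composition. -/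
theorem Rel.comp {n : ℕ} (o : X ⟶ O.obj n) {w w' : Fin n → Word O A.carrier X} {r : Fin n}
    (hne : ∀ i, i ≠ r → w i = w' i) (h : A.Rel (w r) (w' r)) :
    A.Rel (Word.comp o w) (Word.comp o w') := by
  rcases h with h | h
  · obtain ⟨τ, rfl⟩ := h.family hne
    left
    refine ⟨blockSum τ, Word.ext_cast rfl ?_ ?_⟩
    · exact (Category.comp_id _).trans (O.comp_blockSum τ o fun i => (w' i).op)
    · intro i
      obtain ⟨y, rfl⟩ := finSigmaFinEquiv.surjective i
      have hy : blockSum τ (finSigmaFinEquiv y) = finSigmaFinEquiv ⟨y.1, τ y.1 y.2⟩ := by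
        simp [blockSum, Equiv.sigmaCongrRight]
      refine (flatten_finSigmaFinEquiv (fun i j => (w' i).arg (τ i j)) y).trans ?_
      refine Eq.trans ?_ (congrArg (flatten fun i => (w' i).arg) hy.symm)
      exact (flatten_finSigmaFinEquiv (fun i => (w' i).arg) ⟨y.1, τ y.1 y.2⟩).symm
  · obtain ⟨k, a, e, he, ha, -, rfl⟩ := h.family hne
    right
    refine ⟨k, a, fun i => ?_, ?_⟩
    · exact (ha _ _).trans (congrArg A.eval (congrFun he i))
    · rw [Word.comp_comp, he]
      rfl

/-- The permutation case is an axiom. For an omission, apply the associativity coherence with the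
degenerate words innermost: of its four isomorphisms two are identities by `phi_degen` and
`phi_unit_right`, and the remaining two are φ at w and at w'. -/
theorem Rel.phi_eq {n : ℕ} (o : X ⟶ O.obj n) {w w' : Fin n → Word O A.carrier X} {r : Fin n}
    (hne : ∀ i, i ≠ r → w i = w' i) (h : A.Rel (w r) (w' r)) :
    A.phi o w = A.phi o w' := by
  rcases h with h | h
  · obtain ⟨τ, rfl⟩ := h.family hne
    exact A.phi_perm_inner τ o (fun i => (w' i).op) (fun i => (w' i).arg)
  · obtain ⟨k, a, e, he, ha, hid, rfl⟩ := h.family hne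
    have h₁ := A.phi_comp o (fun i => (w' i).op) e
    have h₂ := (ICat.isIdentity₂_iff _).mp (A.act₂_isIdentity o _ hid)
    have h₃ : IsIdentity₂ (A.phiCell (O.comp o fun i => (w' i).op) (flatten e)).hom := by
      rw [he]
      exact A.phiCell_degen _ _ _
    have h₃ : A.phi _ _ = _ := (ICat.isIdentity₂_iff _).mp h₃
    rw [ICat.cmp_congr _ rfl h₃, ICat.cmp_ident, ICat.cmp_congr _ h₂ rfl, ICat.ident_cmp] at h₁
    have h₄ : (fun i => (⟨(w' i).n, (w' i).op, fun s => A.eval (e i s)⟩ : Word O A.carrier X)) =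
        w' := by
      funext i
      rw [← funext (ha i)]
    rw [h₄] at h₁
    exact h₁.symm

/-- Block permutations of juxtaposed words. -/
theorem PermRel.of_equiv {n n' : ℕ} (e : Fin n' ≃ Fin n) (o : X ⟶ O.obj n)
    (a : Fin n → (X ⟶ A.carrier)) :
    A.PermRel ⟨n', o ≫ O.reindex e, fun i => a (e i)⟩ ⟨n, o, a⟩ := by
  obtain rfl : n' = n := Fin.equiv_iff_eq.mp ⟨e⟩
  refine ⟨e, Word.ext_cast rfl ?_ fun i => rfl⟩
  refine (Category.comp_id _).trans (congrArg (fun t => o ≫ t) ?_)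
  exact Category.id_comp _

/-- Outer equivariance of γ gives a block permutation. The two total lengths agree only
propositionally, hence the detour through `of_equiv`. -/
theorem PermRel.comp_perm {n : ℕ} (ρ : Equiv.Perm (Fin n)) (o : X ⟶ O.obj n)
    (w : Fin n → Word O A.carrier X) :
    A.PermRel (Word.comp (o ≫ O.perm ρ) (fun i => w (ρ i))) (Word.comp o w) := by
  have h := PermRel.of_equiv (A := A) (blockPerm ρ fun i => (w i).n)
    (O.comp o fun i => (w i).op) (flatten fun i => (w i).arg)
  refine Eq.mp (congrArg (fun t => A.PermRel t (Word.comp o w)) ?_) h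
  refine Word.ext_cast rfl ?_ fun i => ?_
  · exact (Category.comp_id _).trans (O.comp_perm ρ o fun i => (w i).op).symm
  · obtain ⟨y, rfl⟩ := finSigmaFinEquiv.surjective i
    have hy : blockPerm ρ (fun i => (w i).n) (finSigmaFinEquiv y) =
        finSigmaFinEquiv ⟨ρ y.1, y.2⟩ := by
      simp [blockPerm, Equiv.sigmaCongrLeft]
    refine (congrArg (flatten fun i => (w i).arg) hy).trans ?_
    refine (flatten_finSigmaFinEquiv (fun i => (w i).arg) ⟨ρ y.1, y.2⟩).trans ?_
    exact (flatten_finSigmaFinEquiv (fun i => (w (ρ i)).arg) y).symm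

end PsAlg

/-! ### Connected colimits and products -/

/-- Products with a fixed object preserve connected colimits. -/
class ProdPreservesConnectedColimits (V : Type u) [Category.{v} V] [HasFiniteLimits V] : Prop where
  preserves : ∀ (X : V) (J : Type) [SmallCategory J] [IsConnected J],
    PreservesColimitsOfShape J (prod.functor.obj X)

section

variable {V : Type u} [Category.{v} V] [HasFiniteLimits V]

variable {J : MultispanShape.{0, 0}} (I : MultispanIndex J V) [HasMulticoequalizer I] (Z : V)
  [PreservesColimit I.multispan (prod.functor.obj Z)]

/-- Since Z ⨯ - preserves this colimit, the product with Z is again a colimit of the multispan. The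
legs at the left vertices are forced by those at the right vertices. -/
theorem exists_prod_multicoequalizer_desc {T : V} (k : ∀ b, Z ⨯ I.right b ⟶ T)
    (h : ∀ a, prod.map (𝟙 Z) (I.fst a) ≫ k (J.fst a) = prod.map (𝟙 Z) (I.snd a) ≫ k (J.snd a)) :
    ∃ F : Z ⨯ multicoequalizer I ⟶ T,
      ∀ b, prod.map (𝟙 Z) (Multicoequalizer.π I b) ≫ F = k b := by
  let c : Cocone (I.multispan ⋙ prod.functor.obj Z) :=
    { pt := T
      ι :=
        { app := fun x =>
            match x with
            | WalkingMultispan.left a => prod.map (𝟙 Z) (I.fst a) ≫ k _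
            | WalkingMultispan.right b => k b
          naturality := by
            rintro _ _ (_ | a | a)
            · exact (congrArg (fun t => t ≫ _) (CategoryTheory.Functor.map_id (I.multispan ⋙ prod.functor.obj Z) _)).trans
                ((Category.id_comp _).trans (Category.comp_id _).symm)
            · exact (Category.comp_id _).symm
            · exact (h a).symm.trans (Category.comp_id _).symm } }
  let hc := isColimitOfPreserves (prod.functor.obj Z) (colimit.isColimit I.multispan)
  exact ⟨hc.desc c, fun b => hc.fac c (WalkingMultispan.right b)⟩

theorem prod_multicoequalizer_hom_ext {T : V} {F G : Z ⨯ multicoequalizer I ⟶ T}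
    (h : ∀ b, prod.map (𝟙 Z) (Multicoequalizer.π I b) ≫ F =
      prod.map (𝟙 Z) (Multicoequalizer.π I b) ≫ G) : F = G := by
  let hc := isColimitOfPreserves (prod.functor.obj Z) (colimit.isColimit I.multispan)
  refine hc.hom_ext fun x => ?_
  match x with
  | WalkingMultispan.right b => exact h b
  | WalkingMultispan.left a =>
    have e : ((prod.functor.obj Z).mapCocone (colimit.cocone I.multispan)).ι.app
        (WalkingMultispan.left a) = prod.map (𝟙 Z) (I.fst a) ≫
          prod.map (𝟙 Z) (Multicoequalizer.π I (J.fst a)) :=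
      (((prod.functor.obj Z).mapCocone (colimit.cocone I.multispan)).w
        (WalkingMultispan.Hom.fst a)).symm
    rw [e]
    refine (Category.assoc _ _ _).trans (Eq.trans ?_ (Category.assoc _ _ _).symm)
    exact congrArg _ (h _)

end

section

variable {V : Type u} [Category.{v} V] [HasFiniteLimits V]

/-- Adding a component to a family. -/
noncomputable def consPi {n : ℕ} {X S : V} (s : X ⟶ S) (t : X ⟶ ∏ᶜ fun _ : Fin n => S) :
    X ⟶ ∏ᶜ fun _ : Fin (n + 1) => S :=
  Pi.lift fun i => Fin.cases (motive := fun _ => X ⟶ S) s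
    (fun j => t ≫ Pi.π (fun _ : Fin n => S) j) i

theorem precomp_consPi {n : ℕ} {X Y S : V} (y : Y ⟶ X) (s : X ⟶ S)
    (t : X ⟶ ∏ᶜ fun _ : Fin n => S) : y ≫ consPi s t = consPi (y ≫ s) (y ≫ t) := by
  refine Pi.hom_ext _ _ fun i => ?_
  cases i using Fin.cases <;> simp [consPi]

theorem consPi_eta {n : ℕ} {X S : V} (t : X ⟶ ∏ᶜ fun _ : Fin (n + 1) => S) :
    consPi (t ≫ Pi.π _ 0)
      (Pi.lift fun j : Fin n => t ≫ Pi.π (fun _ : Fin (n + 1) => S) j.succ) = t := by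
  refine Pi.hom_ext _ _ fun i => ?_
  cases i using Fin.cases <;> simp [consPi]

end

/-! ### Generic words over discrete categories -/

namespace Word

variable {V : Type u} [Category.{v} V] [HasFiniteLimits V] {O : ReducedOperad V} {A : ICat V}

/-- The functor between discrete internal categories induced by a map. -/
noncomputable abbrev discMap {X Y : V} (y : Y ⟶ X) : ICat.disc Y ⟶ ICat.disc X :=
  ICat.ofOb (C := ICat.disc X) y

variable (O A) in
/-- The object `O(n) × Aⁿ` of objects. -/
noncomputable abbrev Gen (n : ℕ) : V := (ICat.times (O.obj n) (ICat.pi fun _ : Fin n => A)).Ob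

variable (O A) in
/-- The generic word of length `n`. -/
noncomputable def gen (n : ℕ) : Word O A (ICat.disc (Gen O A n)) :=
  ⟨n, ICat.ofOb (ICat.Fun.obj ICat.fst),
    fun i => ICat.ofOb (ICat.Fun.obj ICat.snd ≫ ICat.Fun.obj (ICat.proj i))⟩

/-- A word over a discrete category as a map. -/
noncomputable def elt {X : V} (w : Word O A (ICat.disc X)) : X ⟶ Gen O A w.n :=
  ICat.liftOb w.op.obj (ICat.piLiftOb fun i => (w.arg i).obj)

theorem elt_fst {X : V} (w : Word O A (ICat.disc X)) : w.elt ≫ ICat.Fun.obj ICat.fst = w.op.obj :=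
  ICat.liftOb_fst _ _

theorem elt_snd_proj {X : V} (w : Word O A (ICat.disc X)) (i : Fin w.n) :
    (w.elt ≫ ICat.Fun.obj ICat.snd) ≫ ICat.Fun.obj (ICat.proj i) = (w.arg i).obj :=
  (congrArg (fun t => t ≫ ICat.Fun.obj (ICat.proj i)) (ICat.liftOb_snd _ _)).trans
    (ICat.piLiftOb_proj _ _)

theorem discMap_elt_op {X : V} (w : Word O A (ICat.disc X)) :
    discMap w.elt ≫ (gen O A w.n).op = w.op :=
  ICat.disc_hom_ext w.elt_fst

theorem discMap_elt_arg {X : V} (w : Word O A (ICat.disc X)) (i : Fin w.n) :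
    discMap w.elt ≫ (gen O A w.n).arg i = w.arg i :=
  ICat.disc_hom_ext ((Category.assoc _ _ _).symm.trans (w.elt_snd_proj i))

/-- A Yoneda argument: every word over a discrete category is pulled back from the generic word of
its length, along the map that it defines. A natural construction on words is therefore determined
by its values at the generic words. -/
theorem pull_elt_gen {X : V} (w : Word O A (ICat.disc X)) :
    pull (discMap w.elt) (gen O A w.n) = w :=
  ext_cast rfl ((Category.comp_id _).trans w.discMap_elt_op) w.discMap_elt_arg

theorem elt_pull {X Y : V} (y : Y ⟶ X) (w : Word O A (ICat.disc X)) :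
    elt (pull (discMap y) w) = y ≫ w.elt := by
  apply ICat.times_ob_ext
  · refine (elt_fst _).trans (Eq.trans ?_ (Category.assoc _ _ _).symm)
    exact congrArg (fun t => y ≫ t) w.elt_fst.symm
  · apply ICat.pi_ob_ext
    intro i
    refine (elt_snd_proj _ i).trans (Eq.trans (congrArg (fun t => y ≫ t) (w.elt_snd_proj i)).symm ?_)
    refine Eq.trans ?_ (congrArg (fun t => t ≫ ICat.Fun.obj (ICat.proj i))
      (Category.assoc y w.elt (ICat.Fun.obj ICat.snd)).symm)
    exact (Category.assoc _ _ _).symm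

theorem pull_discMap {X Y Z : V} (y : Y ⟶ X) (z : Z ⟶ Y) (w : Word O A (ICat.disc X)) :
    pull (discMap z) (pull (discMap y) w) = pull (discMap (z ≫ y)) w := by
  rw [pull_pull]
  exact congrArg (fun t => pull t w) (ICat.comp_ofOb _ _)

end Word

namespace PsAlg

open Word

attribute [local simp] prod.lift_fst prod.lift_fst_assoc prod.lift_snd prod.lift_snd_assoc

variable {V : Type u} [Category.{v} V] [HasFiniteLimits V] {O : ReducedOperad V} (A : PsAlg O)

/-! ### The object of words up to permutations and base points -/

/-- Indices of the generic relations: permutations and omissions. -/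
abbrev RelIndex : Type := ((n : ℕ) × Equiv.Perm (Fin n)) ⊕ ((n : ℕ) × Fin n)

/-- The length of the generic relation. -/
def RelIndex.arity : RelIndex → ℕ
  | Sum.inl x => x.1
  | Sum.inr x => x.1

/-- The left hand sides of the generic relations. -/
noncomputable def lhs : ∀ x : RelIndex, Word O A.carrier (ICat.disc (Gen O A.carrier x.arity))
  | Sum.inl x => ⟨x.1, (gen O A.carrier x.1).op ≫ O.perm x.2,
      fun i => (gen O A.carrier x.1).arg (x.2 i)⟩
  | Sum.inr x => Word.comp (n := x.1) (gen O A.carrier x.1).op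
      (Word.degen x.2 (gen O A.carrier x.1).arg)

/-- The right hand sides of the generic relations. -/
noncomputable def rhs : ∀ x : RelIndex, Word O A.carrier (ICat.disc (Gen O A.carrier x.arity))
  | Sum.inl x => gen O A.carrier x.1
  | Sum.inr x => ⟨x.1, (gen O A.carrier x.1).op,
      fun i => A.eval (Word.degen x.2 (gen O A.carrier x.1).arg i)⟩

theorem rel_lhs_rhs (x : RelIndex) : A.Rel (A.lhs x) (A.rhs x) := by
  rcases x with x | x
  · exact Or.inl ⟨x.2, rfl⟩
  · exact Or.inr ⟨x.2, (gen O A.carrier x.1).arg, fun i => rfl, rfl⟩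

/-- The shape of the diagram of generic words and generic relations. -/
noncomputable def relShape : MultispanShape.{0, 0} where
  L := RelIndex
  R := ℕ
  fst x := (A.lhs x).n
  snd x := (A.rhs x).n

/-- The diagram of generic words and generic relations. -/
noncomputable def relDiagram : MultispanIndex A.relShape V where
  left x := Gen O A.carrier (RelIndex.arity x)
  right n := Gen O A.carrier n
  fst x := (A.lhs x).elt
  snd x := (A.rhs x).elt

/-- Omission of one of n + 1 arguments leaves length n, so this generic relation joins the vertices
n + 1 and n of the diagram. -/
theorem lhs_degen_n (n : ℕ) : (A.lhs (Sum.inr ⟨n + 1, 0⟩)).n = n := by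
  have key : ∀ a : Fin (n + 1) → (ICat.disc (Gen O A.carrier (n + 1)) ⟶ A.carrier),
      ∑ i, (Word.degen 0 a i : Word O _ _).n = n := by
    intro a
    rw [Fin.sum_univ_succ, Word.degen_self]
    have : ∀ i : Fin n, (Word.degen 0 a i.succ : Word O A.carrier _).n = 1 := by
      intro i
      rw [Word.degen_of_ne (Fin.succ_ne_zero i)]
      rfl
    simp [this, Word.zero]
  exact key _

/-- Permutation relations join each length only to itself; the omission relations lead from every
length down to 0. Without them the quotient would involve a coproduct over all lengths, which
products are not assumed to preserve. -/
instance isConnected_relShape : IsConnected (WalkingMultispan A.relShape) := by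
  have h : ∀ n : ℕ, Zigzag (WalkingMultispan.right n : WalkingMultispan A.relShape)
      (WalkingMultispan.right (0 : ℕ)) := by
    intro n
    induction n with
    | zero => exact Zigzag.refl _
    | succ n ih =>
      have h₁ : Zigzag (WalkingMultispan.right (A.rhs (Sum.inr ⟨n + 1, 0⟩)).n :
          WalkingMultispan A.relShape) (WalkingMultispan.right (A.lhs (Sum.inr ⟨n + 1, 0⟩)).n) :=
        Zigzag.of_inv_hom (j₂ := WalkingMultispan.left (J := A.relShape) (Sum.inr ⟨n + 1, 0⟩))
          (WalkingMultispan.Hom.snd _) (WalkingMultispan.Hom.fst _)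
      rw [lhs_degen_n] at h₁
      exact h₁.trans ih
  have h' : ∀ j : WalkingMultispan A.relShape, Zigzag j (WalkingMultispan.right (0 : ℕ)) := by
    intro j
    match j with
    | WalkingMultispan.right n => exact h n
    | WalkingMultispan.left x =>
      exact (Zigzag.of_hom (WalkingMultispan.Hom.fst x)).trans (h _)
  have : Nonempty (WalkingMultispan A.relShape) := ⟨WalkingMultispan.right (0 : ℕ)⟩
  exact zigzag_isConnected fun j₁ j₂ => (h' j₁).trans (h' j₂).symm

variable [HasColimitsOfSize.{0, 0} V]

/-- The object of words up to permutations and base points. -/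
noncomputable def FreeOb : V := multicoequalizer A.relDiagram

/-- The class of a word. -/
noncomputable def cls {X : V} (w : Word O A.carrier (ICat.disc X)) : X ⟶ A.FreeOb :=
  w.elt ≫ Multicoequalizer.π A.relDiagram w.n

theorem cls_pull {X Y : V} (y : Y ⟶ X) (w : Word O A.carrier (ICat.disc X)) :
    A.cls (pull (discMap y) w) = y ≫ A.cls w := by
  unfold cls
  rw [elt_pull]
  exact Category.assoc _ _ _

variable {A}

theorem cls_lhs_rhs (x : RelIndex) : A.cls (A.lhs x) = A.cls (A.rhs x) :=
  Multicoequalizer.condition A.relDiagram x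

/-- Every instance of the relation is pulled back from a generic one. For an omission, the
classifying map is given by the operation and the arguments a, whose s-th entry is arbitrary since
the degenerate family ignores it. -/
theorem Rel.cls_eq {X : V} {w w' : Word O A.carrier (ICat.disc X)} (h : A.Rel w w') :
    A.cls w = A.cls w' := by
  suffices h : ∃ (x : RelIndex) (u : X ⟶ Gen O A.carrier x.arity),
      w = Word.pull (discMap u) (A.lhs x) ∧ w' = Word.pull (discMap u) (A.rhs x) by
    obtain ⟨x, u, rfl, rfl⟩ := h
    rw [cls_pull, cls_pull, cls_lhs_rhs]
  rcases h with ⟨ρ, rfl⟩ | ⟨s, a, ha, rfl⟩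
  · refine ⟨Sum.inl ⟨w'.n, ρ⟩, w'.elt, ?_, (pull_elt_gen w').symm⟩
    refine (ext_cast (w := Word.pull (discMap w'.elt) (A.lhs (Sum.inl ⟨w'.n, ρ⟩)))
      (w' := ⟨w'.n, w'.op ≫ O.perm ρ, fun i => w'.arg (ρ i)⟩) rfl ((Category.comp_id _).trans ?_)
      fun i => discMap_elt_arg w' (ρ i)).symm
    exact (Category.assoc _ _ _).symm.trans (congrArg (fun t => t ≫ O.perm ρ) w'.discMap_elt_op)
  · let u : Word O A.carrier (ICat.disc X) := ⟨w'.n, w'.op, a⟩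
    have h : ∀ i, Word.pull (discMap u.elt) (degen s (gen O A.carrier w'.n).arg i) = degen s a i :=
      fun i => (Word.pull_degen _ s _ i).trans
        (congrArg (fun t => degen (O := O) s t i) (funext u.discMap_elt_arg))
    refine ⟨Sum.inr ⟨w'.n, s⟩, u.elt, ?_, ?_⟩
    · exact ((Word.pull_comp _ _ _).trans (congrArg₂ Word.comp u.discMap_elt_op (funext h))).symm
    · refine (ext_cast (w := Word.pull (discMap u.elt) (A.rhs (Sum.inr ⟨w'.n, s⟩))) (w' := w') rfl
        ((Category.comp_id _).trans u.discMap_elt_op) fun i => ?_).symm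
      exact (A.eval_pull _ _).symm.trans ((congrArg A.eval (h i)).trans (ha i).symm)

/-- The classes of a family of words. -/
noncomputable def clsPi {n : ℕ} {X : V} (w : Fin n → Word O A.carrier (ICat.disc X)) :
    X ⟶ ∏ᶜ fun _ : Fin n => A.FreeOb :=
  Pi.lift fun i => A.cls (w i)

theorem consPi_clsPi {n : ℕ} {X : V} (w : Word O A.carrier (ICat.disc X))
    (w' : Fin n → Word O A.carrier (ICat.disc X)) :
    consPi (A.cls w) (clsPi w') = clsPi (Fin.cons w w' : Fin (n + 1) → _) := by
  refine Pi.hom_ext _ _ fun i => ?_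
  cases i using Fin.cases <;> simp [consPi, clsPi]

/-! ### Descent to classes of words in several variables -/

variable [ProdPreservesConnectedColimits V]

instance (Z : V) : PreservesColimit A.relDiagram.multispan (prod.functor.obj Z) :=
  haveI := ProdPreservesConnectedColimits.preserves Z (WalkingMultispan A.relShape)
  inferInstance

/-- Descent of natural families to classes of words, with a parameter. -/
theorem exists_desc_one {Z T : V}
    (f : ∀ ⦃X : V⦄, (X ⟶ Z) → Word O A.carrier (ICat.disc X) → (X ⟶ T))
    (nat : ∀ ⦃X Y : V⦄ (y : Y ⟶ X) (z : X ⟶ Z) (w : Word O A.carrier (ICat.disc X)),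
      y ≫ f z w = f (y ≫ z) (pull (discMap y) w))
    (inv : ∀ ⦃X : V⦄ (z : X ⟶ Z) (w w' : Word O A.carrier (ICat.disc X)), A.Rel w w' →
      f z w = f z w') :
    ∃ F : Z ⨯ A.FreeOb ⟶ T, ∀ ⦃X : V⦄ (z : X ⟶ Z) (w : Word O A.carrier (ICat.disc X)),
      prod.lift z (A.cls w) ≫ F = f z w := by
  -- The leg at n is the value of f at the universal pair of a parameter and a word of length n;
  -- naturality recovers all other values from it.
  let k : ∀ n : ℕ, Z ⨯ Gen O A.carrier n ⟶ T := fun n =>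
    f prod.fst (pull (discMap prod.snd) (gen O A.carrier n))
  have hk : ∀ {X : V} (z : X ⟶ Z) (w : Word O A.carrier (ICat.disc X)),
      prod.lift z w.elt ≫ k w.n = f z w := by
    intro X z w
    rw [nat, prod.lift_fst, pull_discMap, prod.lift_snd, pull_elt_gen]
  obtain ⟨F, hF⟩ := exists_prod_multicoequalizer_desc A.relDiagram Z (T := T) k (by
    intro x
    have h : ∀ w : Word O A.carrier (ICat.disc (Gen O A.carrier (RelIndex.arity x))),
        prod.map (𝟙 Z) w.elt ≫ k w.n = f prod.fst (pull (discMap prod.snd) w) := by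
      intro w
      rw [← hk, elt_pull]
      refine congrArg (fun t => t ≫ k w.n) ?_
      apply prod.hom_ext
      · rw [prod.map_fst, Category.comp_id]
        exact (prod.lift_fst _ _).symm
      · rw [prod.map_snd]
        exact (prod.lift_snd _ _).symm
    refine (h (A.lhs x)).trans (Eq.trans ?_ (h (A.rhs x)).symm)
    exact inv _ _ _ ((A.rel_lhs_rhs x).pull _))
  refine ⟨F, fun X z w => ?_⟩
  have e : prod.lift z w.elt ≫ prod.map (𝟙 Z) (Multicoequalizer.π A.relDiagram w.n) =
      prod.lift z (A.cls w) :=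
    (prod.lift_map z w.elt (𝟙 Z) (Multicoequalizer.π A.relDiagram w.n)).trans
      (congrArg (fun t => prod.lift t _) (Category.comp_id z))
  rw [← hk]
  refine (congrArg (fun t => t ≫ F) e.symm).trans ((Category.assoc _ _ _).trans ?_)
  exact congrArg (fun t => prod.lift z w.elt ≫ t) (hF w.n)

/-- The maps from Z ⨯ O(n) ⨯ Aⁿ to Z ⨯ `FreeOb` are jointly epimorphic, by preservation of the
colimit, and they are given by generic words. -/
theorem desc_one_ext {Z T : V} {F G : Z ⨯ A.FreeOb ⟶ T}
    (h : ∀ ⦃X : V⦄ (z : X ⟶ Z) (w : Word O A.carrier (ICat.disc X)),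
      prod.lift z (A.cls w) ≫ F = prod.lift z (A.cls w) ≫ G) : F = G := by
  refine prod_multicoequalizer_hom_ext A.relDiagram Z fun n => ?_
  have h₁ := h (X := Z ⨯ Gen O A.carrier n) prod.fst (pull (discMap prod.snd) (gen O A.carrier n))
  have h₂ : elt (gen O A.carrier n) = 𝟙 _ := by
    apply ICat.times_ob_ext
    · exact (ICat.liftOb_fst _ _).trans (Category.id_comp _).symm
    · apply ICat.pi_ob_ext
      intro i
      refine (elt_snd_proj _ i).trans ?_
      exact congrArg (fun t => t ≫ ICat.Fun.obj (ICat.proj i)) (Category.id_comp _).symm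
  have h₃ : prod.lift prod.fst (A.cls (pull (discMap prod.snd) (gen O A.carrier n))) =
      prod.map (𝟙 Z) (Multicoequalizer.π A.relDiagram n) := by
    rw [cls_pull, cls, h₂]
    apply prod.hom_ext
    · exact (prod.lift_fst _ _).trans ((prod.map_fst _ _).trans (Category.comp_id _)).symm
    · refine (prod.lift_snd _ _).trans (Eq.trans ?_ (prod.map_snd _ _).symm)
      exact congrArg (fun t => prod.snd ≫ t) (Category.id_comp _)
  rw [h₃] at h₁
  exact h₁

/-- Induction that splits off one factor at a time and treats all others as parameters. Powers of
`FreeOb` never have to be presented as colimits. -/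
theorem desc_ext {n : ℕ} {Z T : V} {F G : (Z ⨯ ∏ᶜ fun _ : Fin n => A.FreeOb) ⟶ T}
    (h : ∀ ⦃X : V⦄ (z : X ⟶ Z) (w : Fin n → Word O A.carrier (ICat.disc X)),
      prod.lift z (clsPi w) ≫ F = prod.lift z (clsPi w) ≫ G) : F = G := by
  induction n generalizing Z T with
  | zero =>
    have h₁ := h (X := Z ⨯ ∏ᶜ fun _ : Fin 0 => A.FreeOb) prod.fst Fin.elim0
    have h₂ : prod.lift prod.fst (clsPi Fin.elim0) =
        𝟙 (Z ⨯ ∏ᶜ fun _ : Fin 0 => A.FreeOb) := by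
      apply prod.hom_ext
      · simp
      · exact Pi.hom_ext _ _ fun i => Fin.elim0 i
    rw [h₂, Category.id_comp, Category.id_comp] at h₁
    exact h₁
  | succ n ih =>
    let e : (Z ⨯ ∏ᶜ fun _ : Fin n => A.FreeOb) ⨯ A.FreeOb ⟶
        Z ⨯ ∏ᶜ fun _ : Fin (n + 1) => A.FreeOb :=
      prod.lift (prod.fst ≫ prod.fst) (consPi prod.snd (prod.fst ≫ prod.snd))
    have he : e ≫ F = e ≫ G := by
      refine desc_one_ext fun X z w => ?_
      -- The split factor is now represented by a word over X, so X becomes the parameter object and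
      -- the induction hypothesis handles the remaining n factors.
      let e' : (X ⨯ ∏ᶜ fun _ : Fin n => A.FreeOb) ⟶ Z ⨯ ∏ᶜ fun _ : Fin (n + 1) => A.FreeOb :=
        prod.lift (prod.fst ≫ z ≫ prod.fst) (consPi (prod.fst ≫ A.cls w) prod.snd)
      have he' : e' ≫ F = e' ≫ G := by
        refine ih fun Y y w' => ?_
        have h₁ : prod.lift y (clsPi w') ≫ e' = prod.lift (y ≫ z ≫ prod.fst)
            (clsPi (Fin.cons (pull (discMap y) w) w' : Fin (n + 1) → _)) := by
          rw [← consPi_clsPi, cls_pull]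
          simp only [e', prod.comp_lift, precomp_consPi, prod.lift_fst_assoc, prod.lift_snd]
        rw [← Category.assoc, ← Category.assoc, h₁]
        exact h _ _
      have h₁ : prod.lift z (A.cls w) ≫ e = prod.lift (𝟙 X) (z ≫ prod.snd) ≫ e' := by
        simp only [e, e', prod.comp_lift, precomp_consPi, prod.lift_fst_assoc, prod.lift_snd,
          Category.id_comp]
      rw [← Category.assoc, ← Category.assoc, h₁, Category.assoc, Category.assoc, he']
    let s : (Z ⨯ ∏ᶜ fun _ : Fin (n + 1) => A.FreeOb) ⟶
        (Z ⨯ ∏ᶜ fun _ : Fin n => A.FreeOb) ⨯ A.FreeOb :=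
      prod.lift (prod.lift prod.fst (Pi.lift fun j => prod.snd ≫ Pi.π _ j.succ))
        (prod.snd ≫ Pi.π _ 0)
    have hs : s ≫ e = 𝟙 _ := by
      simp only [s, e, prod.comp_lift, precomp_consPi, prod.lift_fst_assoc, prod.lift_snd,
        prod.lift_fst, consPi_eta]
      apply prod.hom_ext <;> simp
    calc F = s ≫ e ≫ F := by rw [← Category.assoc, hs, Category.id_comp]
      _ = s ≫ e ≫ G := by rw [he]
      _ = G := by rw [← Category.assoc, hs, Category.id_comp]

/-- Descent of natural families in several variables. -/
theorem exists_desc {n : ℕ} {Z T : V}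
    (f : ∀ ⦃X : V⦄, (X ⟶ Z) → (Fin n → Word O A.carrier (ICat.disc X)) → (X ⟶ T))
    (nat : ∀ ⦃X Y : V⦄ (y : Y ⟶ X) (z : X ⟶ Z) (w : Fin n → Word O A.carrier (ICat.disc X)),
      y ≫ f z w = f (y ≫ z) (fun i => pull (discMap y) (w i)))
    (inv : ∀ ⦃X : V⦄ (z : X ⟶ Z) (w w' : Fin n → Word O A.carrier (ICat.disc X)) (r : Fin n),
      (∀ i, i ≠ r → w i = w' i) → A.Rel (w r) (w' r) → f z w = f z w') :
    ∃ F : (Z ⨯ ∏ᶜ fun _ : Fin n => A.FreeOb) ⟶ T,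
      ∀ ⦃X : V⦄ (z : X ⟶ Z) (w : Fin n → Word O A.carrier (ICat.disc X)),
        prod.lift z (clsPi w) ≫ F = f z w := by
  induction n generalizing Z T with
  | zero =>
    refine ⟨prod.fst ≫ f (𝟙 Z) Fin.elim0, fun X z w => ?_⟩
    rw [prod.lift_fst_assoc, nat, Category.comp_id]
    congr 1
    exact Subsingleton.elim _ _
  | succ n ih =>
    have hpull : ∀ {X Y : V} (y : Y ⟶ X) (w : Word O A.carrier (ICat.disc X))
        (w' : Fin n → Word O A.carrier (ICat.disc X)),
        (fun i => pull (discMap y) ((Fin.cons w w' : Fin (n + 1) → _) i)) =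
          (Fin.cons (pull (discMap y) w) (fun i => pull (discMap y) (w' i)) :
            Fin (n + 1) → Word O A.carrier (ICat.disc Y)) := by
      intro X Y y w w'
      funext i
      cases i using Fin.cases <;> rfl
    -- Take the first word to be generic of length m and add its entries to the parameters; the
    -- induction hypothesis descends the remaining n words.
    have hm : ∀ m : ℕ, ∃ F : ((Z ⨯ Gen O A.carrier m) ⨯ ∏ᶜ fun _ : Fin n => A.FreeOb) ⟶ T,
        ∀ ⦃X : V⦄ (z : X ⟶ Z ⨯ Gen O A.carrier m) (w : Fin n → Word O A.carrier (ICat.disc X)),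
          prod.lift z (clsPi w) ≫ F =
            f (z ≫ prod.fst) (Fin.cons (pull (discMap (z ≫ prod.snd)) (gen O A.carrier m)) w) := by
      intro m
      refine ih (Z := Z ⨯ Gen O A.carrier m) (fun X z w => f (z ≫ prod.fst)
        (Fin.cons (pull (discMap (z ≫ prod.snd)) (gen O A.carrier m)) w)) ?_ ?_
      · intro X Y y z w
        rw [nat, hpull, pull_discMap, Category.assoc, Category.assoc]
      · intro X z w w' r hne hr
        refine inv _ _ _ r.succ ?_ hr
        intro i hi
        cases i using Fin.cases with
        | zero => rfl
        | succ j => exact hne j fun h => hi (h ▸ rfl)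
    choose F hF using hm
    have hF' : ∀ {X : V} (z : X ⟶ Z) (w : Word O A.carrier (ICat.disc X))
        (w' : Fin n → Word O A.carrier (ICat.disc X)),
        prod.lift (prod.lift z w.elt) (clsPi w') ≫ F w.n =
          f z (Fin.cons w w') := by
      intro X z w w'
      rw [hF, prod.lift_fst, prod.lift_snd, pull_elt_gen]
    obtain ⟨G, hG⟩ := exists_desc_one (A := A) (Z := Z ⨯ ∏ᶜ fun _ : Fin n => A.FreeOb) (T := T)
      (fun X z w => prod.lift (prod.lift (z ≫ prod.fst) w.elt) (z ≫ prod.snd) ≫ F w.n) (by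
        intro X Y y z w
        rw [elt_pull, ← Category.assoc]
        simp only [prod.comp_lift, Category.assoc]
        rfl) (by
        intro X z w w' hr
        -- Invariance in the first word is needed for arbitrary generalized classes in the other
        -- variables. Over X ⨯ `FreeOb`ⁿ it follows from uniqueness of descent, which reduces it to
        -- classes represented by words.
        have key : prod.lift (prod.lift (prod.fst ≫ z ≫ prod.fst) (prod.fst ≫ w.elt))
            (prod.snd (X := X)) ≫ F w.n =
            prod.lift (prod.lift (prod.fst ≫ z ≫ prod.fst) (prod.fst ≫ w'.elt))
              prod.snd ≫ F w'.n := by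
          refine desc_ext fun Y y u => ?_
          have h₁ : ∀ v : Word O A.carrier (ICat.disc X), prod.lift y (clsPi u) ≫
              prod.lift (prod.lift (prod.fst ≫ z ≫ prod.fst) (prod.fst ≫ v.elt)) prod.snd ≫
                F v.n = f (y ≫ z ≫ prod.fst) (Fin.cons (pull (discMap y) v) u) := by
            intro v
            rw [← hF', elt_pull, ← Category.assoc]
            simp only [prod.comp_lift, prod.lift_fst_assoc, prod.lift_snd]
            rfl
          rw [h₁, h₁]
          refine inv _ _ _ 0 ?_ (hr.pull _)
          intro i hi
          cases i using Fin.cases with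
          | zero => exact absurd rfl hi
          | succ j => rfl
        have h₂ := congrArg (fun t => prod.lift (𝟙 X) (z ≫ prod.snd) ≫ t) key
        simpa only [← Category.assoc, prod.comp_lift, prod.lift_fst, prod.lift_snd,
          Category.id_comp] using h₂)
    refine ⟨prod.lift (prod.lift prod.fst (Pi.lift fun j => prod.snd ≫ Pi.π _ j.succ))
        (prod.snd ≫ Pi.π _ 0) ≫ G, fun X z w => ?_⟩
    have h₁ : prod.lift z (clsPi w) ≫
        prod.lift (prod.lift prod.fst (Pi.lift fun j : Fin n => prod.snd ≫ Pi.π _ j.succ))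
          (prod.snd ≫ Pi.π _ 0) =
        prod.lift (prod.lift z (clsPi fun j => w j.succ)) (A.cls (w 0)) := by
      apply prod.hom_ext
      · apply prod.hom_ext
        · simp
        · refine Pi.hom_ext _ _ fun j => ?_
          simp [clsPi]
      · simp [clsPi]
    rw [← Category.assoc, h₁, hG, prod.lift_fst, prod.lift_snd, hF']
    congr 1
    exact Fin.cons_self_tail w

end PsAlg

namespace ICat

variable {V : Type u} [Category.{v} V] [HasFiniteLimits V]

/-- Transformations between functors out of a discrete internal category. -/
noncomputable def discTrans {X : V} {C : ICat V} {F G : disc X ⟶ C} (t : X ⟶ C.Mor)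
    (hs : t ≫ C.src = F.obj) (ht : t ≫ C.tgt = G.obj) : F ⟶ G :=
  Trans.mk (C := disc X) t hs ht (by
    have key : ∀ H : disc X ⟶ C, H.mor = H.obj ≫ C.ident := fun H =>
      (Category.id_comp H.mor).symm.trans H.ident_mor
    have h : (disc X).src ≫ t = t := Category.id_comp t
    have h' : (disc X).tgt ≫ t = t := Category.id_comp t
    exact ((C.cmp_congr (key F) h').trans (C.ident_cmp _ _ _)).trans
      ((C.cmp_congr h (key G)).trans (C.cmp_ident _ _ _)).symm)

end ICat

namespace ActionData

variable {V : Type u} [Category.{v} V] [HasFiniteLimits V] {O : ReducedOperad V} {n : ℕ}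

theorem precomp_act₂_app {Y X : ICat V} {B : ActionData O} (H : Y ⟶ X) (o : X ⟶ O.obj n)
    {a b : Fin n → (X ⟶ B.carrier)} (α : ∀ i, a i ⟶ b i) {a' b' : Fin n → (Y ⟶ B.carrier)}
    (β : ∀ i, a' i ⟶ b' i) (h : ∀ i, H.obj ≫ (α i).app = (β i).app) :
    H.obj ≫ (B.act₂ o α).app = (B.act₂ (H ≫ o) β).app := by
  rw [ActionData.act₂_app, ActionData.act₂_app, ← Category.assoc, ICat.precomp_liftMor,
    ICat.precomp_piLiftMor, funext h]
  simp

theorem act₂_app_congr {X : ICat V} {B : ActionData O} {o o' : X ⟶ O.obj n} (ho : o = o')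
    {a b : Fin n → (X ⟶ B.carrier)} (α : ∀ i, a i ⟶ b i) {a' b' : Fin n → (X ⟶ B.carrier)}
    (β : ∀ i, a' i ⟶ b' i) (h : ∀ i, (α i).app = (β i).app) :
    (B.act₂ o α).app = (B.act₂ o' β).app := by
  subst ho
  rw [ActionData.act₂_app, ActionData.act₂_app, funext h]

end ActionData

namespace PsAlg

open Word

attribute [local simp] prod.lift_fst prod.lift_fst_assoc prod.lift_snd prod.lift_snd_assoc

variable {V : Type u} [Category.{v} V] [HasFiniteLimits V] {O : ReducedOperad V} {A : PsAlg O}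
  [HasColimitsOfSize.{0, 0} V] [ProdPreservesConnectedColimits V]

/-! ### Operations on classes of words -/

theorem exists_cls_desc {T : V} (f : ∀ ⦃X : V⦄, Word O A.carrier (ICat.disc X) → (X ⟶ T))
    (nat : ∀ ⦃X Y : V⦄ (y : Y ⟶ X) (w : Word O A.carrier (ICat.disc X)),
      y ≫ f w = f (pull (discMap y) w))
    (inv : ∀ ⦃X : V⦄ (w w' : Word O A.carrier (ICat.disc X)), A.Rel w w' → f w = f w') :
    ∃ F : A.FreeOb ⟶ T, ∀ ⦃X : V⦄ (w : Word O A.carrier (ICat.disc X)), A.cls w ≫ F = f w := by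
  obtain ⟨F, hF⟩ := exists_desc_one (A := A) (Z := ⊤_ V) (fun X _ w => f w)
    (fun X Y y _ w => nat y w) (fun X _ w w' h => inv w w' h)
  refine ⟨prod.lift (terminal.from _) (𝟙 _) ≫ F, fun X w => ?_⟩
  rw [← hF (terminal.from X) w, ← Category.assoc, prod.comp_lift, Category.comp_id]
  congr 2
  exact Subsingleton.elim _ _

theorem cls_ext {T : V} {F G : A.FreeOb ⟶ T}
    (h : ∀ ⦃X : V⦄ (w : Word O A.carrier (ICat.disc X)), A.cls w ≫ F = A.cls w ≫ G) : F = G := by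
  have h₁ : (prod.snd : (⊤_ V) ⨯ A.FreeOb ⟶ _) ≫ F = prod.snd ≫ G :=
    desc_one_ext fun X z w => by simpa using h w
  have h₂ := congrArg (fun t => prod.lift (terminal.from A.FreeOb) (𝟙 _) ≫ t) h₁
  simpa using h₂

/-- Natural families indexed by classes of words are determined by their values on words. -/
theorem free_ext {ι : Type} [Fintype ι] {Z : ICat V} {T : V}
    (f g : ∀ ⦃X : V⦄, (ICat.disc X ⟶ Z) → (ι → (X ⟶ A.FreeOb)) → (X ⟶ T))
    (hf : ∀ ⦃X Y : V⦄ (y : Y ⟶ X) (z : ICat.disc X ⟶ Z) (s : ι → (X ⟶ A.FreeOb)),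
      y ≫ f z s = f (discMap y ≫ z) (fun i => y ≫ s i))
    (hg : ∀ ⦃X Y : V⦄ (y : Y ⟶ X) (z : ICat.disc X ⟶ Z) (s : ι → (X ⟶ A.FreeOb)),
      y ≫ g z s = g (discMap y ≫ z) (fun i => y ≫ s i))
    (h : ∀ ⦃X : V⦄ (z : ICat.disc X ⟶ Z) (w : ι → Word O A.carrier (ICat.disc X)),
      f z (fun i => A.cls (w i)) = g z (fun i => A.cls (w i)))
    {X : V} (z : ICat.disc X ⟶ Z) (s : ι → (X ⟶ A.FreeOb)) : f z s = g z s := by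
  let e := Fintype.equivFin ι
  -- P is the universal parameter object for a point of Z and a family of classes; every other case
  -- is a pullback of this one.
  let P : V := Z.Ob ⨯ ∏ᶜ fun _ : Fin (Fintype.card ι) => A.FreeOb
  let z₀ : ICat.disc P ⟶ Z := ICat.ofOb prod.fst
  let s₀ : ι → (P ⟶ A.FreeOb) := fun i => prod.snd ≫ Pi.π _ (e i)
  have key : f z₀ s₀ = g z₀ s₀ := by
    refine desc_ext fun Y y w => ?_
    have h₁ : (fun i => prod.lift y (clsPi w) ≫ s₀ i) = fun i => A.cls (w (e i)) := by
      funext i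
      refine (Category.assoc _ _ _).symm.trans ?_
      rw [prod.lift_snd]
      exact Pi.lift_π _ _
    rw [hf, hg, h₁, h]
  let x : X ⟶ P := prod.lift z.obj (Pi.lift fun i => s (e.symm i))
  have hz : discMap x ≫ z₀ = z := ICat.disc_hom_ext (prod.lift_fst _ _)
  have hs : (fun i => x ≫ s₀ i) = s := by
    funext i
    refine (Category.assoc _ _ _).symm.trans ?_
    refine (congrArg (fun t => t ≫ _) (prod.lift_snd _ _)).trans ?_
    exact (Pi.lift_π _ _).trans (congrArg s (e.symm_apply_apply i))
  have := congrArg (fun t => x ≫ t) key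
  simp only [hf, hg] at this
  rwa [hz, hs] at this

/-- The descended map is kept as a natural operation on generalized elements. Identities between
such operations can then be proved by `free_ext`, that is, on words. -/
theorem exists_free_desc {n : ℕ} {Z : ICat V} {T : V}
    (f : ∀ ⦃X : V⦄, (ICat.disc X ⟶ Z) → (Fin n → Word O A.carrier (ICat.disc X)) → (X ⟶ T))
    (nat : ∀ ⦃X Y : V⦄ (y : Y ⟶ X) (z : ICat.disc X ⟶ Z)
      (w : Fin n → Word O A.carrier (ICat.disc X)),
      y ≫ f z w = f (discMap y ≫ z) (fun i => pull (discMap y) (w i)))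
    (inv : ∀ ⦃X : V⦄ (z : ICat.disc X ⟶ Z) (w w' : Fin n → Word O A.carrier (ICat.disc X))
      (r : Fin n), (∀ i, i ≠ r → w i = w' i) → A.Rel (w r) (w' r) → f z w = f z w') :
    ∃ F : ∀ ⦃X : V⦄, (ICat.disc X ⟶ Z) → (Fin n → (X ⟶ A.FreeOb)) → (X ⟶ T),
      (∀ ⦃X Y : V⦄ (y : Y ⟶ X) (z : ICat.disc X ⟶ Z) (s : Fin n → (X ⟶ A.FreeOb)),
        y ≫ F z s = F (discMap y ≫ z) (fun i => y ≫ s i)) ∧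
      ∀ ⦃X : V⦄ (z : ICat.disc X ⟶ Z) (w : Fin n → Word O A.carrier (ICat.disc X)),
        F z (fun i => A.cls (w i)) = f z w := by
  obtain ⟨F, hF⟩ := exists_desc (A := A) (n := n) (Z := Z.Ob) (T := T)
    (fun X z w => f (ICat.ofOb z) w)
    (fun X Y y z w => by
      rw [nat]
      exact congrArg (fun t => f t _) (ICat.comp_ofOb y z))
    (fun X z w w' r hne hr => inv _ w w' r hne hr)
  refine ⟨fun X z s => prod.lift z.obj (Pi.lift s) ≫ F, fun X Y y z s => ?_, fun X z w => ?_⟩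
  · rw [← Category.assoc]
    refine congrArg (fun t => t ≫ F) ?_
    refine (prod.comp_lift y z.obj (Pi.lift s)).trans ?_
    refine congrArg (fun t => prod.lift (y ≫ z.obj) t) ?_
    exact Pi.hom_ext _ _ fun i => by simp
  · refine (hF z.obj w).trans ?_
    exact congrArg (fun t => f t w) (ICat.ofOb_obj_eq z)

variable (A)

theorem exists_freeEval : ∃ F : A.FreeOb ⟶ A.carrier.Ob,
    ∀ ⦃X : V⦄ (w : Word O A.carrier (ICat.disc X)), A.cls w ≫ F = (A.eval w).obj :=
  exists_cls_desc (A := A) (fun _ w => ICat.Fun.obj (A.eval w))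
    (fun _ _ y w => (congrArg ICat.Fun.obj (A.eval_pull (discMap y) w)).symm)
    (fun _ _ _ h => congrArg ICat.Fun.obj h.eval_eq)

/-- Evaluation of classes of words. -/
noncomputable def freeEval : A.FreeOb ⟶ A.carrier.Ob := A.exists_freeEval.choose

theorem cls_freeEval {X : V} (w : Word O A.carrier (ICat.disc X)) :
    A.cls w ≫ A.freeEval = (A.eval w).obj :=
  A.exists_freeEval.choose_spec w

/-- Evaluation of a generalized class of words, as a functor. -/
noncomputable def freeVal {X : V} (s : X ⟶ A.FreeOb) : ICat.disc X ⟶ A.carrier :=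
  ICat.ofOb (s ≫ A.freeEval)

theorem freeVal_cls {X : V} (w : Word O A.carrier (ICat.disc X)) :
    A.freeVal (A.cls w) = A.eval w :=
  ICat.disc_hom_ext (A.cls_freeEval w)

theorem discMap_freeVal {X Y : V} (y : Y ⟶ X) (s : X ⟶ A.FreeOb) :
    discMap y ≫ A.freeVal s = A.freeVal (y ≫ s) :=
  ICat.disc_hom_ext (Category.assoc _ _ _).symm

/-- Composition of words respects the relation in each entry by `Rel.comp`. -/
theorem exists_freeAct (n : ℕ) :
    ∃ F : ∀ ⦃X : V⦄, (ICat.disc X ⟶ O.obj n) → (Fin n → (X ⟶ A.FreeOb)) → (X ⟶ A.FreeOb),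
      (∀ ⦃X Y : V⦄ (y : Y ⟶ X) (z : ICat.disc X ⟶ O.obj n) (s : Fin n → (X ⟶ A.FreeOb)),
        y ≫ F z s = F (discMap y ≫ z) (fun i => y ≫ s i)) ∧
      ∀ ⦃X : V⦄ (z : ICat.disc X ⟶ O.obj n) (w : Fin n → Word O A.carrier (ICat.disc X)),
        F z (fun i => A.cls (w i)) = A.cls (Word.comp z w) :=
  exists_free_desc (fun X z w => A.cls (Word.comp z w))
    (fun X Y y z w => (A.cls_pull y _).symm.trans (congrArg A.cls (Word.pull_comp _ z w)))
    (fun X z w w' r hne hr => (hr.comp z hne).cls_eq)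

/-- Possible because φ is unchanged when an inner word is replaced by a related one (`Rel.phi_eq`).
-/
theorem exists_freePhi (n : ℕ) :
    ∃ F : ∀ ⦃X : V⦄, (ICat.disc X ⟶ O.obj n) → (Fin n → (X ⟶ A.FreeOb)) → (X ⟶ A.carrier.Mor),
      (∀ ⦃X Y : V⦄ (y : Y ⟶ X) (z : ICat.disc X ⟶ O.obj n) (s : Fin n → (X ⟶ A.FreeOb)),
        y ≫ F z s = F (discMap y ≫ z) (fun i => y ≫ s i)) ∧
      ∀ ⦃X : V⦄ (z : ICat.disc X ⟶ O.obj n) (w : Fin n → Word O A.carrier (ICat.disc X)),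
        F z (fun i => A.cls (w i)) = A.phi z w :=
  exists_free_desc (fun X z w => A.phi z w)
    (fun X Y y z w => A.phi_precomp (discMap y) z w)
    (fun X z w w' r hne hr => hr.phi_eq z hne)

theorem exists_freePhiInv (n : ℕ) :
    ∃ F : ∀ ⦃X : V⦄, (ICat.disc X ⟶ O.obj n) → (Fin n → (X ⟶ A.FreeOb)) → (X ⟶ A.carrier.Mor),
      (∀ ⦃X Y : V⦄ (y : Y ⟶ X) (z : ICat.disc X ⟶ O.obj n) (s : Fin n → (X ⟶ A.FreeOb)),
        y ≫ F z s = F (discMap y ≫ z) (fun i => y ≫ s i)) ∧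
      ∀ ⦃X : V⦄ (z : ICat.disc X ⟶ O.obj n) (w : Fin n → Word O A.carrier (ICat.disc X)),
        F z (fun i => A.cls (w i)) = A.phiInv z w :=
  exists_free_desc (fun X z w => A.phiInv z w)
    (fun X Y y z w => A.phiInv_precomp (discMap y) z w)
    (fun X z w w' r hne hr => A.phiInv_congr (hr.phi_eq z hne))

variable {n : ℕ} {X Y : V}

/-- The action of the operad on classes of words. -/
noncomputable def freeAct (o : ICat.disc X ⟶ O.obj n) (s : Fin n → (X ⟶ A.FreeOb)) :
    X ⟶ A.FreeOb :=
  (A.exists_freeAct n).choose o s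

/-- The composition isomorphisms on classes of words. -/
noncomputable def freePhi (o : ICat.disc X ⟶ O.obj n) (s : Fin n → (X ⟶ A.FreeOb)) :
    X ⟶ A.carrier.Mor :=
  (A.exists_freePhi n).choose o s

/-- The inverses of the composition isomorphisms on classes of words. -/
noncomputable def freePhiInv (o : ICat.disc X ⟶ O.obj n) (s : Fin n → (X ⟶ A.FreeOb)) :
    X ⟶ A.carrier.Mor :=
  (A.exists_freePhiInv n).choose o s

theorem precomp_freeAct (y : Y ⟶ X) (o : ICat.disc X ⟶ O.obj n) (s : Fin n → (X ⟶ A.FreeOb)) :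
    y ≫ A.freeAct o s = A.freeAct (discMap y ≫ o) (fun i => y ≫ s i) :=
  (A.exists_freeAct n).choose_spec.1 y o s

theorem freeAct_cls (o : ICat.disc X ⟶ O.obj n) (w : Fin n → Word O A.carrier (ICat.disc X)) :
    A.freeAct o (fun i => A.cls (w i)) = A.cls (Word.comp o w) :=
  (A.exists_freeAct n).choose_spec.2 o w

theorem precomp_freePhi (y : Y ⟶ X) (o : ICat.disc X ⟶ O.obj n) (s : Fin n → (X ⟶ A.FreeOb)) :
    y ≫ A.freePhi o s = A.freePhi (discMap y ≫ o) (fun i => y ≫ s i) :=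
  (A.exists_freePhi n).choose_spec.1 y o s

theorem freePhi_cls (o : ICat.disc X ⟶ O.obj n) (w : Fin n → Word O A.carrier (ICat.disc X)) :
    A.freePhi o (fun i => A.cls (w i)) = A.phi o w :=
  (A.exists_freePhi n).choose_spec.2 o w

theorem precomp_freePhiInv (y : Y ⟶ X) (o : ICat.disc X ⟶ O.obj n)
    (s : Fin n → (X ⟶ A.FreeOb)) :
    y ≫ A.freePhiInv o s = A.freePhiInv (discMap y ≫ o) (fun i => y ≫ s i) :=
  (A.exists_freePhiInv n).choose_spec.1 y o s

theorem freePhiInv_cls (o : ICat.disc X ⟶ O.obj n)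
    (w : Fin n → Word O A.carrier (ICat.disc X)) :
    A.freePhiInv o (fun i => A.cls (w i)) = A.phiInv o w :=
  (A.exists_freePhiInv n).choose_spec.2 o w

theorem precomp_act_freeVal (y : Y ⟶ X) (o : ICat.disc X ⟶ O.obj n)
    (s : Fin n → (X ⟶ A.FreeOb)) :
    y ≫ ICat.Fun.obj (A.act o (fun i => A.freeVal (s i))) =
      ICat.Fun.obj (A.act (discMap y ≫ o) (fun i => A.freeVal (y ≫ s i))) := by
  have h := congrArg ICat.Fun.obj (A.precomp_act (discMap y) o (fun i => A.freeVal (s i)))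
  simp only [discMap_freeVal] at h
  exact h

theorem freePhi_src (o : ICat.disc X ⟶ O.obj n) (s : Fin n → (X ⟶ A.FreeOb)) :
    A.freePhi o s ≫ A.carrier.src = (A.act o (fun i => A.freeVal (s i))).obj := by
  refine free_ext (fun X o s => A.freePhi o s ≫ A.carrier.src)
    (fun X o s => ICat.Fun.obj (A.act o (fun i => A.freeVal (s i)))) ?_ ?_ ?_ o s
  · intro X Y y o s
    simp only [← Category.assoc, precomp_freePhi]
  · intro X Y y o s
    exact A.precomp_act_freeVal y o s
  · intro X o w
    simp only [freePhi_cls, freeVal_cls]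
    exact A.phi_src o w

theorem freePhi_tgt (o : ICat.disc X ⟶ O.obj n) (s : Fin n → (X ⟶ A.FreeOb)) :
    A.freePhi o s ≫ A.carrier.tgt = A.freeAct o s ≫ A.freeEval := by
  refine free_ext (fun X o s => A.freePhi o s ≫ A.carrier.tgt)
    (fun X o s => A.freeAct o s ≫ A.freeEval) ?_ ?_ ?_ o s
  · intro X Y y o s
    simp only [← Category.assoc, precomp_freePhi]
  · intro X Y y o s
    simp only [← Category.assoc, precomp_freeAct]
  · intro X o w
    simp only [freePhi_cls, freeAct_cls, cls_freeEval]
    exact A.phi_tgt o w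

theorem freePhiInv_src (o : ICat.disc X ⟶ O.obj n) (s : Fin n → (X ⟶ A.FreeOb)) :
    A.freePhiInv o s ≫ A.carrier.src = A.freePhi o s ≫ A.carrier.tgt := by
  refine free_ext (fun X o s => A.freePhiInv o s ≫ A.carrier.src)
    (fun X o s => A.freePhi o s ≫ A.carrier.tgt) ?_ ?_ ?_ o s
  · intro X Y y o s
    simp only [← Category.assoc, precomp_freePhiInv]
  · intro X Y y o s
    simp only [← Category.assoc, precomp_freePhi]
  · intro X o w
    simp only [freePhi_cls, freePhiInv_cls]
    exact (A.phiInv_src o w).trans (A.phi_tgt o w).symm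

theorem freePhiInv_tgt (o : ICat.disc X ⟶ O.obj n) (s : Fin n → (X ⟶ A.FreeOb)) :
    A.freePhiInv o s ≫ A.carrier.tgt = A.freePhi o s ≫ A.carrier.src := by
  refine free_ext (fun X o s => A.freePhiInv o s ≫ A.carrier.tgt)
    (fun X o s => A.freePhi o s ≫ A.carrier.src) ?_ ?_ ?_ o s
  · intro X Y y o s
    simp only [← Category.assoc, precomp_freePhiInv]
  · intro X Y y o s
    simp only [← Category.assoc, precomp_freePhi]
  · intro X o w
    simp only [freePhi_cls, freePhiInv_cls]
    exact (A.phiInv_tgt o w).trans (A.phi_src o w).symm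

/-- The isomorphisms `θ(o; ε s) ≅ ε (o · s)`. -/
noncomputable def freePhiFam (o : ICat.disc X ⟶ O.obj n) (s : Fin n → (X ⟶ A.FreeOb)) :
    ICat.IsoFam A.carrier X where
  hom := A.freePhi o s
  inv := A.freePhiInv o s
  inv_src := A.freePhiInv_src o s
  inv_tgt := A.freePhiInv_tgt o s
  hom_inv := by
    refine free_ext (fun X o s => A.carrier.cmp (A.freePhi o s) (A.freePhiInv o s)
      (A.freePhiInv_src o s).symm) (fun X o s => (A.freePhi o s ≫ A.carrier.src) ≫ A.carrier.ident)
      ?_ ?_ ?_ o s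
    · intro X Y y o s
      rw [ICat.precomp_cmp]
      exact ICat.cmp_congr _ (A.precomp_freePhi y o s) (A.precomp_freePhiInv y o s)
    · intro X Y y o s
      simp only [← Category.assoc, precomp_freePhi]
    · intro X o w
      refine (ICat.cmp_congr _ (A.freePhi_cls o w) (A.freePhiInv_cls o w)).trans ?_
      refine (A.phi_phiInv o w).trans ?_
      rw [freePhi_cls]
      exact congrArg (fun t => t ≫ A.carrier.ident) (A.phi_src o w).symm
  inv_hom := by
    refine free_ext (fun X o s => A.carrier.cmp (A.freePhiInv o s) (A.freePhi o s)
      (A.freePhiInv_tgt o s)) (fun X o s => (A.freePhi o s ≫ A.carrier.tgt) ≫ A.carrier.ident)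
      ?_ ?_ ?_ o s
    · intro X Y y o s
      rw [ICat.precomp_cmp]
      exact ICat.cmp_congr _ (A.precomp_freePhiInv y o s) (A.precomp_freePhi y o s)
    · intro X Y y o s
      simp only [← Category.assoc, precomp_freePhi]
    · intro X o w
      refine (ICat.cmp_congr _ (A.freePhiInv_cls o w) (A.freePhi_cls o w)).trans ?_
      refine (A.phiInv_phi o w).trans ?_
      rw [freePhi_cls]
      exact congrArg (fun t => t ≫ A.carrier.ident) (A.phi_tgt o w).symm

/-- The composed words differ by a block permutation, so they are equal as classes though not as
words. -/
theorem freeAct_perm (ρ : Equiv.Perm (Fin n)) (o : ICat.disc X ⟶ O.obj n)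
    (s : Fin n → (X ⟶ A.FreeOb)) :
    A.freeAct (o ≫ O.perm ρ) (fun i => s (ρ i)) = A.freeAct o s := by
  refine free_ext (fun X o s => A.freeAct (o ≫ O.perm ρ) (fun i => s (ρ i)))
    (fun X o s => A.freeAct o s) ?_ ?_ ?_ o s
  · intro X Y y o s
    rw [precomp_freeAct, Category.assoc]
  · intro X Y y o s
    exact A.precomp_freeAct y o s
  · intro X o w
    rw [freeAct_cls A o, freeAct_cls A (o ≫ O.perm ρ) (fun i => w (ρ i))]
    exact Rel.cls_eq (Or.inl (PermRel.comp_perm ρ o w))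

theorem freePhi_perm (ρ : Equiv.Perm (Fin n)) (o : ICat.disc X ⟶ O.obj n)
    (s : Fin n → (X ⟶ A.FreeOb)) :
    A.freePhi (o ≫ O.perm ρ) (fun i => s (ρ i)) = A.freePhi o s := by
  refine free_ext (fun X o s => A.freePhi (o ≫ O.perm ρ) (fun i => s (ρ i)))
    (fun X o s => A.freePhi o s) ?_ ?_ ?_ o s
  · intro X Y y o s
    rw [precomp_freePhi, Category.assoc]
  · intro X Y y o s
    exact A.precomp_freePhi y o s
  · intro X o w
    rw [freePhi_cls A o, freePhi_cls A (o ≫ O.perm ρ) (fun i => w (ρ i))]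
    exact A.phi_perm_outer ρ o w

theorem freeAct_unit (s : X ⟶ A.FreeOb) :
    A.freeAct (O.unit _) (fun _ : Fin 1 => s) = s := by
  refine free_ext (ι := Unit) (Z := ICat.terminal V)
    (fun X _ s => A.freeAct (O.unit _) (fun _ : Fin 1 => s ()))
    (fun X _ s => s ()) ?_ ?_ ?_ (ICat.toTerminal _) (fun _ => s)
  · intro X Y y o s
    rw [precomp_freeAct, precomp_unit]
  · intro X Y y o s
    rfl
  · intro X o w
    exact (A.freeAct_cls _ (fun _ => w ())).trans (congrArg A.cls (Word.unit_comp (w ())))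

theorem freePhi_unit (s : X ⟶ A.FreeOb) :
    A.freePhi (O.unit _) (fun _ : Fin 1 => s) = (s ≫ A.freeEval) ≫ A.carrier.ident := by
  refine free_ext (ι := Unit) (Z := ICat.terminal V)
    (fun X _ s => A.freePhi (O.unit _) (fun _ : Fin 1 => s ()))
    (fun X _ s => (s () ≫ A.freeEval) ≫ A.carrier.ident) ?_ ?_ ?_ (ICat.toTerminal _) (fun _ => s)
  · intro X Y y o s
    rw [precomp_freePhi, precomp_unit]
  · intro X Y y o s
    simp only [Category.assoc]
  · intro X o w
    refine (A.freePhi_cls _ (fun _ => w ())).trans ((A.phi_unit_comp (w ())).trans ?_)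
    simp only [cls_freeEval]
    rfl

theorem freeAct_comp {m : Fin n → ℕ} (o : ICat.disc X ⟶ O.obj n)
    (p : ∀ r, ICat.disc X ⟶ O.obj (m r)) (s : ∀ r, Fin (m r) → (X ⟶ A.FreeOb)) :
    A.freeAct o (fun r => A.freeAct (p r) (s r)) = A.freeAct (O.comp o p) (flatten s) := by
  -- The double family of classes is indexed by pairs, and the operations o and p are bundled into
  -- one point of a product, so that both sides are natural in a single parameter.
  have key := free_ext (A := A) (ι := (r : Fin n) × Fin (m r))
    (Z := ICat.times (O.obj n) (ICat.pi fun r => O.obj (m r)))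
    (fun X z s => A.freeAct (z ≫ ICat.fst)
      (fun r => A.freeAct (z ≫ ICat.snd ≫ ICat.proj r) (fun i => s ⟨r, i⟩)))
    (fun X z s => A.freeAct (O.comp (z ≫ ICat.fst) (fun r => z ≫ ICat.snd ≫ ICat.proj r))
      (flatten fun r i => s ⟨r, i⟩)) ?_ ?_ ?_ (ICat.lift o (ICat.piLift p)) (fun x => s x.1 x.2)
  · simpa only [ICat.lift_fst, ← Category.assoc, ICat.lift_snd, ICat.piLift_proj] using key
  · intro X Y y z s
    simp only [precomp_freeAct, Category.assoc]
  · intro X Y y z s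
    simp only [precomp_freeAct, OperadData.precomp_comp, Category.assoc]
  · intro X z w
    simp only [freeAct_cls]
    exact congrArg A.cls (Word.comp_comp _ _ _)

/-- The composition isomorphisms on classes of words, as transformations. -/
noncomputable def freeCell (o : ICat.disc X ⟶ O.obj n) (s : Fin n → (X ⟶ A.FreeOb)) :
    A.act o (fun i => A.freeVal (s i)) ⟶ A.freeVal (A.freeAct o s) :=
  ICat.discTrans (A.freePhi o s) (A.freePhi_src o s) (A.freePhi_tgt o s)

theorem freeCell_tgt {m : Fin n → ℕ} (o : ICat.disc X ⟶ O.obj n)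
    (p : ∀ r, ICat.disc X ⟶ O.obj (m r)) (s : ∀ r, Fin (m r) → (X ⟶ A.FreeOb)) :
    (A.act₂ o (fun r => A.freeCell (p r) (s r))).app ≫ A.carrier.tgt =
      A.freePhi o (fun r => A.freeAct (p r) (s r)) ≫ A.carrier.src :=
  (ICat.Trans.app_tgt _).trans (A.freePhi_src _ _).symm

theorem phi_freeVal_tgt {m : Fin n → ℕ} (o : ICat.disc X ⟶ O.obj n)
    (p : ∀ r, ICat.disc X ⟶ O.obj (m r)) (s : ∀ r, Fin (m r) → (X ⟶ A.FreeOb)) :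
    A.phi o (fun r => ⟨m r, p r, fun i => A.freeVal (s r i)⟩) ≫ A.carrier.tgt =
      A.freePhi (O.comp o p) (flatten s) ≫ A.carrier.src :=
  (A.phi_tgt _ _).trans (A.freePhi_src _ _).symm

/-- The two composites `θ(o; θ(p; ε s)) ≅ ε (γ(o; p) · s)` agree. -/
theorem freePhi_comp {m : Fin n → ℕ} (o : ICat.disc X ⟶ O.obj n)
    (p : ∀ r, ICat.disc X ⟶ O.obj (m r)) (s : ∀ r, Fin (m r) → (X ⟶ A.FreeOb)) :
    A.carrier.cmp (A.act₂ o (fun r => A.freeCell (p r) (s r))).app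
        (A.freePhi o (fun r => A.freeAct (p r) (s r))) (A.freeCell_tgt o p s) =
      A.carrier.cmp (A.phi o (fun r => ⟨m r, p r, fun i => A.freeVal (s r i)⟩))
        (A.freePhi (O.comp o p) (flatten s)) (A.phi_freeVal_tgt o p s) := by
  have key := free_ext (A := A) (ι := (r : Fin n) × Fin (m r))
    (Z := ICat.times (O.obj n) (ICat.pi fun r => O.obj (m r)))
    (fun X z s => A.carrier.cmp (A.act₂ (z ≫ ICat.fst) (fun r => A.freeCell
        (z ≫ ICat.snd ≫ ICat.proj r) (fun i => s ⟨r, i⟩))).app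
      (A.freePhi (z ≫ ICat.fst) (fun r => A.freeAct (z ≫ ICat.snd ≫ ICat.proj r)
        (fun i => s ⟨r, i⟩))) (A.freeCell_tgt _ _ fun r i => s ⟨r, i⟩))
    (fun X z s => A.carrier.cmp (A.phi (z ≫ ICat.fst) (fun r => ⟨m r, z ≫ ICat.snd ≫ ICat.proj r,
        fun i => A.freeVal (s ⟨r, i⟩)⟩))
      (A.freePhi (O.comp (z ≫ ICat.fst) (fun r => z ≫ ICat.snd ≫ ICat.proj r))
        (flatten fun r i => s ⟨r, i⟩)) (A.phi_freeVal_tgt _ _ fun r i => s ⟨r, i⟩)) ?_ ?_ ?_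
    (ICat.lift o (ICat.piLift p)) (fun x => s x.1 x.2)
  -- The projections of the bundled parameter equal o and p only propositionally, and the composites
  -- carry composability proofs. Replacing variables avoids rewriting under those proofs.
  · have aux : ∀ (o' : ICat.disc X ⟶ O.obj n) (p' : ∀ r, ICat.disc X ⟶ O.obj (m r)),
        o' = o → p' = p →
        (A.carrier.cmp (A.act₂ o' (fun r => A.freeCell (p' r) (s r))).app
            (A.freePhi o' (fun r => A.freeAct (p' r) (s r))) (A.freeCell_tgt o' p' s) =
          A.carrier.cmp (A.phi o' (fun r => ⟨m r, p' r, fun i => A.freeVal (s r i)⟩))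
            (A.freePhi (O.comp o' p') (flatten s)) (A.phi_freeVal_tgt o' p' s)) →
        (A.carrier.cmp (A.act₂ o (fun r => A.freeCell (p r) (s r))).app
            (A.freePhi o (fun r => A.freeAct (p r) (s r))) (A.freeCell_tgt o p s) =
          A.carrier.cmp (A.phi o (fun r => ⟨m r, p r, fun i => A.freeVal (s r i)⟩))
            (A.freePhi (O.comp o p) (flatten s)) (A.phi_freeVal_tgt o p s)) := by
      rintro _ _ rfl rfl h
      exact h
    refine aux _ _ (ICat.lift_fst _ _) (funext fun r => ?_) key
    rw [← Category.assoc, ICat.lift_snd, ICat.piLift_proj]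
  · intro X Y y z s
    refine (ICat.precomp_cmp _ y _ _ _).trans (ICat.cmp_congr _ ?_ ?_)
    · refine (ActionData.precomp_act₂_app (discMap y) _ _ (fun r => A.freeCell
        (discMap y ≫ z ≫ ICat.snd ≫ ICat.proj r) (fun i => y ≫ s ⟨r, i⟩)) fun r => ?_).trans ?_
      · exact A.precomp_freePhi y _ _
      · refine ActionData.act₂_app_congr (Category.assoc _ _ _).symm _ _ fun r => ?_
        exact congrArg (fun t => A.freePhi t _) (Category.assoc _ _ _).symm
    · simp only [precomp_freePhi, precomp_freeAct, Category.assoc]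
  · intro X Y y z s
    refine (ICat.precomp_cmp _ y _ _ _).trans (ICat.cmp_congr _ ?_ ?_)
    · refine (A.phi_precomp (discMap y) _ _).trans ?_
      simp only [Word.pull, discMap_freeVal, Category.assoc]
    · simp only [precomp_freePhi, OperadData.precomp_comp, Category.assoc]
  · intro X z w
    -- On representing words the claim is the associativity coherence of φ read from right to left.
    have h₁ := A.phi_comp (z ≫ ICat.fst) (fun r => z ≫ ICat.snd ≫ ICat.proj r)
      (fun r (i : Fin (m r)) => w ⟨r, i⟩)
    refine Eq.trans (ICat.cmp_congr _ ?_ ?_) (h₁.symm.trans (ICat.cmp_congr _ ?_ ?_))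
    · exact ActionData.act₂_app_congr rfl _ _ fun r => A.freePhi_cls _ _
    · simp only [freeAct_cls]
      exact A.freePhi_cls _ _
    · simp only [freeVal_cls]
    · exact (A.freePhi_cls _ _).symm

end PsAlg

/-! ### Restriction to objects, and strict actions as strict algebras -/

namespace ICat

variable {V : Type u} [Category.{v} V] [HasFiniteLimits V]

/-- The functor from the discrete internal category on the objects of `X`. -/
noncomputable def discOb (X : ICat V) : disc X.Ob ⟶ X := ofOb (𝟙 X.Ob)

theorem discOb_obj_comp (X : ICat V) {Z : V} (f : X.Ob ⟶ Z) :
    Fun.obj X.discOb ≫ f = f := Category.id_comp f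

theorem discOb_comp_obj {X Y : ICat V} (F : X ⟶ Y) : Fun.obj (X.discOb ≫ F) = F.obj :=
  Category.id_comp F.obj

theorem discMap_discOb {X Y : ICat V} (H : Y ⟶ X) :
    ofOb (C := disc X.Ob) H.obj ≫ X.discOb = Y.discOb ≫ H :=
  disc_hom_ext ((Category.comp_id _).trans (Category.id_comp _).symm)

theorem trans_eqToIso_hom_app {X Y : ICat V} {F G H : X ⟶ Y} (α : F ≅ G) (h : G = H) :
    (α ≪≫ eqToIso h).hom.app = α.hom.app := by
  subst h
  simp

end ICat

namespace ActionData

variable {V : Type u} [Category.{v} V] [HasFiniteLimits V] {O : ReducedOperad V}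

/-- The isomorphism `θₙ(id; α₁, …, αₙ)`. -/
noncomputable def act₂Iso (A : ActionData O) {X : ICat V} {n : ℕ} (o : X ⟶ O.obj n)
    {a b : Fin n → (X ⟶ A.carrier)} (α : ∀ i, a i ≅ b i) : A.act o a ≅ A.act o b where
  hom := A.act₂ o fun i => (α i).hom
  inv := A.act₂ o fun i => (α i).inv
  hom_inv_id := by
    rw [← act₂_comp]
    obtain ⟨_, h⟩ := A.act₂_isIdentity o (fun i => (α i).hom ≫ (α i).inv)
      fun i => ⟨rfl, (α i).hom_inv_id⟩
    exact h
  inv_hom_id := by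
    rw [← act₂_comp]
    obtain ⟨_, h⟩ := A.act₂_isIdentity o (fun i => (α i).inv ≫ (α i).hom)
      fun i => ⟨rfl, (α i).inv_hom_id⟩
    exact h

theorem act_comp_obj (A : ActionData O) {X : ICat V} {n : ℕ} (o : X ⟶ O.obj n)
    (a : Fin n → (X ⟶ A.carrier)) :
    (A.act (X.discOb ≫ o) fun i => X.discOb ≫ a i).obj = (A.act o a).obj :=
  (congrArg ICat.Fun.obj (A.precomp_act X.discOb o a)).symm.trans (ICat.discOb_comp_obj _)

variable (B : ActionData O)
  (act_comp : ∀ {X : ICat V} {n : ℕ} {m : Fin n → ℕ} (o : X ⟶ O.obj n)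
    (p : ∀ r, X ⟶ O.obj (m r)) (a : ∀ r, Fin (m r) → (X ⟶ B.carrier)),
    B.act o (fun r => B.act (p r) (a r)) = B.act (O.comp o p) (flatten a))

/-- An associative action, with identities as composition isomorphisms. -/
noncomputable abbrev toPsAlgData : PsAlgData O where
  toActionData := B
  φ _ := eqToIso (act_comp _ _ _)

theorem toPsAlgData_phiAt {X : ICat V} {n : ℕ} {m : Fin n → ℕ} (o : X ⟶ O.obj n)
    (p : ∀ r, X ⟶ O.obj (m r)) (a : ∀ r, Fin (m r) → (X ⟶ B.carrier)) :
    IsIdentity₂ ((B.toPsAlgData act_comp).phiAt o p a).hom := by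
  have h := congrArg (fun t => (PsAlgData.phiLift (B.toPsAlgData act_comp) o p a).obj ≫ t)
    (ICat.eqToHom_app (act_comp (X := phiDomain O B.carrier m) ICat.fst
      (fun r => ICat.snd ≫ ICat.proj r ≫ ICat.fst)
      (fun r s => ICat.snd ≫ ICat.proj r ≫ ICat.snd ≫ ICat.proj s)))
  exact ICat.isIdentity₂_of_app _ _ (((B.toPsAlgData act_comp).phiAt_app o p a).trans
    (h.trans (Category.assoc _ _ _).symm))

theorem toPsAlgData_phiAt_app {X : ICat V} {n : ℕ} {m : Fin n → ℕ} (o : X ⟶ O.obj n)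
    (p : ∀ r, X ⟶ O.obj (m r)) (a : ∀ r, Fin (m r) → (X ⟶ B.carrier)) :
    ((B.toPsAlgData act_comp).phiAt o p a).hom.app =
      (B.act o (fun r => B.act (p r) (a r))).obj ≫ B.carrier.ident :=
  (ICat.isIdentity₂_iff _).mp (B.toPsAlgData_phiAt act_comp o p a)

/-- A strictly associative, unital and symmetric action as a strict algebra. -/
noncomputable abbrev toAlgSt
    (act_perm : ∀ {X : ICat V} {n : ℕ} (ρ : Equiv.Perm (Fin n)) (o : X ⟶ O.obj n)
      (a : Fin n → (X ⟶ B.carrier)), B.act (o ≫ O.perm ρ) (fun i => a (ρ i)) = B.act o a)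
    (act_unit : ∀ {X : ICat V} (a : X ⟶ B.carrier), B.act (O.unit X) (fun _ : Fin 1 => a) = a) :
    AlgSt O where
  alg :=
    { toPsAlgData := B.toPsAlgData act_comp
      act_perm := act_perm
      phi_degen := fun _ _ _ => B.toPsAlgData_phiAt act_comp _ _ _
      act_unit := act_unit
      phi_perm := fun ρ o p a => by
        refine (B.toPsAlgData_phiAt_app act_comp _ _ _).trans
          (Eq.trans ?_ (B.toPsAlgData_phiAt_app act_comp _ _ _).symm)
        exact congrArg (fun t => ICat.Fun.obj t ≫ B.carrier.ident)
          (act_perm ρ o fun r => B.act (p r) (a r))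
      phi_perm_inner := fun τ o p a => by
        refine (B.toPsAlgData_phiAt_app act_comp _ _ _).trans
          (Eq.trans ?_ (B.toPsAlgData_phiAt_app act_comp _ _ _).symm)
        exact congrArg (fun t => ICat.Fun.obj (B.act o t) ≫ B.carrier.ident)
          (funext fun r => act_perm (τ r) (p r) (a r))
      phi_unit_left := fun _ _ => B.toPsAlgData_phiAt act_comp _ _ _
      phi_unit_right := fun _ _ => B.toPsAlgData_phiAt act_comp _ _ _
      phi_assoc := fun o p q a => by
        have h := (ICat.isIdentity₂_iff _).mp (B.act₂_isIdentity o _ fun r =>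
          B.toPsAlgData_phiAt act_comp (p r) (q r) (a r))
        refine (ICat.cmp_congr _ rfl (B.toPsAlgData_phiAt_app act_comp _ _ _)).trans ?_
        refine (ICat.cmp_ident _ _ _ _).trans (Eq.trans ?_ (ICat.cmp_congr _ h rfl).symm)
        refine Eq.trans ?_ (ICat.ident_cmp _ _ _ _).symm
        refine (B.toPsAlgData_phiAt_app act_comp _ _ _).trans
          (Eq.trans ?_ (B.toPsAlgData_phiAt_app act_comp _ _ _).symm)
        exact congrArg (fun t => ICat.Fun.obj (B.act o t) ≫ B.carrier.ident)
          (funext fun r => act_comp (p r) (q r) (a r)) }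
  isStrict _ := ⟨act_comp _ _ _, rfl⟩

end ActionData

namespace PsAlg

open Word

variable {V : Type u} [Category.{v} V] [HasFiniteLimits V] {O : ReducedOperad V} (A : PsAlg O)
  [HasColimitsOfSize.{0, 0} V] [ProdPreservesConnectedColimits V]

/-! ### Strictification of a pseudoalgebra -/

/-- The underlying internal category of the strictification: the objects are classes of words, the
morphisms are the morphisms of `A` between their values. -/
noncomputable def stCarrier : ICat V := A.carrier.induced A.freeEval

/-- The evaluation functor. -/
noncomputable def stEval : A.stCarrier ⟶ A.carrier := A.carrier.inducedFun A.freeEval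

section

variable {A} {X Y : ICat V} {n : ℕ}

theorem stCarrier_hom_ext {F G : X ⟶ A.stCarrier} (h₀ : F.obj = G.obj)
    (h : F ≫ A.stEval = G ≫ A.stEval) : F = G :=
  ICat.induced_hom_ext h₀ h

theorem discOb_comp_stEval (a : X ⟶ A.stCarrier) :
    X.discOb ≫ a ≫ A.stEval = A.freeVal a.obj :=
  ICat.disc_hom_ext (ICat.discOb_comp_obj (a ≫ A.stEval))

/-- The isomorphisms `θ(o; ε a) ≅ ε (o · a)`. -/
noncomputable def stFam (o : X ⟶ O.obj n) (a : Fin n → (X ⟶ A.stCarrier)) :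
    ICat.IsoFam A.carrier X.Ob :=
  A.freePhiFam (X.discOb ≫ o) (fun i => (a i).obj)

theorem stFam_src (o : X ⟶ O.obj n) (a : Fin n → (X ⟶ A.stCarrier)) :
    (stFam o a).hom ≫ A.carrier.src = (A.act o (fun i => a i ≫ A.stEval)).obj := by
  refine (A.freePhi_src _ _).trans (Eq.trans ?_ (A.act_comp_obj o fun i => a i ≫ A.stEval))
  exact congrArg (fun t => ICat.Fun.obj (A.act (X.discOb ≫ o) t))
    (funext fun i => (discOb_comp_stEval (a i)).symm)

theorem stFam_tgt (o : X ⟶ O.obj n) (a : Fin n → (X ⟶ A.stCarrier)) :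
    (stFam o a).hom ≫ A.carrier.tgt =
      A.freeAct (X.discOb ≫ o) (fun i => (a i).obj) ≫ A.stEval.obj :=
  A.freePhi_tgt _ _

end

/-- The action on the strictification. -/
noncomputable abbrev stAction : ActionData O where
  carrier := A.stCarrier
  -- On objects this is the action on classes. On morphisms it is θ conjugated by φ, so that its
  -- value in A runs between the values ε(o · s) of the acted classes rather than between the θ(o; ε
  -- s).
  θ n := ICat.inducedLift (e := A.freeEval)
    (ICat.conj (A.act ICat.fst fun i => (ICat.snd ≫ ICat.proj i) ≫ A.stEval)
      (stFam (X := ICat.times (O.obj n) (ICat.pi fun _ : Fin n => A.stCarrier)) ICat.fst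
        fun i => ICat.snd ≫ ICat.proj i)
      (stFam_src _ _)) _ (stFam_tgt _ _)

/-- The isomorphisms `θ(o; ε a) ≅ ε (o · a)` as isomorphisms of functors. -/
noncomputable def stZeta (n : ℕ) :
    A.act (X := ICat.times (O.obj n) (ICat.pi fun _ : Fin n => A.stCarrier)) ICat.fst
      (fun i => (ICat.snd ≫ ICat.proj i) ≫ A.stEval) ≅ A.stAction.θ n ≫ A.stEval :=
  ICat.conjIso _ (stFam ICat.fst fun i => ICat.snd ≫ ICat.proj i) (stFam_src _ _) ≪≫
    eqToIso (ICat.inducedLift_comp _ _ (stFam_tgt _ _)).symm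

variable {X : ICat V} {n : ℕ}

theorem lift_discOb_fst (o : X ⟶ O.obj n) (a : Fin n → (X ⟶ A.stCarrier)) :
    discMap (ICat.Fun.obj (ICat.lift o (ICat.piLift a))) ≫ ICat.discOb _ ≫ ICat.fst =
      X.discOb ≫ o := by
  rw [← Category.assoc, ICat.discMap_discOb, Category.assoc, ICat.lift_fst]

theorem lift_obj_snd_proj (o : X ⟶ O.obj n) (a : Fin n → (X ⟶ A.stCarrier)) (i : Fin n) :
    ICat.Fun.obj (ICat.lift o (ICat.piLift a)) ≫
      ICat.Fun.obj (ICat.snd ≫ ICat.proj i) = (a i).obj := by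
  refine congrArg ICat.Fun.obj (?_ : ICat.lift o (ICat.piLift a) ≫ ICat.snd ≫ ICat.proj i = a i)
  rw [← Category.assoc, ICat.lift_snd, ICat.piLift_proj]

theorem stAction_act_obj (o : X ⟶ O.obj n) (a : Fin n → (X ⟶ A.stCarrier)) :
    (A.stAction.act o a).obj = A.freeAct (X.discOb ≫ o) (fun i => (a i).obj) := by
  refine (A.precomp_freeAct _ _ _).trans ?_
  exact congrArg₂ A.freeAct (A.lift_discOb_fst o a) (funext (A.lift_obj_snd_proj o a))

theorem stZeta_app (n : ℕ) : (A.stZeta n).hom.app =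
    A.freePhi (ICat.discOb _ ≫ ICat.fst) (fun i => ICat.Fun.obj (ICat.snd ≫ ICat.proj i)) := by
  exact ICat.trans_eqToIso_hom_app (ICat.conjIso _ (stFam ICat.fst fun i => ICat.snd ≫ ICat.proj i)
    (stFam_src _ _)) _

theorem precomp_stZeta_app (o : X ⟶ O.obj n) (a : Fin n → (X ⟶ A.stCarrier)) :
    ICat.Fun.obj (ICat.lift o (ICat.piLift a)) ≫ (A.stZeta n).hom.app =
      A.freePhi (X.discOb ≫ o) (fun i => (a i).obj) := by
  rw [stZeta_app]
  refine (A.precomp_freePhi _ _ _).trans ?_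
  exact congrArg₂ A.freePhi (A.lift_discOb_fst o a) (funext (A.lift_obj_snd_proj o a))

/-- The isomorphisms `θ(o; ε a) ≅ ε (o · a)` at generalized elements. -/
noncomputable def stZetaAt (o : X ⟶ O.obj n) (a : Fin n → (X ⟶ A.stCarrier)) :
    A.act o (fun i => a i ≫ A.stEval) ≅ A.stAction.act o a ≫ A.stEval :=
  eqToIso (by
      rw [ActionData.precomp_act]
      simp only [← Category.assoc, ICat.lift_fst, ICat.lift_snd, ICat.piLift_proj]) ≪≫
    whiskerLeftIso (ICat.lift o (ICat.piLift a)) (A.stZeta n) ≪≫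
    eqToIso (by rw [ActionData.act, Category.assoc])

theorem stZetaAt_app (o : X ⟶ O.obj n) (a : Fin n → (X ⟶ A.stCarrier)) :
    (A.stZetaAt o a).hom.app = A.freePhi (X.discOb ≫ o) (fun i => (a i).obj) := by
  rw [← precomp_stZeta_app]
  simp [stZetaAt]

/-- On objects this is an identity of classes. After evaluation, both sides are transports of the
same functor, by equivariance of θ, along isomorphisms with the same components. -/
theorem stAction_perm (ρ : Equiv.Perm (Fin n)) (o : X ⟶ O.obj n)
    (a : Fin n → (X ⟶ A.stCarrier)) :
    A.stAction.act (o ≫ O.perm ρ) (fun i => a (ρ i)) = A.stAction.act o a := by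
  refine stCarrier_hom_ext ?_ ?_
  · rw [stAction_act_obj, stAction_act_obj, ← Category.assoc]
    exact A.freeAct_perm ρ (X.discOb ≫ o) fun i => (a i).obj
  · refine ICat.eq_of_iso_from (A.stZetaAt (o ≫ O.perm ρ) (fun i => a (ρ i)))
      (A.stZetaAt o a).hom (A.act_perm ρ o fun i => a i ≫ A.stEval) ?_
    rw [stZetaAt_app, stZetaAt_app, ← Category.assoc]
    exact A.freePhi_perm ρ (X.discOb ≫ o) fun i => (a i).obj

theorem stAction_unit (a : X ⟶ A.stCarrier) :
    A.stAction.act (O.unit X) (fun _ : Fin 1 => a) = a := by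
  refine stCarrier_hom_ext ?_ ?_
  · rw [stAction_act_obj, Word.precomp_unit]
    exact A.freeAct_unit a.obj
  · refine ICat.eq_of_iso_from (A.stZetaAt (O.unit X) (fun _ : Fin 1 => a))
      (𝟙 (a ≫ A.stEval)) (A.act_unit (a ≫ A.stEval)) ?_
    rw [stZetaAt_app, Word.precomp_unit]
    exact A.freePhi_unit a.obj

/-- Components of transformations depend only on objects, so the identity `freePhi_comp` over the
discrete category on X.Ob is all that is needed. -/
theorem stZetaAt_comp {m : Fin n → ℕ} (o : X ⟶ O.obj n) (p : ∀ r, X ⟶ O.obj (m r))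
    (a : ∀ r, Fin (m r) → (X ⟶ A.stCarrier)) :
    (A.act₂ o (fun r => (A.stZetaAt (p r) (a r)).hom) ≫
      (A.stZetaAt o (fun r => A.stAction.act (p r) (a r))).hom).app =
    ((A.phiAt o p (fun r s => a r s ≫ A.stEval)).hom ≫
      (A.stZetaAt (O.comp o p) (flatten a)).hom).app := by
  have h := A.freePhi_comp (X.discOb ≫ o) (fun r => X.discOb ≫ p r) (fun r s => (a r s).obj)
  refine Eq.trans (ICat.cmp_congr _ ?_ ?_) (h.trans (ICat.cmp_congr _ ?_ ?_))
  · refine (ICat.discOb_obj_comp X _).symm.trans ?_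
    exact ActionData.precomp_act₂_app X.discOb o _ _ fun r =>
      (ICat.discOb_obj_comp X _).trans (A.stZetaAt_app _ _)
  · refine (A.stZetaAt_app _ _).trans ?_
    exact congrArg (A.freePhi (X.discOb ≫ o)) (funext fun r => A.stAction_act_obj _ _)
  · refine Eq.trans ?_ ((A.phi_precomp X.discOb o fun r => ⟨m r, p r, fun s => a r s ≫ A.stEval⟩
      ).symm.trans (ICat.discOb_obj_comp X _))
    refine congrArg (A.phi (X.discOb ≫ o)) (funext fun r => ?_)
    refine congrArg (fun t => (⟨m r, X.discOb ≫ p r, t⟩ : Word O A.carrier _)) (funext fun s => ?_)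
    exact (discOb_comp_stEval _).symm
  · refine Eq.trans ?_ (A.stZetaAt_app (O.comp o p) (flatten a)).symm
    exact congrArg (fun t => A.freePhi t (flatten fun r s => (a r s).obj))
      (O.precomp_comp X.discOb o p).symm

/-- After evaluation, both sides are isomorphic to θ(o; θ(p; ε a)), once in two steps and once via φ
of A in a single step. The components agree by the coherence of φ, so the two functors are equal. -/
theorem stAction_comp {m : Fin n → ℕ} (o : X ⟶ O.obj n) (p : ∀ r, X ⟶ O.obj (m r))
    (a : ∀ r, Fin (m r) → (X ⟶ A.stCarrier)) :
    A.stAction.act o (fun r => A.stAction.act (p r) (a r)) =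
      A.stAction.act (O.comp o p) (flatten a) := by
  refine stCarrier_hom_ext ?_ ?_
  · rw [stAction_act_obj, stAction_act_obj, O.precomp_comp]
    simp only [stAction_act_obj]
    exact A.freeAct_comp _ _ _
  · exact ICat.eq_of_iso_from (A.act₂Iso o (fun r => A.stZetaAt (p r) (a r)) ≪≫
      A.stZetaAt o (fun r => A.stAction.act (p r) (a r))) _ rfl (A.stZetaAt_comp o p a)

/-- The strictification of a pseudoalgebra. -/
noncomputable abbrev st : AlgSt O :=
  A.stAction.toAlgSt A.stAction_comp A.stAction_perm A.stAction_unit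

end PsAlg

namespace ICat

variable {V : Type u} [Category.{v} V] [HasFiniteLimits V] {X Y : ICat V} {F F' G G' : X ⟶ Y}

/-- A transformation with its source and target replaced by equal functors. -/
noncomputable def castTrans (α : F ⟶ G) (hF : F = F') (hG : G = G') : F' ⟶ G' :=
  eqToHom hF.symm ≫ α ≫ eqToHom hG

theorem castTrans_app (α : F ⟶ G) (hF : F = F') (hG : G = G') :
    (castTrans α hF hG).app = α.app := by
  subst hF hG
  simp [castTrans]

end ICat

namespace PsAlg

variable {V : Type u} [Category.{v} V] [HasFiniteLimits V] {O : ReducedOperad V}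

/-- Algebra 2-cells that are invertible as transformations are invertible. -/
noncomputable def PsCell.isoMk {A B : PsAlg O} {F G : A ⟶ B} (e : F.f ≅ G.f)
    (h : ∀ {X : ICat V} {n : ℕ} (o : X ⟶ O.obj n) (a : Fin n → (X ⟶ A.carrier)),
      B.act₂ o (fun i => a i ◁ e.hom) ≫ (G.zetaAt o a).hom =
        (F.zetaAt o a).hom ≫ A.act o a ◁ e.hom) : F ≅ G where
  hom := PsCell.mk e.hom h
  inv := PsCell.mk e.inv fun o a => by
    have h₁ : B.act₂ o (fun i => a i ◁ e.inv) ≫ B.act₂ o (fun i => a i ◁ e.hom) = 𝟙 _ :=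
      (B.act₂Iso o fun i => whiskerLeftIso (a i) e).inv_hom_id
    have h₂ : A.act o a ◁ e.hom ≫ A.act o a ◁ e.inv = 𝟙 _ :=
      (whiskerLeftIso (A.act o a) e).hom_inv_id
    calc B.act₂ o (fun i => a i ◁ e.inv) ≫ (F.zetaAt o a).hom
        = B.act₂ o (fun i => a i ◁ e.inv) ≫
            ((F.zetaAt o a).hom ≫ A.act o a ◁ e.hom) ≫ A.act o a ◁ e.inv := by
          rw [Category.assoc, h₂, Category.comp_id]
      _ = (B.act₂ o (fun i => a i ◁ e.inv) ≫ B.act₂ o (fun i => a i ◁ e.hom)) ≫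
            (G.zetaAt o a).hom ≫ A.act o a ◁ e.inv := by
          rw [← h, Category.assoc, Category.assoc]
      _ = (G.zetaAt o a).hom ≫ A.act o a ◁ e.inv := by rw [h₁, Category.id_comp]
  hom_inv_id := PsCell.ext_app (congrArg ICat.Trans.app e.hom_inv_id)
  inv_hom_id := PsCell.ext_app (congrArg ICat.Trans.app e.inv_hom_id)

open Word

variable (A : PsAlg O) [HasColimitsOfSize.{0, 0} V] [ProdPreservesConnectedColimits V]

/-! ### The evaluation pseudomorphism -/

/-- On one-letter words φ is φ(o; 1, …, 1), an identity by `phi_unit_right`. -/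
theorem freePhi_cls_unit {X : V} {n : ℕ} (o : ICat.disc X ⟶ O.obj n)
    (a : Fin n → (ICat.disc X ⟶ A.carrier)) :
    A.freePhi o (fun i => A.cls (Word.unit (a i))) = (A.act o a).obj ≫ A.carrier.ident :=
  (A.freePhi_cls o _).trans (A.phi_comp_unit o a)

/-- The data of the evaluation pseudomorphism. -/
noncomputable abbrev stEvalData : PsMorData A.st.alg A where
  f := A.stEval
  ζ := A.stZeta

theorem stEvalData_zetaAt_app {X : ICat V} {n : ℕ} (o : X ⟶ O.obj n)
    (a : Fin n → (X ⟶ A.stCarrier)) :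
    (A.stEvalData.zetaAt o a).hom.app = A.freePhi (X.discOb ≫ o) (fun i => (a i).obj) :=
  A.stZetaAt_app o a

theorem st_phiAt_app {X : ICat V} {n : ℕ} {m : Fin n → ℕ} (o : X ⟶ O.obj n)
    (p : ∀ r, X ⟶ O.obj (m r)) (a : ∀ r, Fin (m r) → (X ⟶ A.stCarrier)) :
    (A.st.alg.phiAt o p a).hom.app =
      (A.stAction.act o (fun r => A.stAction.act (p r) (a r))).obj ≫ A.stCarrier.ident :=
  A.stAction.toPsAlgData_phiAt_app A.stAction_comp o p a

/-- The evaluation pseudomorphism. -/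
noncomputable def stCounit : A.st.alg ⟶ A :=
  PsMor.mk A.stEvalData
    (by
      -- The empty family of classes is in particular a family of classes of one-letter words, where
      -- φ is the identity.
      have h := (A.stZeta_app 0).trans ((congrArg (A.freePhi _) (funext fun i => Fin.elim0 i)).trans
        (A.freePhi_cls_unit _ Fin.elim0))
      exact ICat.isIdentity₂_of_app _ _ h)
    (fun {X} a => by
      have h := A.freePhi_unit a.obj
      rw [← Word.precomp_unit X.discOb] at h
      exact ICat.isIdentity₂_of_app _ _ ((A.stEvalData_zetaAt_app _ _).trans h))
    (fun {X n} ρ o a => by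
      refine (A.stEvalData_zetaAt_app _ _).trans
        (Eq.trans ?_ (A.stEvalData_zetaAt_app o a).symm)
      rw [← Category.assoc]
      exact A.freePhi_perm ρ (X.discOb ≫ o) fun i => (a i).obj)
    (fun {X n m} o p a => by
      apply ICat.trans_ext
      -- The composition isomorphisms of the strictification are identities and drop out; what is
      -- left is the coherence of φ.
      refine Eq.trans ?_ (A.stZetaAt_comp o p a)
      refine ICat.cmp_congr _ rfl ((ICat.cmp_congr _ rfl ?_).trans (ICat.cmp_ident _
        ((A.stAction.act o (fun r => A.stAction.act (p r) (a r))).obj ≫ A.stEval.obj) _ ?_))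
      · refine (congrArg (fun t => t ≫ A.stEval.mor) (A.st_phiAt_app o p a)).trans ?_
        rw [Category.assoc, ICat.Fun.ident_mor, Category.assoc]
      · refine (ICat.Trans.app_tgt _).trans ?_
        simp)

/-! ### The unit -/

/-- The functor `a ↦ (1; a)`. -/
noncomputable def stUnitFun : A.carrier ⟶ A.stCarrier :=
  ICat.inducedLift (e := A.freeEval) (𝟙 A.carrier) (A.cls (Word.unit A.carrier.discOb))
    ((congrArg ICat.Fun.obj (A.eval_unit A.carrier.discOb)).symm.trans (A.cls_freeEval _).symm)

theorem stUnitFun_stEval : A.stUnitFun ≫ A.stEval = 𝟙 A.carrier :=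
  ICat.inducedLift_comp _ _ _

theorem comp_stUnitFun_obj {X : ICat V} (a : X ⟶ A.carrier) :
    ICat.Fun.obj (a ≫ A.stUnitFun) = A.cls (Word.unit (X.discOb ≫ a)) := by
  refine (A.cls_pull _ _).symm.trans (congrArg A.cls ?_)
  rw [Word.pull_unit, ICat.discMap_discOb]

-- Evaluation is faithful, so a 2-cell over an identity is an identity once its endpoints agree as
-- classes. That hypothesis is needed because distinct classes can have the same value.
variable {A} in
theorem isIdentity₂_st {X : ICat V} {F G : X ⟶ A.stCarrier} (α : F ⟶ G) (h₀ : F.obj = G.obj)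
    (x : X.Ob ⟶ A.carrier.Ob) (h : α.app ≫ A.stEval.mor = x ≫ A.carrier.ident) :
    IsIdentity₂ α := by
  refine (ICat.isIdentity₂_iff α).mpr (ICat.induced_mor_ext ?_ ?_ ?_)
  · have h₁ := (ICat.isIdentity₂_iff _).mp (ICat.isIdentity₂_of_app (α ▷ A.stEval) x h)
    refine Eq.trans h₁ ?_
    refine Eq.trans ?_ (Category.assoc _ _ _).symm
    refine Eq.trans ?_ (congrArg (fun t => F.obj ≫ t) A.stEval.ident_mor).symm
    exact Category.assoc _ _ _
  · exact (ICat.Trans.app_src α).trans ((Category.assoc _ _ _).trans (ICat.ident_src' A.stCarrier F.obj)).symm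
  · exact (ICat.Trans.app_tgt α).trans (h₀.symm.trans ((Category.assoc _ _ _).trans
      (ICat.ident_tgt' A.stCarrier F.obj)).symm)

theorem stZetaAt_unit {X : ICat V} {n : ℕ} (o : X ⟶ O.obj n) (a : Fin n → (X ⟶ A.carrier)) :
    (A.stZetaAt o (fun i => a i ≫ A.stUnitFun)).hom.app = (A.act o a).obj ≫ A.carrier.ident := by
  refine (A.stZetaAt_app _ _).trans ?_
  refine (congrArg (A.freePhi (X.discOb ≫ o)) (funext fun i => A.comp_stUnitFun_obj (a i))).trans ?_
  refine (A.freePhi_cls_unit _ _).trans ?_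
  exact congrArg (fun t => t ≫ A.carrier.ident) (A.act_comp_obj o a)

/-- The class of (o; a) and the class of (1; θ(o; a)) have the same value, and the transport
isomorphism there is an identity. The classes themselves may differ, which is why the unit is only a
pseudomorphism. -/
theorem act_stUnitFun {X : ICat V} {n : ℕ} (o : X ⟶ O.obj n) (a : Fin n → (X ⟶ A.carrier)) :
    A.stAction.act o (fun i => a i ≫ A.stUnitFun) ≫ A.stEval = A.act o a := by
  refine (ICat.isIdentity₂_of_app _ _ (A.stZetaAt_unit o a)).1.symm.trans ?_
  refine congrArg (A.act o) (funext fun i => ?_)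
  rw [Category.assoc, stUnitFun_stEval, Category.comp_id]

theorem act_stUnitFun_proj (n : ℕ) :
    A.stAction.act (X := ICat.times (O.obj n) (ICat.pi fun _ : Fin n => A.carrier)) ICat.fst
      (fun i => (ICat.snd ≫ ICat.proj i) ≫ A.stUnitFun) ≫ A.stEval =
    (A.θ n ≫ A.stUnitFun) ≫ A.stEval := by
  refine (A.act_stUnitFun ICat.fst fun i => ICat.snd ≫ ICat.proj i).trans ?_
  rw [Category.assoc, stUnitFun_stEval, Category.comp_id]
  simpa only [Category.comp_id] using PsMor.act_id A n

/-- The data of the unit. -/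
noncomputable abbrev stUnitData : PsMorData A A.st.alg where
  f := A.stUnitFun
  -- The structure isomorphism from (o; a) to (1; θ(o; a)) is the identity of the common value θ(o;
  -- a), lifted along the fully faithful evaluation.
  ζ n := ICat.inducedIso (e := A.freeEval) (eqToIso (A.act_stUnitFun_proj n))

theorem stUnitData_zetaAt_app {X : ICat V} {n : ℕ} (o : X ⟶ O.obj n)
    (a : Fin n → (X ⟶ A.carrier)) :
    (A.stUnitData.zetaAt o a).hom.app ≫ A.stEval.mor = (A.act o a).obj ≫ A.carrier.ident := by
  have h : (A.stUnitData.ζ n).hom.app ≫ A.stEval.mor = _ :=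
    (ICat.inducedIso_hom_app_mor _).trans (ICat.eqToHom_app (A.act_stUnitFun_proj n))
  have h' := (congrArg (fun t => t ≫ A.stEval.mor) (A.stUnitData.zetaAt_app o a)).trans
    ((Category.assoc _ _ _).trans ((congrArg
      (fun t => ICat.Fun.obj (ICat.lift o (ICat.piLift a)) ≫ t) h).trans (Category.assoc _ _ _).symm))
  refine ((ICat.isIdentity₂_iff ((A.stUnitData.zetaAt o a).hom ▷ A.stEval)).mp
    (ICat.isIdentity₂_of_app _ _ h')).trans ?_
  exact congrArg (fun t => ICat.Fun.obj t ≫ A.carrier.ident) (A.act_stUnitFun o a)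

/-- Compatibility of the action with cells whose values are identities. -/
theorem act₂_stEval {X : ICat V} {n : ℕ} (o : X ⟶ O.obj n) {a : Fin n → (X ⟶ A.stCarrier)}
    {b : Fin n → (X ⟶ A.carrier)} (β : ∀ i, a i ⟶ b i ≫ A.stUnitFun)
    (hβ : ∀ i, IsIdentity₂ (β i ▷ A.stEval)) :
    (A.stAction.act₂ o β).app ≫ A.stEval.mor = (A.stZetaAt o a).inv.app := by
  -- In the naturality square of the structure isomorphism of ε, the side over A is an identity and
  -- so is the structure isomorphism at η b. The evaluated action on β is therefore forced to be
  -- inverse to the structure isomorphism at a.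
  have h := congrArg ICat.Trans.app (PsMor.zeta_natural A.stEvalData o β)
  have h₁ := (ICat.isIdentity₂_iff _).mp (A.act₂_isIdentity o _ hβ)
  have h₂ : A.carrier.cmp (A.stZetaAt o a).hom.app ((A.stAction.act₂ o β).app ≫ A.stEval.mor)
      (by rw [ICat.Trans.app_tgt]; exact (ICat.Trans.app_src (A.stAction.act₂ o β ▷ A.stEval)).symm) =
      ((A.stZetaAt o a).hom.app ≫ A.carrier.src) ≫ A.carrier.ident := by
    refine h.symm.trans ?_
    refine (ICat.cmp_congr _ h₁ (A.stZetaAt_unit o b)).trans ((ICat.cmp_ident _ _ _ _).trans ?_)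
    rw [ICat.Trans.app_src]
  refine (ICat.inv_unique ?_ _ ?_ h₂).symm
  · rw [ICat.Trans.app_tgt, ICat.Trans.app_src]
  · refine (congrArg ICat.Trans.app (A.stZetaAt o a).inv_hom_id).trans ?_
    rw [ICat.Trans.app_tgt]
    rfl

theorem isIdentity₂_act₂_stEval {X : ICat V} {n : ℕ} (o : X ⟶ O.obj n)
    {a : Fin n → (X ⟶ A.stCarrier)}
    {b : Fin n → (X ⟶ A.carrier)} (β : ∀ i, a i ⟶ b i ≫ A.stUnitFun)
    (hβ : ∀ i, IsIdentity₂ (β i ▷ A.stEval))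
    (h : ((A.stAction.act₂ o β).app ≫ A.stEval.mor) ≫ A.carrier.tgt =
      (A.stZetaAt o a).hom.app ≫ A.carrier.src) :
    A.carrier.cmp ((A.stAction.act₂ o β).app ≫ A.stEval.mor) (A.stZetaAt o a).hom.app h =
      (ICat.Fun.obj (A.stAction.act o a ≫ A.stEval)) ≫ A.carrier.ident := by
  refine (ICat.cmp_congr _ (A.act₂_stEval o β hβ) rfl).trans ?_
  exact congrArg ICat.Trans.app (A.stZetaAt o a).inv_hom_id

/-- Since O(0) is trivial, the empty word is (0;). It arises from the one-letter word on the base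
point by omitting its argument, using γ(1; 0) = 0. Hence η preserves the base point strictly. -/
theorem cls_zero {X : V} (o : ICat.disc X ⟶ O.obj 0) (a : Fin 0 → (ICat.disc X ⟶ A.carrier)) :
    A.cls ⟨0, o, a⟩ = A.cls (Word.unit (A.act o a)) := by
  have ho : o = ICat.toTerminal _ ≫ O.zero.hom := by
    have h : o ≫ O.zero.inv = ICat.toTerminal _ := by
      apply ICat.hom_ext <;> exact Subsingleton.elim (α := _ ⟶ ⊤_ V) _ _
    rw [← h, Category.assoc, Iso.inv_hom_id, Category.comp_id]
  have hw : (⟨0, o, a⟩ : Word O A.carrier (ICat.disc X)) = Word.zero O A.carrier _ := by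
    subst ho
    exact Word.ext_cast rfl (Category.comp_id _) fun i => Fin.elim0 i
  have he : A.act o a = A.eval (Word.zero O A.carrier _) := congrArg A.eval hw
  rw [hw, he]
  refine Rel.cls_eq (Or.inr ⟨(0 : Fin 1), fun _ => A.eval (Word.zero O A.carrier _), ?_, ?_⟩)
  · intro i
    obtain rfl : i = (0 : Fin 1) := Subsingleton.elim (α := Fin 1) _ _
    exact congrArg A.eval (Word.degen_self _ _).symm
  · refine (Word.unit_comp _).symm.trans (congrArg (Word.comp (O.unit _)) (funext fun i => ?_))
    obtain rfl : i = (0 : Fin 1) := Subsingleton.elim (α := Fin 1) _ _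
    exact (Word.degen_self _ _).symm

theorem act_stUnitFun_obj {X : ICat V} {n : ℕ} (o : X ⟶ O.obj n) (a : Fin n → (X ⟶ A.carrier)) :
    ICat.Fun.obj (A.stAction.act o (fun i => a i ≫ A.stUnitFun)) =
      A.cls ⟨n, X.discOb ≫ o, fun i => X.discOb ≫ a i⟩ := by
  refine (A.stAction_act_obj _ _).trans ?_
  refine (congrArg (A.freeAct (X.discOb ≫ o)) (funext fun i => A.comp_stUnitFun_obj (a i))).trans ?_
  exact (A.freeAct_cls _ _).trans (congrArg A.cls (Word.comp_unit _ _))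

theorem stZetaAt_act_unit {X : ICat V} {n : ℕ} {m : Fin n → ℕ} (o : X ⟶ O.obj n)
    (p : ∀ r, X ⟶ O.obj (m r)) (a : ∀ r, Fin (m r) → (X ⟶ A.carrier)) :
    (A.stZetaAt o (fun r => A.stAction.act (p r) (fun s => a r s ≫ A.stUnitFun))).hom.app =
      (A.phiAt o p a).hom.app := by
  refine (A.stZetaAt_app _ _).trans ?_
  refine (congrArg (A.freePhi (X.discOb ≫ o))
    (funext fun r => A.act_stUnitFun_obj (p r) (a r))).trans ((A.freePhi_cls _ _).trans ?_)
  exact (A.phi_precomp X.discOb o fun r => ⟨m r, p r, a r⟩).symm.trans (ICat.discOb_obj_comp X _)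

/-- The unit of the strictification. -/
noncomputable def stUnit : A ⟶ A.st.alg :=
  PsMor.mk A.stUnitData
    (by
      have h : (A.stUnitData.ζ 0).hom.app ≫ A.stEval.mor = _ :=
        (ICat.inducedIso_hom_app_mor _).trans (ICat.eqToHom_app (A.act_stUnitFun_proj 0))
      refine isIdentity₂_st _ ?_ _ h
      -- For n = 0 the endpoints (0;) and (1; θ₀) are the same class, so the lifted identity is
      -- itself an identity.
      refine (A.act_stUnitFun_obj _ _).trans ((A.cls_zero _ _).trans ?_)
      refine Eq.trans ?_ (A.comp_stUnitFun_obj (A.θ 0)).symm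
      refine congrArg (fun t => A.cls (Word.unit t)) ((A.precomp_act _ _ _).symm.trans ?_)
      refine congrArg (fun t => ICat.discOb _ ≫ t) ?_
      simpa only [Category.comp_id] using PsMor.act_id A 0)
    (fun {X} a => by
      refine isIdentity₂_st _ ?_ _ (A.stUnitData_zetaAt_app _ _)
      refine congrArg ICat.Fun.obj ((A.stAction_unit (a ≫ A.stUnitFun)).trans ?_)
      exact congrArg (fun t => t ≫ A.stUnitFun) (A.act_unit a).symm)
    (fun {X n} ρ o a => by
      refine ICat.induced_mor_ext ?_ ?_ ?_
      · refine (A.stUnitData_zetaAt_app _ _).trans (Eq.trans ?_ (A.stUnitData_zetaAt_app _ _).symm)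
        rw [A.act_perm]
      · refine (ICat.Trans.app_src _).trans (Eq.trans ?_ (ICat.Trans.app_src _).symm)
        exact congrArg ICat.Fun.obj (A.stAction_perm ρ o fun i => a i ≫ A.stUnitFun)
      · refine (ICat.Trans.app_tgt _).trans (Eq.trans ?_ (ICat.Trans.app_tgt _).symm)
        exact congrArg (fun t => ICat.Fun.obj (t ≫ A.stUnitFun)) (A.act_perm ρ o a))
    (fun {X n m} o p a => by
      -- After evaluation the structure isomorphisms of η become identities. On the left, the action
      -- on the inner ones evaluates to the inverse of the transport isomorphism at the inner words,
      -- which is φ of A there; it cancels against the image of φ.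
      refine ICat.induced_trans_ext ?_
      have h₁ : ((A.phiAt o p a).hom.app ≫ A.stUnitFun.mor) ≫ A.stEval.mor =
          (A.stZetaAt o (fun r => A.stAction.act (p r) (fun s => a r s ≫ A.stUnitFun))).hom.app :=
        (Category.assoc _ _ _).trans ((congrArg (fun t => (A.phiAt o p a).hom.app ≫ t)
          (congrArg ICat.Fun.mor A.stUnitFun_stEval)).trans ((Category.comp_id _).trans
            (A.stZetaAt_act_unit o p a).symm))
      refine (ICat.cmp_mor A.stEval _ _ _).trans
        (Eq.trans ?_ (ICat.cmp_mor A.stEval _ _ _).symm)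
      refine (ICat.cmp_congr _ rfl ((ICat.cmp_mor A.stEval _ _ _).trans ((ICat.cmp_congr _
        (A.stUnitData_zetaAt_app o fun r => A.act (p r) (a r)) h₁).trans
          (ICat.ident_cmp _ _ _ _)))).trans ?_
      refine (A.isIdentity₂_act₂_stEval o (fun r => (A.stUnitData.zetaAt (p r) (a r)).hom)
        (fun r => ICat.isIdentity₂_of_app _ _ (A.stUnitData_zetaAt_app (p r) (a r))) _).trans ?_
      refine Eq.trans ?_ ((ICat.cmp_congr _ rfl (A.stUnitData_zetaAt_app _ _)).trans
        (ICat.cmp_ident _ _ _ _)).symm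
      refine Eq.trans ?_ (congrArg (fun t => t ≫ A.stEval.mor) (A.st_phiAt_app o p _)).symm
      refine Eq.trans ?_ (Category.assoc _ _ _).symm
      exact (Category.assoc _ _ _).trans (congrArg (fun t => _ ≫ t) A.stEval.ident_mor.symm))

/-! ### The unit and the evaluation are inverse up to isomorphism -/

theorem stUnit_zetaAt_app {X : ICat V} {n : ℕ} (o : X ⟶ O.obj n) (a : Fin n → (X ⟶ A.carrier)) :
    (A.stUnit.zetaAt o a).hom.app ≫ A.stEval.mor = (A.act o a).obj ≫ A.carrier.ident :=
  A.stUnitData_zetaAt_app o a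

/-- This composite is strictly the identity: φ at one-letter words is an identity, and the structure
isomorphisms of the unit lie over identities. -/
theorem stUnit_stCounit : A.stUnit ≫ A.stCounit = 𝟙 A := by
  refine PsMor.ext_app A.stUnitFun_stEval fun n => ?_
  refine (PsMor.compData_zeta_app _ _ _).trans ?_
  have h₁ : (A.stUnitData.ζ n).hom.app ≫ A.stEval.mor = _ :=
    (ICat.inducedIso_hom_app_mor _).trans (ICat.eqToHom_app (A.act_stUnitFun_proj n))
  refine (ICat.cmp_congr _ (A.stZetaAt_unit _ _) h₁).trans ((ICat.cmp_ident _ _ _ _).trans ?_)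
  refine Eq.trans ?_ (ICat.eqToHom_app (PsMor.act_id A n)).symm
  simp only [Category.comp_id]

theorem stEval_stUnitFun_stEval :
    𝟙 A.stCarrier ≫ A.stEval = (A.stEval ≫ A.stUnitFun) ≫ A.stEval := by
  rw [Category.id_comp, Category.assoc, stUnitFun_stEval, Category.comp_id]

/-- The functor into the strictification is isomorphic to the unit at its value. -/
noncomputable def stFunIso : 𝟙 A.stCarrier ≅ A.stEval ≫ A.stUnitFun :=
  ICat.inducedIso (e := A.freeEval) (eqToIso A.stEval_stUnitFun_stEval)

theorem stFunIso_app : A.stFunIso.hom.app ≫ A.stEval.mor = A.stEval.obj ≫ A.carrier.ident := by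
  refine (ICat.inducedIso_hom_app_mor _).trans
    ((ICat.eqToHom_app A.stEval_stUnitFun_stEval).trans ?_)
  exact congrArg (fun t => t ≫ A.carrier.ident) (Category.id_comp _)

/-- Every class of words is isomorphic to its value. -/
noncomputable def stIso : 𝟙 A.st.alg ≅ A.stCounit ≫ A.stUnit :=
  PsCell.isoMk (F := 𝟙 A.st.alg) (G := A.stCounit ≫ A.stUnit) A.stFunIso
    (fun {X n} o a => by
      refine ICat.induced_trans_ext ?_
      have h₁ : ∀ (Y : ICat V) (b : Y ⟶ A.stCarrier),
          (b ◁ A.stFunIso.hom).app ≫ A.stEval.mor = (b ≫ A.stEval).obj ≫ A.carrier.ident :=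
        fun Y b => (Category.assoc _ _ _).trans ((congrArg (fun t => b.obj ≫ t)
          A.stFunIso_app).trans (Category.assoc _ _ _).symm)
      refine (ICat.cmp_mor A.stEval _ _ _).trans
        (Eq.trans ?_ (ICat.cmp_mor A.stEval _ _ _).symm)
      refine Eq.trans ?_ ((ICat.cmp_congr _ rfl (h₁ X (A.stAction.act o a))).trans
        ((ICat.cmp_ident _ _ _ _).trans (congrArg (fun t => t ≫ A.stEval.mor)
          (PsMor.idData_zetaAt_app A.st.alg o a)))).symm
      -- The unit contributes only an identity after evaluation, so the structure isomorphism of ηε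
      -- evaluates to that of ε. It cancels against the action on the components of 1 ≅ ηε, which
      -- lie over identities.
      have h₂ : ((A.stCounit ≫ A.stUnit).zetaAt o a).hom.app ≫ A.stEval.mor =
          (A.stZetaAt o a).hom.app := by
        refine (congrArg (fun t => t ≫ A.stEval.mor) (PsMor.compData_zetaAt_app
          A.stCounit.toPsMorData A.stUnit.toPsMorData o a)).trans ?_
        refine (ICat.cmp_mor A.stEval _ _ _).trans ?_
        refine (ICat.cmp_congr _ (A.stUnit_zetaAt_app _ _) ?_).trans (ICat.ident_cmp _ _ _ _)
        refine (Category.assoc _ _ _).trans ((congrArg (fun t => _ ≫ t)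
          (congrArg ICat.Fun.mor A.stUnitFun_stEval)).trans (Category.comp_id _))
      let β : ∀ i, a i ⟶ (a i ≫ A.stEval) ≫ A.stUnitFun := fun i =>
        ICat.castTrans (a i ◁ A.stFunIso.hom) (Category.comp_id _) (Category.assoc _ _ _).symm
      have hβ : ∀ i, (a i ◁ A.stFunIso.hom).app = (β i).app := fun i =>
        (ICat.castTrans_app _ _ _).symm
      refine (ICat.cmp_congr _ (congrArg (fun t => t ≫ A.stEval.mor)
        (ActionData.act₂_app_congr rfl _ β hβ)) h₂).trans ?_
      refine (A.isIdentity₂_act₂_stEval o β (fun i => ICat.isIdentity₂_of_app (β i ▷ A.stEval) _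
        ((congrArg (fun t => t ≫ A.stEval.mor) (hβ i)).symm.trans (h₁ X (a i)))) _).trans ?_
      refine Eq.trans ?_ (Category.assoc _ _ _).symm
      exact (Category.assoc _ _ _).trans (congrArg (fun t => _ ≫ t) A.stEval.ident_mor.symm))

end PsAlg

/-! ### Strict algebras and strict maps -/

namespace PsAlg

variable {V : Type u} [Category.{v} V] [HasFiniteLimits V] {O : ReducedOperad V}

theorem IsStrict.phiAt {B : PsAlg O} (hB : B.IsStrict) {X : ICat V} {n : ℕ} {m : Fin n → ℕ}
    (o : X ⟶ O.obj n) (p : ∀ r, X ⟶ O.obj (m r)) (a : ∀ r, Fin (m r) → (X ⟶ B.carrier)) :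
    IsIdentity₂ (B.phiAt o p a).hom := by
  have h := congrArg (fun t => (B.phiLift o p a).obj ≫ t) ((ICat.isIdentity₂_iff _).mp (hB m))
  exact ICat.isIdentity₂_of_app _ _ ((B.phiAt_app o p a).trans
    (h.trans (Category.assoc _ _ _).symm))

theorem PsMor.IsStrict.zetaAt {A B : PsAlg O} {F : PsMor A B} (hF : F.IsStrict) {X : ICat V}
    {n : ℕ} (o : X ⟶ O.obj n) (a : Fin n → (X ⟶ A.carrier)) :
    IsIdentity₂ (F.zetaAt o a).hom := by
  have h := congrArg (fun t => (ICat.lift o (ICat.piLift a)).obj ≫ t)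
    ((ICat.isIdentity₂_iff _).mp (hF n))
  exact ICat.isIdentity₂_of_app _ _ ((F.zetaAt_app o a).trans
    (h.trans (Category.assoc _ _ _).symm))

/-- Strict maps are determined by their underlying functors. -/
theorem PsMor.IsStrict.ext {A B : PsAlg O} {F G : PsMor A B} (hF : F.IsStrict) (hG : G.IsStrict)
    (h : F.f = G.f) : F = G := by
  refine PsMor.ext_app h fun n => ?_
  rw [(ICat.isIdentity₂_iff _).mp (hF n), (ICat.isIdentity₂_iff _).mp (hG n), h]

theorem act_proj_comp {A B : AlgSt O} (g : A.alg.carrier ⟶ B.alg.carrier)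
    (hg : ∀ {X : ICat V} {n : ℕ} (o : X ⟶ O.obj n) (a : Fin n → (X ⟶ A.alg.carrier)),
      B.alg.act o (fun i => a i ≫ g) = A.alg.act o a ≫ g) (n : ℕ) :
    B.alg.act (X := ICat.times (O.obj n) (ICat.pi fun _ : Fin n => A.alg.carrier)) ICat.fst
      (fun i => (ICat.snd ≫ ICat.proj i) ≫ g) = A.alg.θ n ≫ g := by
  refine (hg _ _).trans (congrArg (fun t => t ≫ g) ?_)
  simpa only [Category.comp_id] using PsMor.act_id A.alg n

section

variable {A B : AlgSt O} (g : A.alg.carrier ⟶ B.alg.carrier)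
  (hg : ∀ {X : ICat V} {n : ℕ} (o : X ⟶ O.obj n) (a : Fin n → (X ⟶ A.alg.carrier)),
    B.alg.act o (fun i => a i ≫ g) = A.alg.act o a ≫ g)

/-- A functor that commutes with the actions, with identities as structure isomorphisms. -/
noncomputable abbrev strictData : PsMorData A.alg B.alg where
  f := g
  ζ n := eqToIso (act_proj_comp g hg n)

theorem strictData_zetaAt {X : ICat V} {n : ℕ} (o : X ⟶ O.obj n)
    (a : Fin n → (X ⟶ A.alg.carrier)) :
    IsIdentity₂ ((strictData g hg).zetaAt o a).hom := by
  have h := congrArg (fun t => (ICat.lift o (ICat.piLift a)).obj ≫ t)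
    ((ICat.isIdentity₂_iff ((strictData g hg).ζ n).hom).mp ⟨act_proj_comp g hg n, rfl⟩)
  exact ICat.isIdentity₂_of_app _ _ (((strictData g hg).zetaAt_app o a).trans
    (h.trans (Category.assoc _ _ _).symm))

theorem strictData_zetaAt_app {X : ICat V} {n : ℕ} (o : X ⟶ O.obj n)
    (a : Fin n → (X ⟶ A.alg.carrier)) :
    ((strictData g hg).zetaAt o a).hom.app =
      (B.alg.act o (fun i => a i ≫ g)).obj ≫ B.alg.carrier.ident :=
  (ICat.isIdentity₂_iff _).mp (strictData_zetaAt g hg o a)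

/-- A functor that commutes with the actions as a strict map. -/
noncomputable def strictMk : A ⟶ B :=
  AlgSt.StMor.mk
    (PsMor.mk (strictData g hg) ⟨act_proj_comp g hg 0, rfl⟩ (fun a => strictData_zetaAt g hg _ _)
      (fun ρ o a => by
        rw [strictData_zetaAt_app, strictData_zetaAt_app,
          ← B.alg.act_perm ρ o (fun i => a i ≫ g)])
      (fun o p a => by
        apply ICat.trans_ext
        have h₁ := (ICat.isIdentity₂_iff _).mp (B.alg.act₂_isIdentity o _ fun r =>
          strictData_zetaAt g hg (p r) (a r))
        have h₂ := (ICat.isIdentity₂_iff _).mp (IsStrict.phiAt A.isStrict o p a)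
        have h₃ := (ICat.isIdentity₂_iff _).mp (IsStrict.phiAt B.isStrict o p fun r s => a r s ≫ g)
        have h₄ : (A.alg.phiAt o p a).hom.app ≫ g.mor =
            ((A.alg.act o fun r => A.alg.act (p r) (a r)).obj ≫ g.obj) ≫ B.alg.carrier.ident := by
          rw [h₂, Category.assoc, ICat.Fun.ident_mor, Category.assoc]
        refine (ICat.cmp_congr _ h₁ (ICat.cmp_congr _ (strictData_zetaAt_app g hg _ _) h₄)).trans ?_
        refine (ICat.ident_cmp _ _ _ _).trans ((ICat.ident_cmp _ _ _ _).trans ?_)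
        refine Eq.trans ?_ ((ICat.cmp_congr _ h₃ (strictData_zetaAt_app g hg _ _)).trans
          (ICat.cmp_ident _ _ _ _)).symm
        refine congrArg (fun t => t ≫ B.alg.carrier.ident) ?_
        refine (congrArg ICat.Fun.obj (hg o fun r => A.alg.act (p r) (a r))).symm.trans ?_
        exact congrArg (fun t => ICat.Fun.obj (B.alg.act o t)) (funext fun r => (hg _ _).symm)))
    (fun n => ⟨act_proj_comp g hg n, rfl⟩)

end

open Word

/-! ### Structure isomorphisms of a pseudomorphism on words -/

section

variable {A B : PsAlg O} (F : PsMor A B) {X Y : ICat V}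

/-- The structure isomorphism at a word. -/
noncomputable def zetaCell (w : Word O A.carrier X) :
    B.act w.op (fun i => w.arg i ≫ F.f) ≅ A.eval w ≫ F.f :=
  F.zetaAt w.op w.arg

theorem zetaCell_precomp (H : Y ⟶ X) (w : Word O A.carrier X) :
    H.obj ≫ (zetaCell F w).hom.app = (zetaCell F (Word.pull H w)).hom.app :=
  PsMor.zetaAt_precomp F.toPsMorData H w.op w.arg

theorem inv_app_congr {C D : ICat V} {F F' G G' : C ⟶ D} (α : F ≅ G) (β : F' ≅ G')
    (h : α.hom.app = β.hom.app) : α.inv.app = β.inv.app := by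
  have hs := congrArg (fun t => t ≫ D.src) h
  have ht := congrArg (fun t => t ≫ D.tgt) h
  simp only [ICat.Trans.app_src, ICat.Trans.app_tgt] at hs ht
  refine ICat.inv_unique (f := α.hom.app) (by simp) (by simp [ht]) ?_ ?_
  · refine (congrArg ICat.Trans.app α.inv_hom_id).trans ?_
    simp
  · refine (ICat.cmp_congr _ h rfl).trans ((congrArg ICat.Trans.app β.hom_inv_id).trans ?_)
    simp [hs]

theorem precomp_inv_app {C C' D : ICat V} {F G : C ⟶ D} {F' G' : C' ⟶ D} (H : C' ⟶ C)
    (α : F ≅ G) (β : F' ≅ G') (h : H.obj ≫ α.hom.app = β.hom.app) :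
    H.obj ≫ α.inv.app = β.inv.app :=
  inv_app_congr (whiskerLeftIso H α) β h

theorem zetaCell_zero : (zetaCell F (Word.zero O A.carrier X)).hom.app =
    (B.act (n := 0) (ICat.toTerminal X ≫ O.zero.hom)
      (fun i => (Word.zero O A.carrier X).arg i ≫ F.f)).obj ≫ B.carrier.ident := by
  have h := congrArg (fun t => (ICat.lift (ICat.toTerminal X ≫ O.zero.hom)
    (ICat.piLift (Word.zero O A.carrier X).arg)).obj ≫ t)
    ((ICat.isIdentity₂_iff _).mp F.zeta_zero)
  have h' := (F.zetaAt_app (ICat.toTerminal X ≫ O.zero.hom) (Word.zero O A.carrier X).arg).trans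
    (h.trans (Category.assoc _ _ _).symm)
  exact (ICat.isIdentity₂_iff _).mp (ICat.isIdentity₂_of_app _ _ h')

theorem zetaCell_unit (a : X ⟶ A.carrier) :
    (zetaCell F (Word.unit a)).hom.app = (a ≫ F.f).obj ≫ B.carrier.ident := by
  refine ((ICat.isIdentity₂_iff _).mp (F.zeta_unit a)).trans ?_
  exact congrArg (fun t => ICat.Fun.obj t ≫ B.carrier.ident) (B.act_unit (a ≫ F.f))

theorem zetaCell_degen {n : ℕ} (s : Fin n) (a : Fin n → (X ⟶ A.carrier)) (i : Fin n) :
    IsIdentity₂ (zetaCell F (Word.degen s a i)).hom := by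
  by_cases h : i = s
  · subst h
    rw [Word.degen_self]
    exact ICat.isIdentity₂_of_app _ _ (zetaCell_zero F)
  · rw [Word.degen_of_ne h]
    exact ICat.isIdentity₂_of_app _ _ (zetaCell_unit F _)

/-- Compatibility with the composition isomorphisms for a strict target. -/
theorem zetaCell_comp (hB : B.IsStrict) {n : ℕ} (o : X ⟶ O.obj n)
    (w : Fin n → Word O A.carrier X) :
    B.carrier.cmp (B.act₂ o (fun r => (zetaCell F (w r)).hom)).app
        (B.carrier.cmp (F.zetaAt o (fun r => A.eval (w r))).hom.app (A.phi o w ≫ F.f.mor)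
          (by rw [ICat.Trans.app_tgt, Category.assoc, F.f.mor_src, ← Category.assoc, phi_src]; rfl))
        (by rw [ICat.Trans.app_tgt, ICat.cmp_src, ICat.Trans.app_src]) =
      (zetaCell F (Word.comp o w)).hom.app := by
  refine (F.zeta_phi_app o (fun r => (w r).op) (fun r => (w r).arg)).trans ?_
  refine (ICat.cmp_congr _ ((ICat.isIdentity₂_iff _).mp (hB.phiAt _ _ _)) rfl).trans ?_
  exact ICat.ident_cmp _ _ _ _

/-- For an omission, the coherence of ζ with φ is applied to the degenerate words: the inner
structure isomorphisms are identities because ζ₀ and ζ(1; -) are, and φ is an identity there.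
Strictness of B removes the remaining φ of the target. -/
theorem Rel.zetaCell_eq (hB : B.IsStrict) {w w' : Word O A.carrier X} (h : A.Rel w w') :
    (zetaCell F w).hom.app = (zetaCell F w').hom.app := by
  rcases h with ⟨ρ, rfl⟩ | ⟨s, a, ha, rfl⟩
  · exact F.zeta_perm ρ w'.op w'.arg
  · refine (zetaCell_comp F hB w'.op (Word.degen s a)).symm.trans ?_
    have h₁ := (ICat.isIdentity₂_iff _).mp (B.act₂_isIdentity w'.op _ fun r => zetaCell_degen F s a r)
    have h₂ : A.phi w'.op (Word.degen s a) ≫ F.f.mor =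
        ((A.act w'.op fun i => A.eval (Word.degen s a i)).obj ≫ F.f.obj) ≫ B.carrier.ident := by
      refine (congrArg (fun t => t ≫ F.f.mor)
        ((ICat.isIdentity₂_iff _).mp (A.phiCell_degen s w'.op a))).trans ?_
      rw [Category.assoc, ICat.Fun.ident_mor, Category.assoc]
    refine (ICat.cmp_congr _ h₁ (ICat.cmp_congr _ rfl h₂)).trans ?_
    refine (ICat.ident_cmp _ _ _ _).trans ((ICat.cmp_ident _ _ _ _).trans ?_)
    exact F.zetaAt_congr rfl (funext fun i => (ha i).symm)

end

end PsAlg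

namespace Word

theorem pull_discOb {V : Type u} [Category.{v} V] [HasFiniteLimits V] {O : ReducedOperad V}
    {C : ICat V} {X : V} (w : Word O C (ICat.disc X)) :
    pull (ICat.disc X).discOb w = w :=
  ext_cast rfl ((Category.comp_id _).trans (ICat.disc_hom_ext (ICat.discOb_comp_obj _)))
    fun _ => ICat.disc_hom_ext (ICat.discOb_comp_obj _)

end Word

namespace PsAlg

open Word

variable {V : Type u} [Category.{v} V] [HasFiniteLimits V] {O : ReducedOperad V} {A : PsAlg O}
  [HasColimitsOfSize.{0, 0} V] [ProdPreservesConnectedColimits V] {B : AlgSt O} (F : A ⟶ B.alg)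

/-! ### Extension of pseudomorphisms to strict maps -/

theorem exists_freeZeta : ∃ F' : A.FreeOb ⟶ B.alg.carrier.Mor,
    ∀ ⦃X : V⦄ (w : Word O A.carrier (ICat.disc X)), A.cls w ≫ F' = (zetaCell F w).hom.app :=
  exists_cls_desc (A := A) (fun _ w => ICat.Trans.app (zetaCell F w).hom)
    (fun _ _ y w => zetaCell_precomp F (discMap y) w)
    (fun _ _ _ h => h.zetaCell_eq F B.isStrict)

theorem exists_freeZetaInv : ∃ F' : A.FreeOb ⟶ B.alg.carrier.Mor,
    ∀ ⦃X : V⦄ (w : Word O A.carrier (ICat.disc X)), A.cls w ≫ F' = (zetaCell F w).inv.app :=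
  exists_cls_desc (A := A) (fun _ w => ICat.Trans.app (zetaCell F w).inv)
    (fun _ _ y w => precomp_inv_app (discMap y) _ _ (zetaCell_precomp F (discMap y) w))
    (fun _ _ _ h => inv_app_congr _ _ (h.zetaCell_eq F B.isStrict))

/-- The structure isomorphisms on classes of words. -/
noncomputable def freeZeta : A.FreeOb ⟶ B.alg.carrier.Mor := (exists_freeZeta F).choose

theorem cls_freeZeta {X : V} (w : Word O A.carrier (ICat.disc X)) :
    A.cls w ≫ freeZeta F = (zetaCell F w).hom.app :=
  (exists_freeZeta F).choose_spec w

/-- The inverses of the structure isomorphisms on classes of words. -/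
noncomputable def freeZetaInv : A.FreeOb ⟶ B.alg.carrier.Mor := (exists_freeZetaInv F).choose

theorem cls_freeZetaInv {X : V} (w : Word O A.carrier (ICat.disc X)) :
    A.cls w ≫ freeZetaInv F = (zetaCell F w).inv.app :=
  (exists_freeZetaInv F).choose_spec w

theorem freeZeta_tgt : freeZeta F ≫ B.alg.carrier.tgt = A.freeEval ≫ F.f.obj := by
  refine cls_ext fun X w => ?_
  rw [← Category.assoc, cls_freeZeta, ← Category.assoc, cls_freeEval]
  exact ICat.Trans.app_tgt _

theorem freeZetaInv_src : freeZetaInv F ≫ B.alg.carrier.src = A.freeEval ≫ F.f.obj := by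
  refine cls_ext fun X w => ?_
  rw [← Category.assoc, cls_freeZetaInv, ← Category.assoc, cls_freeEval]
  exact ICat.Trans.app_src _

theorem freeZeta_src : freeZeta F ≫ B.alg.carrier.src = freeZetaInv F ≫ B.alg.carrier.tgt := by
  refine cls_ext fun X w => ?_
  rw [← Category.assoc, cls_freeZeta, ← Category.assoc, cls_freeZetaInv]
  exact (ICat.Trans.app_src _).trans (ICat.Trans.app_tgt _).symm

/-- The isomorphisms `f ε s ≅ g s`. -/
noncomputable def freeZetaFam : ICat.IsoFam B.alg.carrier A.FreeOb where
  -- The structure isomorphism ζ points from ξ(o; f a) to f ε(o; a), while the transport starts at f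
  -- ε; so its forward direction is the inverse of ζ.
  hom := freeZetaInv F
  inv := freeZeta F
  inv_src := freeZeta_src F
  inv_tgt := (freeZeta_tgt F).trans (freeZetaInv_src F).symm
  hom_inv := by
    refine cls_ext fun X w => ?_
    refine (ICat.precomp_cmp _ _ _ _ _).trans ?_
    refine (ICat.cmp_congr _ (cls_freeZetaInv F w) (cls_freeZeta F w)).trans ?_
    refine (congrArg ICat.Trans.app (zetaCell F w).inv_hom_id).trans ?_
    rw [freeZetaInv_src, ← Category.assoc, ← Category.assoc, cls_freeEval]
    rfl
  inv_hom := by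
    refine cls_ext fun X w => ?_
    refine (ICat.precomp_cmp _ _ _ _ _).trans ?_
    refine (ICat.cmp_congr _ (cls_freeZeta F w) (cls_freeZetaInv F w)).trans ?_
    refine (congrArg ICat.Trans.app (zetaCell F w).hom_inv_id).trans ?_
    rw [← Category.assoc, ← Category.assoc, cls_freeZetaInv]
    exact congrArg (fun t => t ≫ B.alg.carrier.ident) (ICat.Trans.app_tgt _).symm

/-- The functor that extends `f` to words. -/
noncomputable def descFun : A.stCarrier ⟶ B.alg.carrier :=
  ICat.conj (A.stEval ≫ F.f) (freeZetaFam F) (freeZetaInv_src F)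

/-- The extension is isomorphic to `f` after evaluation. -/
noncomputable def descIso : descFun F ≅ A.stEval ≫ F.f :=
  (ICat.conjIso (A.stEval ≫ F.f) (freeZetaFam F) (freeZetaInv_src F)).symm

/-- The structure isomorphism at a class of words, as a transformation. -/
noncomputable def freeZetaCell {X : V} (s : X ⟶ A.FreeOb) :
    ICat.ofOb (s ≫ freeZeta F ≫ B.alg.carrier.src) ⟶ A.freeVal s ≫ F.f :=
  ICat.discTrans (s ≫ freeZeta F) (Category.assoc _ _ _)
    ((Category.assoc _ _ _).trans ((congrArg (fun t => s ≫ t) (freeZeta_tgt F)).trans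
      (Category.assoc _ _ _).symm))

theorem freeZeta_mid {X : V} {n : ℕ} (o : ICat.disc X ⟶ O.obj n) (s : Fin n → (X ⟶ A.FreeOb)) :
    (F.zetaAt o (fun i => A.freeVal (s i))).hom.app ≫ B.alg.carrier.tgt =
      (A.freePhi o s ≫ F.f.mor) ≫ B.alg.carrier.src := by
  refine (ICat.Trans.app_tgt _).trans (Eq.trans ?_ (Category.assoc _ _ _).symm)
  refine Eq.trans ?_ (congrArg (fun t => A.freePhi o s ≫ t) F.f.mor_src).symm
  refine Eq.trans ?_ (Category.assoc _ _ _)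
  exact congrArg (fun t => t ≫ F.f.obj) (A.freePhi_src o s).symm

theorem freeZeta_fst {X : V} {n : ℕ} (o : ICat.disc X ⟶ O.obj n) (s : Fin n → (X ⟶ A.FreeOb)) :
    (B.alg.act₂ o (fun i => freeZetaCell F (s i))).app ≫ B.alg.carrier.tgt =
      B.alg.carrier.cmp (F.zetaAt o (fun i => A.freeVal (s i))).hom.app
        (A.freePhi o s ≫ F.f.mor) (freeZeta_mid F o s) ≫ B.alg.carrier.src := by
  refine Eq.trans ?_ (ICat.cmp_src _ _ _ _).symm
  exact (ICat.Trans.app_tgt _).trans (ICat.Trans.app_src _).symm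

/-- Coherence of ζ with φ for a strict target, descended from words to classes. -/
theorem freeZeta_comp {X : V} {n : ℕ} (o : ICat.disc X ⟶ O.obj n) (s : Fin n → (X ⟶ A.FreeOb)) :
    B.alg.carrier.cmp (B.alg.act₂ o (fun i => freeZetaCell F (s i))).app
      (B.alg.carrier.cmp (F.zetaAt o (fun i => A.freeVal (s i))).hom.app
        (A.freePhi o s ≫ F.f.mor) (freeZeta_mid F o s)) (freeZeta_fst F o s) =
    A.freeAct o s ≫ freeZeta F := by
  refine free_ext (fun X o s => B.alg.carrier.cmp (B.alg.act₂ o (fun i => freeZetaCell F (s i))).app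
      (B.alg.carrier.cmp (F.zetaAt o (fun i => A.freeVal (s i))).hom.app
        (A.freePhi o s ≫ F.f.mor) (freeZeta_mid F o s)) (freeZeta_fst F o s))
    (fun X o s => A.freeAct o s ≫ freeZeta F) ?_ ?_ ?_ o s
  · intro X Y y o s
    refine (ICat.precomp_cmp _ y _ _ _).trans (ICat.cmp_congr _ ?_
      ((ICat.precomp_cmp _ y _ _ _).trans (ICat.cmp_congr _ ?_ ?_)))
    · exact ActionData.precomp_act₂_app (discMap y) o _ (fun i => freeZetaCell F (y ≫ s i))
        fun i => (Category.assoc _ _ _).symm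
    · refine (PsMor.zetaAt_precomp F.toPsMorData (discMap y) o _).trans ?_
      exact F.zetaAt_congr rfl (funext fun i => A.discMap_freeVal y (s i))
    · rw [← Category.assoc, precomp_freePhi]
  · intro X Y y o s
    rw [← Category.assoc, precomp_freeAct]
  · intro X o w
    rw [freeAct_cls, cls_freeZeta]
    refine Eq.trans (ICat.cmp_congr _ ?_ (ICat.cmp_congr _ ?_ ?_))
      (zetaCell_comp F B.isStrict o w)
    · exact ActionData.act₂_app_congr rfl _ _ fun i => cls_freeZeta F (w i)
    · exact F.zetaAt_congr rfl (funext fun i => A.freeVal_cls (w i))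
    · exact congrArg (fun t => t ≫ F.f.mor) (A.freePhi_cls o w)

/-- Both sides map isomorphically to the value of f ε at o · a: one by ζ at the entries, then ζ at
o, then φ; the other by ζ at o · a. These agree by `freeZeta_comp`, so the functors are equal and
the extension is strict. -/
theorem descFun_act {X : ICat V} {n : ℕ} (o : X ⟶ O.obj n) (a : Fin n → (X ⟶ A.stCarrier)) :
    B.alg.act o (fun i => a i ≫ descFun F) = A.stAction.act o a ≫ descFun F := by
  let α : ∀ i, a i ≫ descFun F ⟶ (a i ≫ A.stEval) ≫ F.f := fun i =>
    ICat.castTrans (a i ◁ (descIso F).hom) rfl (Category.assoc _ _ _).symm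
  have hα : ∀ i, (α i).app = (a i).obj ≫ freeZeta F := fun i => ICat.castTrans_app _ _ _
  refine ICat.eq_of_iso_to (B.alg.act₂ o α ≫ (F.zetaAt o fun i => a i ≫ A.stEval).hom ≫
    (A.stZetaAt o a).hom ▷ F.f) (whiskerLeftIso (A.stAction.act o a) (descIso F))
    (Category.assoc _ _ _) ?_
  refine Eq.trans ?_ (congrArg (fun t => t ≫ freeZeta F) (A.stAction_act_obj o a)).symm
  refine Eq.trans (ICat.cmp_congr _ ?_ (ICat.cmp_congr _ ?_ ?_))
    (freeZeta_comp F (X.discOb ≫ o) fun i => (a i).obj)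
  · refine (ICat.discOb_obj_comp X _).symm.trans ?_
    exact ActionData.precomp_act₂_app X.discOb o _ _ fun i =>
      (ICat.discOb_obj_comp X _).trans (hα i)
  · refine (ICat.discOb_obj_comp X _).symm.trans ?_
    refine (PsMor.zetaAt_precomp F.toPsMorData X.discOb o _).trans ?_
    exact F.zetaAt_congr rfl (funext fun i => discOb_comp_stEval (a i))
  · exact congrArg (fun t => t ≫ F.f.mor) (A.stZetaAt_app o a)

/-- The strict map that extends a pseudomorphism. -/
noncomputable def stDesc : A.st ⟶ B := strictMk (descFun F) (descFun_act F)

theorem stUnitFun_descFun_app :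
    A.stUnitFun.obj ≫ freeZeta F = F.f.obj ≫ B.alg.carrier.ident := by
  refine (cls_freeZeta F _).trans ((zetaCell_unit F _).trans ?_)
  exact congrArg (fun t => t ≫ B.alg.carrier.ident) (ICat.discOb_comp_obj F.f)

/-- At a one-letter word the transport is along ζ(1; -), an identity. -/
theorem stUnitFun_descFun : A.stUnitFun ≫ descFun F = F.f := by
  refine ICat.eq_of_iso_to (A.stUnitFun ◁ (descIso F).hom) (Iso.refl F.f) ?_
    (stUnitFun_descFun_app F)
  rw [← Category.assoc, stUnitFun_stEval, Category.id_comp]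

/-- The structure isomorphism of η lies over an identity, so the extension sends it to a conjugate
of an identity by ζ at its two endpoints. At the source (o; a) this contributes ζₙ, at the target
(1; θ(o; a)) an identity. -/
theorem stUnit_zeta_descFun (n : ℕ) :
    (A.stUnitData.ζ n).hom.app ≫ (descFun F).mor = (F.ζ n).hom.app := by
  have hnat := (descIso F).hom.naturality' (A.stUnitData.ζ n).hom.app
  have h₁ : (A.stUnitData.ζ n).hom.app ≫ A.stCarrier.tgt ≫ (descIso F).hom.app =
      ((A.θ n).obj ≫ F.f.obj) ≫ B.alg.carrier.ident := by
    refine (Category.assoc _ _ _).symm.trans ((congrArg (fun t => t ≫ freeZeta F)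
      (ICat.Trans.app_tgt (A.stUnitData.ζ n).hom)).trans ?_)
    refine (Category.assoc _ _ _).trans ((congrArg (fun t => (A.θ n).obj ≫ t)
      (stUnitFun_descFun_app F)).trans (Category.assoc _ _ _).symm)
  have h₂ : (A.stUnitData.ζ n).hom.app ≫ ICat.Fun.mor (A.stEval ≫ F.f) =
      ((ICat.Fun.obj (A.stAction.act (X := ICat.times (O.obj n)
        (ICat.pi fun _ : Fin n => A.carrier)) ICat.fst
        (fun i => (ICat.snd ≫ ICat.proj i) ≫ A.stUnitFun) ≫ A.stEval)) ≫ F.f.obj) ≫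
          B.alg.carrier.ident := by
    have h : (A.stUnitData.ζ n).hom.app ≫ A.stEval.mor = _ :=
      (ICat.inducedIso_hom_app_mor _).trans (ICat.eqToHom_app (A.act_stUnitFun_proj n))
    refine (Category.assoc _ _ _).symm.trans ((congrArg (fun t => t ≫ F.f.mor) h).trans ?_)
    refine (Category.assoc _ _ _).trans ((congrArg (fun t => _ ≫ t) F.f.ident_mor).trans ?_)
    exact (Category.assoc _ _ _).symm
  have h₃ : (A.stUnitData.ζ n).hom.app ≫ A.stCarrier.src ≫ (descIso F).hom.app =
      (F.ζ n).hom.app := by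
    refine (Category.assoc _ _ _).symm.trans ((congrArg (fun t => t ≫ freeZeta F)
      ((ICat.Trans.app_src (A.stUnitData.ζ n).hom).trans (A.act_stUnitFun_obj _ _))).trans ?_)
    refine (cls_freeZeta F _).trans ?_
    refine (PsMor.zetaAt_precomp F.toPsMorData (ICat.discOb _) ICat.fst
      fun i : Fin n => ICat.snd ≫ ICat.proj i).symm.trans ?_
    refine (ICat.discOb_obj_comp _ _).trans ((F.zetaAt_app _ _).trans ?_)
    have h : ICat.lift ICat.fst (ICat.piLift fun i => ICat.snd ≫ ICat.proj i) =
        𝟙 (ICat.times (O.obj n) (ICat.pi fun _ : Fin n => A.carrier)) := by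
      apply ICat.times_hom_ext
      · simp
      · apply ICat.pi_hom_ext
        intro i
        rw [ICat.lift_snd, ICat.piLift_proj, Category.id_comp]
    exact (congrArg (fun t => ICat.Fun.obj t ≫ (F.ζ n).hom.app) h).trans (Category.id_comp _)
  refine Eq.trans ?_ (hnat.trans ?_)
  · exact ((ICat.cmp_congr _ rfl h₁).trans (ICat.cmp_ident _ _ _ _)).symm
  · exact (ICat.cmp_congr _ h₃ h₂).trans (ICat.cmp_ident _ _ _ _)

theorem stUnit_stDesc : A.stUnit ≫ (stDesc F).mor = F := by
  refine PsMor.ext_app (stUnitFun_descFun F) fun n => ?_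
  refine (PsMor.compData_zeta_app _ _ _).trans ?_
  have h₁ := (ICat.isIdentity₂_iff _).mp (PsMor.IsStrict.zetaAt (stDesc F).isStrict
    (X := ICat.times (O.obj n) (ICat.pi fun _ : Fin n => A.carrier)) ICat.fst
    fun i => (ICat.snd ≫ ICat.proj i) ≫ A.stUnitFun)
  refine (ICat.cmp_congr _ h₁ rfl).trans ((ICat.ident_cmp _ _ _ _).trans ?_)
  exact stUnit_zeta_descFun F n

/-! ### Uniqueness of the extension -/

/-- Both morphisms lie over the identity of the value of w and run from the class of w to the
one-letter word on that value, so they agree by faithfulness of ε. -/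
theorem cls_stFunIso_app {X : V} (w : Word O A.carrier (ICat.disc X)) :
    A.cls w ≫ A.stFunIso.hom.app = (A.stUnit.zetaAt w.op w.arg).hom.app := by
  refine ICat.induced_mor_ext ?_ ?_ ?_
  · refine Eq.trans ?_ (A.stUnit_zetaAt_app w.op w.arg).symm
    refine (Category.assoc _ _ _).trans ((congrArg (fun t => A.cls w ≫ t) A.stFunIso_app).trans ?_)
    refine (Category.assoc _ _ _).symm.trans ?_
    exact congrArg (fun t => t ≫ A.carrier.ident) (A.cls_freeEval w)
  · refine (Category.assoc _ _ _).trans ((congrArg (fun t => A.cls w ≫ t)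
      (ICat.Trans.app_src _)).trans ((Category.comp_id _).trans ?_))
    refine Eq.trans ?_ (ICat.Trans.app_src (A.stUnit.zetaAt w.op w.arg).hom).symm
    refine Eq.trans ?_ (A.act_stUnitFun_obj w.op w.arg).symm
    exact congrArg A.cls (Word.pull_discOb w).symm
  · refine (Category.assoc _ _ _).trans ((congrArg (fun t => A.cls w ≫ t)
      (ICat.Trans.app_tgt _)).trans ?_)
    refine Eq.trans ?_ (ICat.Trans.app_tgt (A.stUnit.zetaAt w.op w.arg).hom).symm
    refine (Category.assoc _ _ _).symm.trans ?_
    exact congrArg (fun t => t ≫ A.stUnitFun.obj) (A.cls_freeEval w)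

theorem zetaAt_stUnit_comp (G : A.st ⟶ B) {X : ICat V} {n : ℕ} (o : X ⟶ O.obj n)
    (a : Fin n → (X ⟶ A.carrier)) :
    (A.stUnit.zetaAt o a).hom.app ≫ G.mor.f.mor = ((A.stUnit ≫ G.mor).zetaAt o a).hom.app := by
  refine Eq.trans ?_ (PsMor.compData_zetaAt_app A.stUnit.toPsMorData G.mor.toPsMorData o a).symm
  have h := (ICat.isIdentity₂_iff _).mp (PsMor.IsStrict.zetaAt G.isStrict o
    fun i => a i ≫ A.stUnitFun)
  exact ((ICat.cmp_congr _ h rfl).trans (ICat.ident_cmp _ _ _ _)).symm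

/-- A strict G sends the component of 1 ≅ ηε at a word w to the structure isomorphism of Gη at w. So
G and G' are isomorphic to the same functor Gηε by isomorphisms with the same components on classes,
and are equal. -/
theorem st_hom_ext {G G' : A.st ⟶ B} (h : A.stUnit ≫ G.mor = A.stUnit ≫ G'.mor) : G = G' := by
  refine AlgSt.StMor.ext (PsMor.IsStrict.ext G.isStrict G'.isStrict ?_)
  have hf : A.stUnitFun ≫ G.mor.f = A.stUnitFun ≫ G'.mor.f :=
    congrArg (fun t : A ⟶ B.alg => t.f) h
  refine (Category.id_comp G.mor.f).symm.trans (Eq.trans ?_ (Category.id_comp G'.mor.f))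
  refine ICat.eq_of_iso_to (A.stFunIso.hom ▷ G.mor.f) (whiskerRightIso A.stFunIso G'.mor.f) ?_ ?_
  · rw [Category.assoc, Category.assoc, hf]
  · refine cls_ext fun X w => ?_
    have key : ∀ K : A.st ⟶ B, A.cls w ≫ A.stFunIso.hom.app ≫ K.mor.f.mor =
        ((A.stUnit ≫ K.mor).zetaAt w.op w.arg).hom.app := fun K =>
      (Category.assoc _ _ _).symm.trans ((congrArg (fun t => t ≫ K.mor.f.mor)
        (cls_stFunIso_app w)).trans (zetaAt_stUnit_comp K w.op w.arg))
    refine (key G).trans (Eq.trans ?_ (key G').symm)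
    rw [h]

end PsAlg

namespace PsAlg

variable {V : Type u} [Category.{v} V] [HasFiniteLimits V] {O : ReducedOperad V}

/-! ### The two-dimensional universal property -/

theorem cell_ext {A B : PsAlg O} {F G : A ⟶ B} {α β : F ⟶ G} (h : α.τ.app = β.τ.app) : α = β :=
  PsCell.ext_app h

/-- An algebra 2-cell with its source and target replaced by equal pseudomorphisms. -/
noncomputable def castCell {A B : PsAlg O} {F F' G G' : A ⟶ B} (α : F ⟶ G) (hF : F = F')
    (hG : G = G') : F' ⟶ G' :=
  eqToHom hF.symm ≫ α ≫ eqToHom hG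

theorem castCell_app {A B : PsAlg O} {F F' G G' : A ⟶ B} (α : F ⟶ G) (hF : F = F')
    (hG : G = G') : (castCell α hF hG).τ.app = α.τ.app := by
  subst hF hG
  rw [castCell, eqToHom_refl, eqToHom_refl, Category.id_comp, Category.comp_id]

theorem cell_comp_eqToHom_app {A B : PsAlg O} {F G G' : A ⟶ B} (α : F ⟶ G) (h : G = G') :
    (α ≫ eqToHom h).τ.app = α.τ.app := by
  subst h
  rw [eqToHom_refl, Category.comp_id]

theorem cell_eqToHom_comp_app {A B : PsAlg O} {F F' G : A ⟶ B} (h : F' = F) (α : F ⟶ G) :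
    (eqToHom h ≫ α).τ.app = α.τ.app := by
  subst h
  rw [eqToHom_refl, Category.id_comp]

variable {A : PsAlg O} [HasColimitsOfSize.{0, 0} V] [ProdPreservesConnectedColimits V]

/-- One of the triangle identities between η and ε: at a one-letter word, source and target of 1 ≅
ηε coincide as classes, and the component lies over an identity. -/
theorem stUnitFun_stFunIso_app :
    A.stUnitFun.obj ≫ A.stFunIso.hom.app = A.stUnitFun.obj ≫ A.stCarrier.ident := by
  have h : (A.stUnitFun ◁ A.stFunIso.hom).app ≫ A.stEval.mor =
      (A.stUnitFun.obj ≫ A.stEval.obj) ≫ A.carrier.ident :=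
    (Category.assoc _ _ _).trans ((congrArg (fun t => A.stUnitFun.obj ≫ t) A.stFunIso_app).trans
      (Category.assoc _ _ _).symm)
  refine ((ICat.isIdentity₂_iff _).mp (isIdentity₂_st (A.stUnitFun ◁ A.stFunIso.hom) ?_ _ h)).trans
    (congrArg (fun t => ICat.Fun.obj t ≫ A.stCarrier.ident) (Category.comp_id A.stUnitFun))
  refine congrArg ICat.Fun.obj (?_ : A.stUnitFun ≫ 𝟙 _ = A.stUnitFun ≫ A.stEval ≫ A.stUnitFun)
  rw [← Category.assoc, stUnitFun_stEval, Category.comp_id, Category.id_comp]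

theorem stUnitFun_stFunIso_inv_app :
    A.stUnitFun.obj ≫ A.stFunIso.inv.app = A.stUnitFun.obj ≫ A.stCarrier.ident :=
  precomp_inv_app A.stUnitFun A.stFunIso (Iso.refl A.stUnitFun) stUnitFun_stFunIso_app

variable {B : PsAlg O} {K K' : A.st.alg ⟶ B}

/-- Interchange with the isomorphism 1 ≅ ηε recovers a 2-cell from its restriction along η. Neither
strictness of K and K' nor strictness of B is involved. -/
theorem st_cell_ext {β β' : K ⟶ K'}
    (h : A.stUnitFun.obj ≫ β.τ.app = A.stUnitFun.obj ≫ β'.τ.app) : β = β' := by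
  have key : (𝟙 A.st.alg : A.st.alg ⟶ A.st.alg) ◁ β = (𝟙 A.st.alg : A.st.alg ⟶ A.st.alg) ◁ β' := by
    rw [← cancel_mono (A.stIso.hom ▷ K'), whisker_exchange, whisker_exchange]
    congr 1
    refine cell_ext ?_
    refine (Category.assoc A.stEval.obj A.stUnitFun.obj β.τ.app).trans (Eq.trans ?_
      (Category.assoc A.stEval.obj A.stUnitFun.obj β'.τ.app).symm)
    exact congrArg (fun t => A.stEval.obj ≫ t) h
  have h' := congrArg (fun t : 𝟙 A.st.alg ≫ K ⟶ 𝟙 A.st.alg ≫ K' => t.τ.app) key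
  exact cell_ext ((Category.id_comp _).symm.trans (h'.trans (Category.id_comp _)))

/-- The extension of an algebra 2-cell along the unit. -/
noncomputable def stCell (α : A.stUnit ≫ K ⟶ A.stUnit ≫ K') : K ⟶ K' :=
  castCell (A.stIso.hom ▷ K) (Category.id_comp K) (Category.assoc A.stCounit A.stUnit K) ≫
    A.stCounit ◁ α ≫
    castCell (A.stIso.inv ▷ K') (Category.assoc A.stCounit A.stUnit K') (Category.id_comp K')

/-- Restricted along η, the two conjugating isomorphisms become identities, and εη = 1 leaves α. -/
theorem stUnitFun_stCell_app (α : A.stUnit ≫ K ⟶ A.stUnit ≫ K') :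
    A.stUnitFun.obj ≫ (stCell α).τ.app = α.τ.app := by
  have hid : ∀ (L : A.st.alg ⟶ B) (t : A.stCarrier.Ob ⟶ A.stCarrier.Mor),
      A.stUnitFun.obj ≫ t = A.stUnitFun.obj ≫ A.stCarrier.ident →
      A.stUnitFun.obj ≫ t ≫ L.f.mor = (A.stUnitFun.obj ≫ L.f.obj) ≫ B.carrier.ident :=
    fun L t ht => (Category.assoc _ _ _).symm.trans ((congrArg (fun t => t ≫ L.f.mor) ht).trans
      ((Category.assoc _ _ _).trans ((congrArg (fun t => A.stUnitFun.obj ≫ t)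
        L.f.ident_mor).trans (Category.assoc _ _ _).symm)))
  have h₁ : A.stUnitFun.obj ≫ (castCell (A.stIso.hom ▷ K) (Category.id_comp K)
      (Category.assoc A.stCounit A.stUnit K)).τ.app =
      (A.stUnitFun.obj ≫ K.f.obj) ≫ B.carrier.ident :=
    (congrArg (fun t => A.stUnitFun.obj ≫ t) (castCell_app _ _ _)).trans
      (hid K _ stUnitFun_stFunIso_app)
  have h₂ : A.stUnitFun.obj ≫ (castCell (A.stIso.inv ▷ K')
      (Category.assoc A.stCounit A.stUnit K') (Category.id_comp K')).τ.app =
      (A.stUnitFun.obj ≫ K'.f.obj) ≫ B.carrier.ident :=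
    (congrArg (fun t => A.stUnitFun.obj ≫ t) (castCell_app _ _ _)).trans
      (hid K' _ stUnitFun_stFunIso_inv_app)
  have h₃ : A.stUnitFun.obj ≫ A.stEval.obj ≫ α.τ.app = α.τ.app :=
    (Category.assoc _ _ _).symm.trans ((congrArg (fun t => ICat.Fun.obj t ≫ α.τ.app)
      A.stUnitFun_stEval).trans (Category.id_comp _))
  refine (ICat.precomp_cmp _ A.stUnitFun.obj _ _ _).trans ((ICat.cmp_congr _ h₁
    ((ICat.precomp_cmp _ A.stUnitFun.obj _ _ _).trans (ICat.cmp_congr _ h₃ h₂))).trans ?_)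
  exact (ICat.ident_cmp _ _ _ _).trans (ICat.cmp_ident _ _ _ _)

/-! ### The strictification 2-functor -/

section

variable {A B C : PsAlg O}

/-- Strictification of a pseudomorphism. -/
noncomputable def stMap (F : A ⟶ B) : A.st ⟶ B.st := stDesc (F ≫ B.stUnit)

theorem stUnit_stMap (F : A ⟶ B) : A.stUnit ≫ (stMap F).mor = F ≫ B.stUnit :=
  stUnit_stDesc _

/-- Strictification of an algebra 2-cell. -/
noncomputable def stMap₂ {F G : A ⟶ B} (α : F ⟶ G) : (stMap F).mor ⟶ (stMap G).mor :=
  stCell (castCell (α ▷ B.stUnit) (stUnit_stMap F).symm (stUnit_stMap G).symm)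

theorem stUnitFun_stMap₂_app {F G : A ⟶ B} (α : F ⟶ G) :
    A.stUnitFun.obj ≫ (stMap₂ α).τ.app = α.τ.app ≫ B.stUnitFun.mor :=
  (stUnitFun_stCell_app _).trans (castCell_app _ _ _)

/-- The form in which functoriality on 2-cells is checked: only restrictions along the unit have to
be compared. -/
theorem stMap₂_eq {F G : A ⟶ B} (α : F ⟶ G) (β : (stMap F).mor ⟶ (stMap G).mor)
    (h : A.stUnitFun.obj ≫ β.τ.app = α.τ.app ≫ B.stUnitFun.mor) : stMap₂ α = β :=
  st_cell_ext ((stUnitFun_stMap₂_app α).trans h.symm)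

theorem stMap_id (A : PsAlg O) : stMap (𝟙 A) = 𝟙 A.st := by
  refine st_hom_ext ((stUnit_stMap _).trans ((Category.id_comp A.stUnit).trans ?_))
  exact (Category.comp_id A.stUnit).symm

theorem stMap_comp (F : A ⟶ B) (G : B ⟶ C) : stMap (F ≫ G) = stMap F ≫ stMap G := by
  refine st_hom_ext ((stUnit_stMap _).trans ?_)
  refine Eq.trans ?_ (Category.assoc A.stUnit (stMap F).mor (stMap G).mor)
  rw [stUnit_stMap, Category.assoc, Category.assoc, stUnit_stMap]

theorem stUnitFun_obj_stMap (F : A ⟶ B) :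
    A.stUnitFun.obj ≫ (stMap F).mor.f.obj = F.f.obj ≫ B.stUnitFun.obj :=
  congrArg (fun t : A ⟶ B.st.alg => t.f.obj) (stUnit_stMap F)

theorem stUnitFun_mor_stMap (F : A ⟶ B) :
    A.stUnitFun.mor ≫ (stMap F).mor.f.mor = F.f.mor ≫ B.stUnitFun.mor :=
  congrArg (fun t : A ⟶ B.st.alg => t.f.mor) (stUnit_stMap F)

end

end PsAlg

namespace AlgSt

variable {V : Type u} [Category.{v} V] [HasFiniteLimits V] {O : ReducedOperad V}

theorem comp_eqToHom_app {A B : AlgSt O} {F G G' : A ⟶ B} (α : F ⟶ G) (h : G = G') :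
    (PsAlg.PsCell.τ (F := F.mor) (G := G'.mor) (α ≫ eqToHom h)).app =
      (PsAlg.PsCell.τ (F := F.mor) (G := G.mor) α).app := by
  subst h
  rw [eqToHom_refl, Category.comp_id]

theorem eqToHom_comp_app {A B : AlgSt O} {F F' G : A ⟶ B} (h : F' = F) (α : F ⟶ G) :
    (PsAlg.PsCell.τ (F := F'.mor) (G := G.mor) (eqToHom h ≫ α)).app =
      (PsAlg.PsCell.τ (F := F.mor) (G := G.mor) α).app := by
  subst h
  rw [eqToHom_refl, Category.id_comp]

end AlgSt

namespace PsAlg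

variable {V : Type u} [Category.{v} V] [HasFiniteLimits V] (O : ReducedOperad V)
  [HasColimitsOfSize.{0, 0} V] [ProdPreservesConnectedColimits V]

/-- The strictification 2-functor. -/
noncomputable def strictification : StrictPseudofunctor (PsAlg O) (AlgSt O) :=
  StrictPseudofunctor.mk''
    { obj := fun A => A.st
      map := fun F => stMap F
      map₂ := fun α => stMap₂ α
      map₂_id := fun {A B} F => by
        refine stMap₂_eq _ _ ?_
        refine (Category.assoc _ _ _).symm.trans ((congrArg (fun t => t ≫ B.stCarrier.ident)
          (stUnitFun_obj_stMap F)).trans ?_)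
        refine (Category.assoc _ _ _).trans (Eq.trans ?_ (Category.assoc _ _ _).symm)
        exact congrArg (fun t => F.f.obj ≫ t) B.stUnitFun.ident_mor.symm
      map₂_comp := fun {A B F G H} α β => by
        refine stMap₂_eq _ _ ?_
        refine (ICat.precomp_cmp _ A.stUnitFun.obj _ _ _).trans (Eq.trans ?_
          (ICat.cmp_mor B.stUnitFun _ _ _).symm)
        exact ICat.cmp_congr _ (stUnitFun_stMap₂_app α) (stUnitFun_stMap₂_app β)
      map_id := stMap_id
      map_comp := stMap_comp
      map₂_whisker_left := fun {A B C} F {G G'} α => by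
        refine stMap₂_eq _ _ ?_
        refine (congrArg (fun t => A.stUnitFun.obj ≫ t) ((AlgSt.eqToHom_comp_app _ _).trans
          (AlgSt.comp_eqToHom_app _ _))).trans ?_
        refine (Category.assoc _ _ _).symm.trans ((congrArg (fun t => t ≫ (stMap₂ α).τ.app)
          (stUnitFun_obj_stMap F)).trans ?_)
        refine (Category.assoc _ _ _).trans ((congrArg (fun t => F.f.obj ≫ t)
          (stUnitFun_stMap₂_app α)).trans (Category.assoc _ _ _).symm)
      map₂_whisker_right := fun {A B C F F'} α G => by
        refine stMap₂_eq _ _ ?_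
        refine (congrArg (fun t => A.stUnitFun.obj ≫ t) ((AlgSt.eqToHom_comp_app _ _).trans
          (AlgSt.comp_eqToHom_app _ _))).trans ?_
        refine (Category.assoc _ _ _).symm.trans ((congrArg (fun t => t ≫ (stMap G).mor.f.mor)
          (stUnitFun_stMap₂_app α)).trans ?_)
        refine (Category.assoc _ _ _).trans ((congrArg (fun t => α.τ.app ≫ t)
          (stUnitFun_mor_stMap G)).trans (Category.assoc _ _ _).symm) }

/-! ### The 2-adjunction -/

/-- The unit of the strictification 2-adjunction. -/
noncomputable def stUnitTrans :
    TwoNatTrans (StrictPseudofunctor.id (PsAlg O)) ((strictification O).comp (AlgSt.inclusion O)) where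
  app A := A.stUnit
  naturality F := (stUnit_stMap F).symm
  naturality₂ {A B F G} α := by
    refine cell_ext ?_
    refine (cell_comp_eqToHom_app _ _).trans (Eq.trans ?_ (cell_eqToHom_comp_app _ _).symm)
    exact (stUnitFun_stMap₂_app α).symm

/-- The strict map from the strictification of a strict algebra to the algebra. -/
noncomputable def stCounitMor (B : AlgSt O) : B.alg.st ⟶ B := stDesc (𝟙 B.alg)

variable {O}

theorem stUnit_stCounitMor (B : AlgSt O) : B.alg.stUnit ≫ (stCounitMor O B).mor = 𝟙 B.alg :=
  stUnit_stDesc _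

/-- Both strict maps restrict to G along the unit of B. -/
theorem stCounitMor_naturality {B C : AlgSt O} (G : B ⟶ C) :
    stMap G.mor ≫ stCounitMor O C = stCounitMor O B ≫ G := by
  refine st_hom_ext ?_
  refine (Category.assoc B.alg.stUnit (stMap G.mor).mor (stCounitMor O C).mor).symm.trans
    (Eq.trans ?_ (Category.assoc B.alg.stUnit (stCounitMor O B).mor G.mor))
  rw [stUnit_stMap, stUnit_stCounitMor, Category.assoc, stUnit_stCounitMor, Category.comp_id,
    Category.id_comp]

variable (O)

/-- The counit of the strictification 2-adjunction. -/
noncomputable def stCounitTrans :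
    TwoNatTrans ((AlgSt.inclusion O).comp (strictification O)) (StrictPseudofunctor.id (AlgSt O)) where
  app B := stCounitMor O B
  naturality G := stCounitMor_naturality G
  naturality₂ {B C G G'} α := by
    have h₁ := AlgSt.comp_eqToHom_app (Bicategory.whiskerRight (B := AlgSt O) (stMap₂ α :
      stMap G.mor ⟶ stMap G'.mor) (stCounitMor O C)) (stCounitMor_naturality G')
    have h₂ := AlgSt.eqToHom_comp_app (stCounitMor_naturality G)
      (Bicategory.whiskerLeft (B := AlgSt O) (stCounitMor O B) α)
    -- Both 2-cells restrict to α along the unit: the counit cancels the unit of C on one side and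
    -- the unit of B on the other.
    refine st_cell_ext ((congrArg (fun t => B.alg.stUnitFun.obj ≫ t) h₁).trans
      (Eq.trans ?_ (congrArg (fun t => B.alg.stUnitFun.obj ≫ t) h₂).symm))
    have h₃ : C.alg.stUnitFun.mor ≫ (stCounitMor O C).mor.f.mor = 𝟙 C.alg.carrier.Mor :=
      congrArg (fun t : C.alg ⟶ C.alg => t.f.mor) (stUnit_stCounitMor C)
    have h₄ : B.alg.stUnitFun.obj ≫ (stCounitMor O B).mor.f.obj = 𝟙 B.alg.carrier.Ob :=
      congrArg (fun t : B.alg ⟶ B.alg => t.f.obj) (stUnit_stCounitMor B)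
    have h₅ := stUnitFun_stMap₂_app α
    refine (Category.assoc _ _ _).symm.trans ((congrArg (fun t => t ≫ (stCounitMor O C).mor.f.mor)
      h₅).trans ((Category.assoc _ _ _).trans ((congrArg (fun t => α.τ.app ≫ t) h₃).trans ?_)))
    refine (Category.comp_id _).trans ((Category.id_comp _).symm.trans ?_)
    exact (congrArg (fun t => t ≫ α.τ.app) h₄).symm.trans (Category.assoc _ _ _)

/-- Strictification is left 2-adjoint to the inclusion of strict algebras. -/
noncomputable def stAdjunction : TwoAdjunction (strictification O) (AlgSt.inclusion O) where
  unit := stUnitTrans O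
  counit := stCounitTrans O
  left_triangle A := by
    -- Both sides are strict maps out of the strictification that restrict to η along η.
    refine st_hom_ext ?_
    refine (Category.assoc A.stUnit (stMap A.stUnit).mor (stCounitMor O A.st).mor).symm.trans ?_
    rw [stUnit_stMap, Category.assoc, stUnit_stCounitMor]
    rfl
  right_triangle B := stUnit_stCounitMor B

/-- The pseudo-inverse is the evaluation, which exists for every pseudoalgebra but is only a
pseudomorphism; it is not defined as the counit, whose components are strict maps out of
strictifications of strict algebras. -/
theorem isInternalEquivalence_stUnit (A : PsAlg O) : IsInternalEquivalence A.stUnit :=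
  ⟨A.stCounit, ⟨eqToIso A.stUnit_stCounit.symm⟩, ⟨A.stIso.symm⟩⟩

end PsAlg

theorem theorem0p2 {V : Type u} [Category.{v} V] [HasFiniteLimits V]
    [HasColimitsOfSize.{0, 0} V]
    (hV : ∀ (X : V) (J : Type) [SmallCategory J] [IsConnected J],
      PreservesColimitsOfShape J (prod.functor.obj X))
    (O : ReducedOperad V) :
    ∃ (St : StrictPseudofunctor (PsAlg O) (AlgSt O))
      (adj : TwoAdjunction St (AlgSt.inclusion O)),
      ∀ A : PsAlg O, IsInternalEquivalence (adj.unit.app A) := by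
  have : ProdPreservesConnectedColimits V := ⟨hV⟩
  exact ⟨PsAlg.strictification O, PsAlg.stAdjunction O, PsAlg.isInternalEquivalence_stUnit O⟩
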